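/- Assume the Riemann hypothesis. Let $\chi(s) = 2^s \pi^{s-1} \sin(\tfrac{\pi}{2}s)\,\Gamma(1-s)$ be the factor in the functional equation $\zeta(s)=\chi(s)\zeta(1-s)$, and let $Z(t) = \chi(\tfrac12 - it)^{1/2}\,\zeta(\tfrac12+it)$ for real $t$, where $\chi(\tfrac12-it)^{1/2}$ denotes the smooth branch of the square root that equals $1$ at $t=0$; then $Z$ is real-valued. There is a constant $T_0$ such that for every integer $k\ge 1$ there is a constant $c_k>0$, depending only on $k$, with $$\int_0^T Z'(t)^2\, Z(t)^{2k-2}\,dt \;\ge\; c_k\, T(\log T)^{k^2+2}\qquad\text{for all } T\ge T_0 .$$ -/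

import Mathlib

/-- The factor `χ(s) = 2^s π^(s-1) sin(π s / 2) Γ(1 - s)` of the functional equation
`ζ(s) = χ(s) ζ(1 - s)`. -/
noncomputable def zetaChi (s : ℂ) : ℂ :=
  2 ^ s * (Real.pi : ℂ) ^ (s - 1) * Complex.sin (Real.pi / 2 * s) * Complex.Gamma (1 - s)

/-- The smooth branch of `t ↦ χ(1/2 - it)^(1/2)` on the real line that equals `1` at `t = 0`,
namely the phase of `π^(-s/2) Γ(s/2)` at `s = 1/2 + it`. The lemmas `sqrtChi_sq`, `sqrtChi_zero`
and `sqrtChi_differentiable` show that it is this branch. -/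
noncomputable def sqrtChi (t : ℝ) : ℂ :=
  Complex.Gammaℝ (1 / 2 + t * Complex.I) / (‖Complex.Gammaℝ (1 / 2 + t * Complex.I)‖ : ℂ)

/-- Hardy's function `Z(t) = χ(1/2 - it)^(1/2) ζ(1/2 + it)`. The product is real, see
`hardyZ_eq`, so that taking the real part only changes its type. -/
noncomputable def hardyZ (t : ℝ) : ℝ :=
  (sqrtChi t * riemannZeta (1 / 2 + t * Complex.I)).re

theorem gammaR_half_ne_zero (t : ℝ) : Complex.Gammaℝ (1 / 2 + t * Complex.I) ≠ 0 :=
  Complex.Gammaℝ_ne_zero_of_re_pos (by simp)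

theorem conj_gammaR (s : ℂ) :
    (starRingEnd ℂ) (Complex.Gammaℝ s) = Complex.Gammaℝ ((starRingEnd ℂ) s) := by
  have hpi : (Real.pi : ℂ).arg ≠ Real.pi := by
    rw [Complex.arg_ofReal_of_nonneg Real.pi_pos.le]
    exact Real.pi_pos.ne
  have h := Complex.cpow_conj (Real.pi : ℂ) (-s / 2) hpi
  rw [Complex.conj_ofReal] at h
  rw [Complex.Gammaℝ_def, Complex.Gammaℝ_def, map_mul, ← h, ← Complex.Gamma_conj]
  simp only [map_div₀, map_neg, map_ofNat]

theorem conj_half (t : ℝ) :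
    (starRingEnd ℂ) (1 / 2 + t * Complex.I) = 1 - (1 / 2 + t * Complex.I) := by
  simp only [map_add, map_mul, map_div₀, map_one, map_ofNat, Complex.conj_ofReal, Complex.conj_I]
  ring

theorem sqrtChi_sq (t : ℝ) : sqrtChi t ^ 2 = zetaChi (1 / 2 - t * Complex.I) := by
  set s : ℂ := 1 / 2 + t * Complex.I with hs
  have hre : s.re = 1 / 2 := by simp [hs]
  have h0 := gammaR_half_ne_zero t
  have hq : sqrtChi t ^ 2 = Complex.Gammaℝ s / Complex.Gammaℝ (1 - s) := by
    have hc : (‖Complex.Gammaℝ s‖ : ℂ) ^ 2 = Complex.Gammaℝ s * Complex.Gammaℝ (1 - s) := by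
      rw [← conj_half t, ← conj_gammaR, Complex.mul_conj, Complex.normSq_eq_norm_sq]
      push_cast
      rfl
    rw [sqrtChi, div_pow, hc, sq, mul_div_mul_left _ _ h0]
  have hodd : ∀ n : ℕ, s ≠ -(2 * n + 1) := by
    intro n hn
    have := congrArg Complex.re hn
    rw [hre] at this
    simp at this
    have hn0 : (0 : ℝ) ≤ n := n.cast_nonneg
    linarith
  rw [hq, Complex.Gammaℝ_div_Gammaℝ_one_sub hodd, zetaChi,
    show (1 / 2 - t * Complex.I : ℂ) = 1 - s by rw [hs]; ring, Complex.Gammaℂ_def]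
  have hsin : Complex.sin (Real.pi / 2 * (1 - s)) = Complex.cos (Real.pi * s / 2) := by
    rw [← Complex.sin_pi_div_two_sub]
    congr 1
    ring
  have hmul : ((2 : ℂ) * Real.pi) ^ (-s) = 2 ^ (-s) * (Real.pi : ℂ) ^ (-s) := by
    have := Complex.mul_cpow_ofReal_nonneg (a := 2) (b := Real.pi) (by norm_num)
      Real.pi_pos.le (-s)
    simpa using this
  rw [hsin, hmul, show (1 : ℂ) - s - 1 = -s by ring, show (1 : ℂ) - (1 - s) = s by ring,
    show (1 : ℂ) - s = 1 + -s by ring, Complex.cpow_add _ _ two_ne_zero, Complex.cpow_one]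
  ring

theorem sqrtChi_zero : sqrtChi 0 = 1 := by
  have h0 := gammaR_half_ne_zero 0
  have hr : (1 / 2 : ℂ) = ((1 / 2 : ℝ) : ℂ) := by push_cast; rfl
  have hpos : Complex.Gammaℝ (1 / 2 + (0 : ℝ) * Complex.I)
      = ((Real.pi ^ (-(1 / 2 : ℝ) / 2) * Real.Gamma ((1 / 2 : ℝ) / 2) : ℝ) : ℂ) := by
    rw [Complex.Gammaℝ_def, Complex.ofReal_mul, Complex.ofReal_cpow Real.pi_pos.le,
      ← Complex.Gamma_ofReal]
    push_cast
    simp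
  have hnn : 0 ≤ Real.pi ^ (-(1 / 2 : ℝ) / 2) * Real.Gamma ((1 / 2 : ℝ) / 2) :=
    mul_nonneg (Real.rpow_nonneg Real.pi_pos.le _) (Real.Gamma_pos_of_pos (by norm_num)).le
  rw [sqrtChi]
  rw [hpos] at h0 ⊢
  rw [Complex.norm_real, Real.norm_of_nonneg hnn, div_self h0]

theorem sqrtChi_differentiable : Differentiable ℝ sqrtChi := by
  have hG : Differentiable ℝ fun t : ℝ => Complex.Gammaℝ (1 / 2 + t * Complex.I) := by
    intro t
    have h1 : DifferentiableAt ℂ Complex.Gammaℝ (1 / 2 + t * Complex.I) := by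
      have h2 := (Complex.differentiable_Gammaℝ_inv (1 / 2 + t * Complex.I)).inv
        (inv_ne_zero (gammaR_half_ne_zero t))
      have h4 : (fun s : ℂ => (Complex.Gammaℝ s)⁻¹)⁻¹ = Complex.Gammaℝ := by
        ext s
        simp
      rwa [h4] at h2
    have h3 : DifferentiableAt ℝ (fun t : ℝ => (1 / 2 + t * Complex.I : ℂ)) t :=
      (Complex.ofRealCLM.differentiableAt.mul_const _).const_add _
    exact (h1.restrictScalars ℝ).comp t h3
  intro t
  have hn : DifferentiableAt ℝ (fun t : ℝ => ‖Complex.Gammaℝ (1 / 2 + t * Complex.I)‖) t :=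
    (hG t).norm ℝ (gammaR_half_ne_zero t)
  have hn' : DifferentiableAt ℝ
      (fun t : ℝ => (‖Complex.Gammaℝ (1 / 2 + t * Complex.I)‖ : ℂ)) t :=
    Complex.ofRealCLM.differentiableAt.comp t hn
  exact (hG t).div hn' (by simpa using gammaR_half_ne_zero t)

theorem hardyZ_eq (t : ℝ) :
    (hardyZ t : ℂ) = sqrtChi t * riemannZeta (1 / 2 + t * Complex.I) := by
  set s : ℂ := 1 / 2 + t * Complex.I with hs
  have hs0 : s ≠ 0 := by
    intro h
    have := congrArg Complex.re h
    simp [hs] at this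
  have hs1 : 1 - s ≠ 0 := by
    intro h
    have := congrArg Complex.re h
    norm_num [hs] at this
  have h0 := gammaR_half_ne_zero t
  have h1 : Complex.Gammaℝ (1 - s) ≠ 0 := Complex.Gammaℝ_ne_zero_of_re_pos (by norm_num [hs])
  have hp : sqrtChi t * riemannZeta s = completedRiemannZeta s / (‖Complex.Gammaℝ s‖ : ℂ) := by
    rw [sqrtChi, riemannZeta_def_of_ne_zero hs0, div_mul_div_comm, mul_comm,
      mul_div_mul_right _ _ h0]
  have hreal : (starRingEnd ℂ) (completedRiemannZeta s) = completedRiemannZeta s := by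
    have e1 : completedRiemannZeta s = Complex.Gammaℝ s * riemannZeta s := by
      rw [riemannZeta_def_of_ne_zero hs0, mul_div_cancel₀ _ h0]
    have e2 : completedRiemannZeta (1 - s) = Complex.Gammaℝ (1 - s) * riemannZeta (1 - s) := by
      rw [riemannZeta_def_of_ne_zero hs1, mul_div_cancel₀ _ h1]
    rw [e1, map_mul, conj_gammaR, ← riemannZeta_conj, conj_half, ← e2,
      completedRiemannZeta_one_sub, e1]
  refine Complex.conj_eq_iff_re.mp ?_
  rw [← hs, hp, map_div₀, hreal, Complex.conj_ofReal]

/-! The proof is a duality argument against a short Dirichlet polynomial. On the critical line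
`hardyZ` is ζ times a unimodular factor whose logarithmic derivative is i times `thetaDeriv`. Hence
Z'² Z^(2k-2) is, up to the factor k², the squared modulus of G = k θ' ζ^k + (ζ^k)', which is
`zetaPowDeriv`; see `norm_zetaPowDeriv_sq`. The function G is holomorphic off the real axis, so
contours can be shifted.

Put X = T^(1/64) and let A(s) be the sum of d_k(n) n^(s-1) over n ≤ N, where N ≤ X. On the critical
line A is the conjugate of a partial sum of ζ^k. With a Gaussian weight of width Δ = X^16 centred at
τ in [T/2, 3T/4], the integral of G A is moved to Re s = 2. There θ' varies so slowly that it may be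
frozen at its value κ at the centre, and what remains of G is an absolutely convergent Dirichlet
series. Since Δ is much larger than N, the Gaussian keeps only the diagonal, so the twisted moment
is √π Δ times the sum of d_k(n)²/n (kκ - log n), up to a small error
(`exists_norm_integral_half_sub_le`). By the asymptotics of the digamma function, Re κ is at least
16 log X, while log n ≤ log X; the main term is therefore at least of size Δ (log X) S, with S the
sum of d_k(n)²/n over n ≤ N. The Gaussian mean square of A is at most 2 √π Δ S by the same diagonal
argument.

Expanding (|G| - λ|A|)² ≥ 0 with λ = 2k log X gives a lower bound of order Δ (log X)² S for the
Gaussian mean square of G (`exists_le_integral_gauss_mul_norm_sq`), and averaging over τ removes the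
weight. Finally S is at least of order (log X)^(k²): d_k² agrees with d_{k²} on squarefree numbers,
square factors cost only a convergent series, and logarithmic sums of d_K are bounded below by
products of harmonic sums.

This gives the bound for T beyond a threshold depending on k. A threshold common to all k comes from
positivity: Z' cannot vanish identically on the interval obtained for k = 1, which makes every other
moment over that interval positive. -/

/-! ### Piltz divisor functions and their logarithmic sums -/

/-- The Piltz divisor function: the number of ordered factorizations of `n` into `k` factors. -/
def piltz (k n : ℕ) : ℕ := (ArithmeticFunction.zeta ^ k : ArithmeticFunction ℕ) n

theorem piltz_zero_right (k : ℕ) : piltz k 0 = 0 := by simp [piltz]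

theorem piltz_one_right (k : ℕ) : piltz k 1 = 1 := by
  induction k with
  | zero => simp [piltz]
  | succ k ih =>
    rw [piltz] at ih ⊢
    rw [pow_succ, ArithmeticFunction.mul_zeta_apply]
    simpa using ih

theorem piltz_add (j k n : ℕ) :
    piltz (j + k) n = ∑ x ∈ n.divisorsAntidiagonal, piltz j x.1 * piltz k x.2 := by
  rw [piltz, pow_add, ArithmeticFunction.mul_apply]
  rfl

theorem piltz_one_left {n : ℕ} (hn : n ≠ 0) : piltz 1 n = 1 := by
  simp [piltz, hn]

theorem piltz_succ (k n : ℕ) : piltz (k + 1) n = ∑ d ∈ n.divisors, piltz k d := by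
  rw [piltz, pow_succ, ArithmeticFunction.mul_zeta_apply]
  rfl

theorem piltz_mul_of_coprime (k : ℕ) {a b : ℕ} (h : a.Coprime b) :
    piltz k (a * b) = piltz k a * piltz k b := by
  have : (ArithmeticFunction.zeta ^ k : ArithmeticFunction ℕ).IsMultiplicative := by
    induction k with
    | zero => simp
    | succ k ih => rw [pow_succ]; exact ih.mul ArithmeticFunction.isMultiplicative_zeta
  exact this.map_mul_of_coprime h

theorem sum_image_le_sum_comp {α β : Type*} [DecidableEq β] (s : Finset α) (g : α → β)
    (f : β → ℝ) (hf : ∀ b, 0 ≤ f b) : ∑ b ∈ s.image g, f b ≤ ∑ a ∈ s, f (g a) := by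
  classical
  induction s using Finset.induction_on with
  | empty => simp
  | insert a s ha ih =>
    rw [Finset.image_insert, Finset.sum_insert ha]
    by_cases h : g a ∈ s.image g
    · rw [Finset.insert_eq_of_mem h]
      linarith [hf (g a)]
    · rw [Finset.sum_insert h]
      linarith

/-- Every divisor of ab is a product of a divisor of a and a divisor of b, possibly in several ways.
Summing over all pairs can only overcount, and induction on k finishes. -/
theorem piltz_mul_le (k a b : ℕ) : piltz k (a * b) ≤ piltz k a * piltz k b := by
  induction k generalizing a b with
  | zero =>
    by_cases h : a * b = 1
    · have := Nat.eq_one_of_mul_eq_one_right h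
      have := Nat.eq_one_of_mul_eq_one_left h
      simp_all [piltz]
    · simp [piltz, ArithmeticFunction.one_apply, h]
  | succ k ih =>
    simp only [piltz_succ]
    rw [Nat.divisors_mul, Finset.sum_mul_sum, ← Finset.sum_product']
    have h := sum_image_le_sum_comp (a.divisors ×ˢ b.divisors) (fun x => x.1 * x.2)
      (fun n => (piltz k n : ℝ)) (fun _ => Nat.cast_nonneg _)
    have h' : ∑ n ∈ (a.divisors ×ˢ b.divisors).image (fun x => x.1 * x.2), piltz k n
        ≤ ∑ x ∈ a.divisors ×ˢ b.divisors, piltz k (x.1 * x.2) := by exact_mod_cast h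
    exact h'.trans (Finset.sum_le_sum fun x _ => ih _ _)

/-- Induction on j: expand one factor over n = x₁x₂ and split d_k(x₁x₂) by submultiplicativity, so
that the induction hypothesis applies at x₁. -/
theorem piltz_mul_piltz_le (j k n : ℕ) : piltz j n * piltz k n ≤ piltz (j * k) n := by
  induction j generalizing n with
  | zero =>
    by_cases h : n = 1
    · simp [h, piltz_one_right]
    · simp [piltz, h]
  | succ j ih =>
    rcases eq_or_ne n 0 with rfl | hn
    · simp [piltz_zero_right]
    rw [add_mul, one_mul, piltz_add, piltz_add, Finset.sum_mul]
    refine Finset.sum_le_sum fun x hx => ?_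
    obtain ⟨hx, -⟩ := Nat.mem_divisorsAntidiagonal.1 hx
    have h2 : x.2 ≠ 0 := by rintro h; simp [h] at hx; omega
    rw [piltz_one_left h2, mul_one, ← hx]
    calc piltz j x.1 * piltz k (x.1 * x.2) ≤ piltz j x.1 * (piltz k x.1 * piltz k x.2) :=
          Nat.mul_le_mul_left _ (piltz_mul_le _ _ _)
      _ = piltz j x.1 * piltz k x.1 * piltz k x.2 := by ring
      _ ≤ _ := Nat.mul_le_mul_right _ (ih _)

/-- The induction of the preceding inequality becomes exact here, since complementary divisors of a
squarefree number are coprime and d_k is multiplicative. -/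
theorem piltz_mul_eq_of_squarefree (j k : ℕ) {n : ℕ} (hn : Squarefree n) :
    piltz (j * k) n = piltz j n * piltz k n := by
  induction j generalizing n with
  | zero =>
    by_cases h : n = 1
    · simp [h, piltz_one_right]
    · simp [piltz, h]
  | succ j ih =>
    rw [add_mul, one_mul, piltz_add, piltz_add, Finset.sum_mul]
    refine Finset.sum_congr rfl fun x hx => ?_
    obtain ⟨hx, -⟩ := Nat.mem_divisorsAntidiagonal.1 hx
    have h2 : x.2 ≠ 0 := by rintro h; simp [h] at hx; exact hn.ne_zero hx.symm
    have hx1 : Squarefree x.1 := hn.squarefree_of_dvd ⟨x.2, hx.symm⟩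
    have hc : x.1.Coprime x.2 := Nat.coprime_of_squarefree_mul (hx ▸ hn)
    rw [piltz_one_left h2, mul_one, ← hx, ih hx1, piltz_mul_of_coprime k hc]
    ring

theorem LSeriesHasSum_piltz (k : ℕ) {s : ℂ} (hs : 1 < s.re) :
    LSeriesHasSum (fun n => (piltz k n : ℂ)) s (riemannZeta s ^ k) := by
  induction k with
  | zero =>
    have h : (fun n => (piltz 0 n : ℂ)) = LSeries.delta := by
      ext n
      simp [piltz, ArithmeticFunction.one_apply, LSeries.delta]
    rw [h, LSeriesHasSum, pow_zero, funext (LSeries.term_delta s)]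
    exact hasSum_ite_eq 1 1
  | succ k ih =>
    have h := ih.convolution (ArithmeticFunction.LSeriesHasSum_zeta hs)
    rw [pow_succ]
    refine (LSeriesHasSum_congr s _ (fun {n} hn => ?_)).1 h
    rw [LSeries.convolution_def, piltz_add, Nat.cast_sum]
    refine Finset.sum_congr rfl fun x _ => ?_
    simp only [Nat.cast_mul, piltz, pow_one]

/-- Grouping pairs by their product n, the pairs with first entry at most a and second at most b
form only some of the factorizations of n counted by the convolution d_K * 1. -/
theorem sum_piltz_div_mul_le (K a b : ℕ) :
    (∑ n ∈ Finset.Icc 1 a, (piltz K n : ℝ) / n) * ∑ n ∈ Finset.Icc 1 b, (1 : ℝ) / n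
      ≤ ∑ n ∈ Finset.Icc 1 (a * b), (piltz (K + 1) n : ℝ) / n := by
  rw [Finset.sum_mul_sum, ← Finset.sum_product']
  rw [← Finset.sum_fiberwise_of_maps_to (g := fun x : ℕ × ℕ => x.1 * x.2)
    (t := Finset.Icc 1 (a * b))]
  · refine Finset.sum_le_sum fun n hn => ?_
    rw [piltz_add, Nat.cast_sum, Finset.sum_div]
    refine (Finset.sum_le_sum_of_subset_of_nonneg (t := n.divisorsAntidiagonal)
      (f := fun x : ℕ × ℕ => (piltz K x.1 : ℝ) / x.1 * (1 / x.2)) ?_ ?_).trans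
      (Finset.sum_le_sum ?_)
    · intro x hx
      simp only [Finset.mem_filter, Nat.mem_divisorsAntidiagonal, Finset.mem_Icc] at *
      exact ⟨hx.2, by omega⟩
    · intros; positivity
    · intro x hx
      obtain ⟨hx, h0⟩ := Nat.mem_divisorsAntidiagonal.1 hx
      have h2 : x.2 ≠ 0 := by rintro h; simp [h] at hx; omega
      rw [piltz_one_left h2, ← hx]
      push_cast
      rw [div_mul_div_comm]
  · intro x hx
    simp only [Finset.mem_product, Finset.mem_Icc] at *
    exact ⟨Nat.mul_pos hx.1.1 hx.2.1, Nat.mul_le_mul hx.1.2 hx.2.2⟩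

/-- Restricting each of the K factors to at most M leaves a K-th power of a harmonic sum. The price
is that the range of summation has to be M^K. -/
theorem log_pow_le_sum_piltz_div (K M : ℕ) (hM : 1 ≤ M) :
    Real.log M ^ K ≤ ∑ n ∈ Finset.Icc 1 (M ^ K), (piltz K n : ℝ) / n := by
  induction K with
  | zero => simp [piltz]
  | succ K ih =>
    rw [pow_succ, pow_succ]
    refine le_trans ?_ (sum_piltz_div_mul_le _ _ _)
    have hl : 0 ≤ Real.log M := Real.log_natCast_nonneg M
    have hh : Real.log M ≤ ∑ n ∈ Finset.Icc 1 M, (1 : ℝ) / n := by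
      have h := log_add_one_le_harmonic M
      rw [harmonic_eq_sum_Icc] at h
      push_cast at h
      have : Real.log M ≤ Real.log (M + 1) := Real.log_le_log (by positivity) (by linarith)
      simp only [one_div]
      linarith
    exact mul_le_mul ih hh hl (by positivity)

theorem summable_piltz_div_sq (k : ℕ) : Summable fun n : ℕ => (piltz k n : ℝ) / (n : ℝ) ^ 2 := by
  have h := (LSeriesHasSum_piltz k (s := 2) (by norm_num)).LSeriesSummable.norm
  refine h.congr fun n => ?_
  rcases eq_or_ne n 0 with rfl | hn
  · simp
  · rw [LSeries.term_of_ne_zero hn]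
    simp

theorem piltz_sq_eq_of_squarefree (k : ℕ) {n : ℕ} (hn : Squarefree n) :
    (piltz k n : ℝ) ^ 2 = piltz (k ^ 2) n := by
  rw [sq k, piltz_mul_eq_of_squarefree _ _ hn]
  push_cast
  ring

/-- The mean square of the Piltz function, with the logarithmic weight, has at least the order of
magnitude of the sum of `piltz (k ^ 2)`. -/
theorem exists_sum_piltz_le_mul_sum_piltz_sq (k : ℕ) : ∃ C : ℝ, 0 < C ∧ ∀ N : ℕ,
    ∑ n ∈ Finset.Icc 1 N, (piltz (k ^ 2) n : ℝ) / n
      ≤ C * ∑ n ∈ Finset.Icc 1 N, (piltz k n : ℝ) ^ 2 / n := by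
  have hs := summable_piltz_div_sq (k ^ 2 * k ^ 2)
  -- The constant is the total contribution of the square parts r² of the integers n, majorized by
  -- the convergent series of d_{k⁴}(r)/r².
  refine ⟨1 + ∑' n : ℕ, (piltz (k ^ 2 * k ^ 2) n : ℝ) / (n : ℝ) ^ 2, ?_, fun N => ?_⟩
  · have : 0 ≤ ∑' n : ℕ, (piltz (k ^ 2 * k ^ 2) n : ℝ) / (n : ℝ) ^ 2 :=
      tsum_nonneg fun n => by positivity
    linarith
  -- Pairs (m, r) with m squarefree, standing for n = r²m. On m the functions d_{k²} and d_k² agree,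
  -- and d_{k²}(r²) ≤ d_{k²}(r)² ≤ d_{k⁴}(r).
  set P := (Finset.Icc 1 N).filter Squarefree ×ˢ Finset.Icc 1 N with hP
  have h1 : ∑ n ∈ Finset.Icc 1 N, (piltz (k ^ 2) n : ℝ) / n
      ≤ ∑ x ∈ P, (piltz (k ^ 2) (x.2 ^ 2 * x.1) : ℝ) / (x.2 ^ 2 * x.1 : ℕ) := by
    refine (Finset.sum_le_sum_of_subset_of_nonneg (t := P.image fun x => x.2 ^ 2 * x.1) ?_ ?_).trans
      (sum_image_le_sum_comp P (fun x => x.2 ^ 2 * x.1)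
        (fun n => (piltz (k ^ 2) n : ℝ) / n) fun n => by positivity)
    · intro n hn
      obtain ⟨hn1, hn2⟩ := Finset.mem_Icc.1 hn
      obtain ⟨a, b, ha, hb, hab, hsq⟩ := Nat.sq_mul_squarefree_of_pos (n := n) (by omega)
      simp only [hP, Finset.mem_image, Finset.mem_product, Finset.mem_filter, Finset.mem_Icc]
      refine ⟨(a, b), ⟨⟨⟨ha, ?_⟩, hsq⟩, hb, ?_⟩, hab⟩
      · exact (Nat.le_of_dvd (by omega) ⟨b ^ 2, by rw [← hab]; ring⟩).trans hn2
      · exact (Nat.le_of_dvd (by omega) ⟨b * a, by rw [← hab]; ring⟩).trans hn2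
    · intros; positivity
  have h2 : ∑ x ∈ P, (piltz (k ^ 2) (x.2 ^ 2 * x.1) : ℝ) / (x.2 ^ 2 * x.1 : ℕ)
      ≤ (∑ m ∈ (Finset.Icc 1 N).filter Squarefree, (piltz k m : ℝ) ^ 2 / m) *
        ∑ r ∈ Finset.Icc 1 N, (piltz (k ^ 2 * k ^ 2) r : ℝ) / (r : ℝ) ^ 2 := by
    rw [Finset.sum_mul_sum, ← Finset.sum_product']
    refine Finset.sum_le_sum fun x hx => ?_
    simp only [hP, Finset.mem_product, Finset.mem_filter, Finset.mem_Icc] at hx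
    rw [piltz_sq_eq_of_squarefree k hx.1.2, div_mul_div_comm]
    have e : ((x.2 ^ 2 * x.1 : ℕ) : ℝ) = (x.1 : ℝ) * (x.2 : ℝ) ^ 2 := by push_cast; ring
    rw [e]
    have hle : piltz (k ^ 2) (x.2 ^ 2 * x.1) ≤ piltz (k ^ 2) x.1 * piltz (k ^ 2 * k ^ 2) x.2 :=
      calc _ ≤ piltz (k ^ 2) (x.2 ^ 2) * piltz (k ^ 2) x.1 := piltz_mul_le _ _ _
        _ ≤ piltz (k ^ 2 * k ^ 2) x.2 * piltz (k ^ 2) x.1 := by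
          refine Nat.mul_le_mul_right _ ?_
          rw [sq x.2]
          exact (piltz_mul_le _ _ _).trans (piltz_mul_piltz_le _ _ _)
        _ = _ := mul_comm _ _
    gcongr
    exact_mod_cast hle
  have h3 : ∑ m ∈ (Finset.Icc 1 N).filter Squarefree, (piltz k m : ℝ) ^ 2 / m
      ≤ ∑ n ∈ Finset.Icc 1 N, (piltz k n : ℝ) ^ 2 / n :=
    Finset.sum_le_sum_of_subset_of_nonneg (Finset.filter_subset _ _) fun _ _ _ => by positivity
  have h4 : ∑ r ∈ Finset.Icc 1 N, (piltz (k ^ 2 * k ^ 2) r : ℝ) / (r : ℝ) ^ 2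
      ≤ 1 + ∑' n : ℕ, (piltz (k ^ 2 * k ^ 2) n : ℝ) / (n : ℝ) ^ 2 := by
    have := hs.sum_le_tsum (Finset.Icc 1 N) fun n _ => by positivity
    linarith
  calc _ ≤ _ := h1
    _ ≤ _ := h2
    _ ≤ _ := mul_le_mul h3 h4 (Finset.sum_nonneg fun _ _ => by positivity)
        (Finset.sum_nonneg fun _ _ => by positivity)
    _ = _ := mul_comm _ _

/-! ### Polynomial growth of ζ and ζ' to the left of Re s = 1 -/

theorem norm_cpow_neg_sub_cpow_neg_le {a b : ℝ} (ha : 0 < a) (hab : a ≤ b) {s : ℂ}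
    (hs : 0 < s.re) :
    ‖(b : ℂ) ^ (-s) - (a : ℂ) ^ (-s)‖ ≤ ‖s‖ * a ^ (-s.re - 1) * (b - a) := by
  have hs0 : -s ≠ 0 := by
    intro h
    rw [neg_eq_zero.1 h] at hs
    simp at hs
  have h := Convex.norm_image_sub_le_of_norm_hasDerivWithin_le (s := Set.Icc a b)
    (f := fun x : ℝ => (x : ℂ) ^ (-s)) (f' := fun x : ℝ => -s * (x : ℂ) ^ (-s - 1)) (x := a) (y := b)
    (C := ‖s‖ * a ^ (-s.re - 1))
    (fun x hx => (hasDerivAt_ofReal_cpow_const (ha.trans_le hx.1).ne' hs0).hasDerivWithinAt)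
    (fun x hx => by
      rw [norm_mul, norm_neg, Complex.norm_cpow_eq_rpow_re_of_pos (ha.trans_le hx.1)]
      refine mul_le_mul_of_nonneg_left ?_ (norm_nonneg _)
      simpa using Real.rpow_le_rpow_of_nonpos ha hx.1 (by linarith : -s.re - 1 ≤ 0))
    (convex_Icc a b) ⟨le_rfl, hab⟩ ⟨hab, le_rfl⟩
  rwa [Real.norm_of_nonneg (sub_nonneg.2 hab)] at h

/-- The terms of the Euler–Maclaurin type expansion of `(s - 1) ζ(s) - 1`. -/
noncomputable def zetaTerm (n : ℕ) (s : ℂ) : ℂ :=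
  (s - 1) * ((n + 1 : ℝ) : ℂ) ^ (-s) +
    (((n + 2 : ℝ) : ℂ) ^ (1 - s) - ((n + 1 : ℝ) : ℂ) ^ (1 - s))

theorem differentiable_zetaTerm (n : ℕ) : Differentiable ℂ (zetaTerm n) := by
  have h1 : ((n + 1 : ℝ) : ℂ) ≠ 0 := Complex.ofReal_ne_zero.2 (by positivity)
  have h2 : ((n + 2 : ℝ) : ℂ) ≠ 0 := Complex.ofReal_ne_zero.2 (by positivity)
  intro s
  unfold zetaTerm
  refine DifferentiableAt.add (DifferentiableAt.mul (by fun_prop) ?_) (DifferentiableAt.sub ?_ ?_)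
  · exact DifferentiableAt.const_cpow (by fun_prop) (Or.inl h1)
  · exact DifferentiableAt.const_cpow (by fun_prop) (Or.inl h2)
  · exact DifferentiableAt.const_cpow (by fun_prop) (Or.inl h1)

/-- With a = n + 1, the term is the increment of x^(1-s) over [a, a + 1] minus that of its tangent
at a. The mean value inequality is applied to the difference, whose derivative is -(s-1)(x^(-s) -
a^(-s)). The exponent 9/8 is 1 + Re s at the edge of the half-plane. -/
theorem norm_zetaTerm_le (n : ℕ) {s : ℂ} (hs : 1 / 8 < s.re) :
    ‖zetaTerm n s‖ ≤ ‖s‖ * ‖s - 1‖ * (1 / ((n + 1 : ℕ) : ℝ) ^ (9 / 8 : ℝ)) := by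
  rcases eq_or_ne s 1 with rfl | hs1
  · simp [zetaTerm]
  have hs1' : 1 - s ≠ 0 := sub_ne_zero.2 hs1.symm
  set a : ℝ := n + 1 with ha
  have ha1 : 1 ≤ a := by rw [ha]; linarith [n.cast_nonneg (α := ℝ)]
  have ha0 : 0 < a := by linarith
  have h := Convex.norm_image_sub_le_of_norm_hasDerivWithin_le (s := Set.Icc a (a + 1))
    (f := fun x : ℝ => (x : ℂ) ^ (1 - s) + (s - 1) * (a : ℂ) ^ (-s) * x)
    (f' := fun x : ℝ => (1 - s) * (x : ℂ) ^ (1 - s - 1) + (s - 1) * (a : ℂ) ^ (-s))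
    (x := a) (y := a + 1) (C := ‖s‖ * ‖s - 1‖ * a ^ (-s.re - 1))
    (fun x hx => by
      refine HasDerivAt.hasDerivWithinAt ((hasDerivAt_ofReal_cpow_const
        (ha0.trans_le hx.1).ne' hs1').add ?_)
      simpa using (Complex.ofRealCLM.hasDerivAt (x := x)).const_mul ((s - 1) * (a : ℂ) ^ (-s)))
    (fun x hx => by
      have e : (1 - s) * (x : ℂ) ^ (1 - s - 1) + (s - 1) * (a : ℂ) ^ (-s)
          = -(s - 1) * ((x : ℂ) ^ (-s) - (a : ℂ) ^ (-s)) := by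
        rw [show 1 - s - 1 = -s by ring]; ring
      rw [e, norm_mul, norm_neg]
      have := norm_cpow_neg_sub_cpow_neg_le ha0 hx.1 (s := s) (by linarith)
      calc _ ≤ ‖s - 1‖ * (‖s‖ * a ^ (-s.re - 1) * (x - a)) := by gcongr
        _ ≤ ‖s - 1‖ * (‖s‖ * a ^ (-s.re - 1) * 1) := by gcongr; linarith [hx.2]
        _ = _ := by ring)
    (convex_Icc _ _) ⟨le_rfl, by linarith⟩ ⟨by linarith, le_rfl⟩
  have e : zetaTerm n s = (((a + 1 : ℝ) : ℂ) ^ (1 - s) + (s - 1) * (a : ℂ) ^ (-s) * ((a + 1 : ℝ) : ℂ))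
      - ((a : ℂ) ^ (1 - s) + (s - 1) * (a : ℂ) ^ (-s) * a) := by
    rw [zetaTerm, ← ha, show (n + 2 : ℝ) = a + 1 by rw [ha]; ring]
    push_cast
    ring
  rw [e]
  refine h.trans ?_
  rw [add_sub_cancel_left, norm_one, mul_one]
  refine mul_le_mul_of_nonneg_left ?_ (by positivity)
  rw [one_div, ← Real.rpow_neg (by positivity), show ((n + 1 : ℕ) : ℝ) = a by rw [ha]; push_cast; rfl]
  exact Real.rpow_le_rpow_of_exponent_le ha1 (by linarith)

theorem summable_one_div_succ_rpow :
    Summable fun n : ℕ => 1 / ((n + 1 : ℕ) : ℝ) ^ (9 / 8 : ℝ) :=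
  (summable_nat_add_iff 1).2 (Real.summable_one_div_nat_rpow.2 (by norm_num))

theorem summable_zetaTerm {s : ℂ} (hs : 1 / 8 < s.re) : Summable fun n => zetaTerm n s :=
  Summable.of_norm_bounded (summable_one_div_succ_rpow.mul_left _) fun n => norm_zetaTerm_le n hs

/-- The increments of x^(1-s) telescope, and the boundary term (N+1)^(1-s) tends to 0 for Re s > 1.
-/
theorem tsum_zetaTerm_of_one_lt_re {s : ℂ} (hs : 1 < s.re) :
    ∑' n, zetaTerm n s = riemannZeta₁ s - 1 := by
  have hs1 : s ≠ 1 := by rintro rfl; simp at hs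
  have h1 := (summable_zetaTerm (s := s) (by linarith)).hasSum.tendsto_sum_nat
  have hz : HasSum (fun n : ℕ => 1 / ((n : ℂ) + 1) ^ s) (riemannZeta s) := by
    rw [zeta_eq_tsum_one_div_nat_add_one_cpow hs]
    have := (summable_nat_add_iff 1).2 (Complex.summable_one_div_nat_cpow.2 hs)
    push_cast at this
    exact this.hasSum
  have h2 := ((hz.tendsto_sum_nat.const_mul (s - 1)).sub_const 1)
  have h3 : Filter.Tendsto (fun N : ℕ => ((N + 1 : ℝ) : ℂ) ^ (1 - s)) Filter.atTop (nhds 0) := by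
    rw [tendsto_zero_iff_norm_tendsto_zero]
    have h4 : Filter.Tendsto (fun N : ℕ => (N + 1 : ℝ) ^ (-(s.re - 1))) Filter.atTop (nhds 0) :=
      (tendsto_rpow_neg_atTop (by linarith)).comp
        (Filter.tendsto_atTop_add_const_right _ _ tendsto_natCast_atTop_atTop)
    refine h4.congr fun N => ?_
    rw [Complex.norm_cpow_eq_rpow_re_of_pos (by positivity)]
    simp
  have h5 := h2.add h3
  rw [riemannZeta_eq_inv_sub_mul hs1, mul_inv_cancel_left₀ (sub_ne_zero.2 hs1), add_zero] at h5
  refine tendsto_nhds_unique h1 (h5.congr fun N => ?_)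
  induction N with
  | zero => simp
  | succ N ih =>
    rw [Finset.sum_range_succ, Finset.sum_range_succ, ← ih, zetaTerm, Complex.cpow_neg]
    push_cast
    ring_nf

/-- Analytic continuation from Re s > 1. The half-plane is cut by a ball because the majorant of the
terms grows with ‖s‖; the resulting region is convex and contains both s and 2. -/
theorem riemannZeta₁_eq_tsum {s : ℂ} (hs : 1 / 8 < s.re) :
    riemannZeta₁ s = 1 + ∑' n, zetaTerm n s := by
  set R : ℝ := ‖s‖ + 3
  set U : Set ℂ := {z | 1 / 8 < z.re} ∩ Metric.ball 0 R with hU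
  have hopen : IsOpen U := (isOpen_lt continuous_const Complex.continuous_re).inter
    Metric.isOpen_ball
  have hconv : Convex ℝ U := (convex_halfSpace_re_gt _).inter (convex_ball _ _)
  have hd : DifferentiableOn ℂ (fun z => ∑' n, zetaTerm n z) U := by
    refine Complex.differentiableOn_tsum_of_summable_norm
      (u := fun n => R * (R + 1) * (1 / ((n + 1 : ℕ) : ℝ) ^ (9 / 8 : ℝ)))
      (summable_one_div_succ_rpow.mul_left _)
      (fun n => (differentiable_zetaTerm n).differentiableOn) hopen fun n z hz => ?_
    refine (norm_zetaTerm_le n hz.1).trans ?_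
    have h1 : ‖z‖ ≤ R := by simpa using (Metric.mem_ball.1 hz.2).le
    have h2 : ‖z - 1‖ ≤ R + 1 := (norm_sub_le _ _).trans (by simpa using h1)
    gcongr
  have h2 : (2 : ℂ) ∈ U := ⟨by norm_num, by simp [R]; linarith [norm_nonneg s]⟩
  have hsU : s ∈ U := ⟨hs, by simp [R]⟩
  have := ((hd.const_add 1).analyticOnNhd hopen).eqOn_of_preconnected_of_eventuallyEq
    (differentiable_riemannZeta₁.differentiableOn.analyticOnNhd hopen) hconv.isPreconnected h2
    (Filter.eventually_of_mem ((isOpen_lt continuous_const Complex.continuous_re).mem_nhds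
      (show (1 : ℝ) < (2 : ℂ).re by norm_num)) fun z hz => by
        simp only
        rw [tsum_zetaTerm_of_one_lt_re hz]
        ring)
  exact (this hsU).symm

/-- Polynomial growth of `ζ` to the right of the line `Re s = 1/8`. -/
theorem exists_norm_riemannZeta_le : ∃ C : ℝ, 0 < C ∧ ∀ s : ℂ, 1 / 8 < s.re → 1 / 2 ≤ |s.im| →
    ‖riemannZeta s‖ ≤ C * (1 + ‖s‖) := by
  set A := ∑' n : ℕ, 1 / ((n + 1 : ℕ) : ℝ) ^ (9 / 8 : ℝ) with hA
  have hA0 : 0 ≤ A := tsum_nonneg fun n => by positivity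
  refine ⟨2 + A, by linarith, fun s hs him => ?_⟩
  have hn : 1 / 2 ≤ ‖s - 1‖ := him.trans (by simpa using Complex.abs_im_le_norm (s - 1))
  have hs1 : s ≠ 1 := by rintro rfl; norm_num at hn
  have h1 : ‖∑' n, zetaTerm n s‖ ≤ ‖s‖ * ‖s - 1‖ * A := by
    rw [hA, ← tsum_mul_left]
    exact tsum_of_norm_bounded (summable_one_div_succ_rpow.mul_left _).hasSum
      fun n => norm_zetaTerm_le n hs
  rw [riemannZeta_eq_inv_sub_mul hs1, riemannZeta₁_eq_tsum hs, norm_mul, norm_inv,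
    inv_mul_le_iff₀ (by linarith)]
  calc _ ≤ 1 + ‖s‖ * ‖s - 1‖ * A := (norm_add_le _ _).trans (by simpa using h1)
    _ ≤ ‖s - 1‖ * ((2 + A) * (1 + ‖s‖)) := by
      nlinarith [norm_nonneg s, mul_nonneg (norm_nonneg s) (norm_nonneg (s - 1)),
        mul_nonneg hA0 (norm_nonneg (s - 1))]

/-- Cauchy's estimate on a disc of radius 1/4. For Re s ≥ 1/2 the disc stays to the right of Re =
1/8, which is why the bound for ζ was proved that far to the left. -/
theorem exists_norm_deriv_riemannZeta_le : ∃ C : ℝ, 0 < C ∧ ∀ s : ℂ, 1 / 2 ≤ s.re →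
    1 ≤ |s.im| → ‖deriv riemannZeta s‖ ≤ C * (1 + ‖s‖) := by
  obtain ⟨C, hC, h⟩ := exists_norm_riemannZeta_le
  refine ⟨8 * C, by positivity, fun s hs him => ?_⟩
  have hb : ∀ z ∈ Metric.closedBall s (1 / 4), 1 / 8 < z.re ∧ 1 / 2 ≤ |z.im| ∧
      ‖z‖ ≤ ‖s‖ + 1 / 4 := by
    intro z hz
    have hz' : ‖z - s‖ ≤ 1 / 4 := by simpa [dist_eq_norm] using hz
    have h1 := (abs_le.1 ((Complex.abs_re_le_norm (z - s)).trans hz')).1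
    have h2 := (Complex.abs_im_le_norm (z - s)).trans hz'
    rw [Complex.sub_re] at h1
    rw [Complex.sub_im] at h2
    refine ⟨by linarith, ?_, ?_⟩
    · have := abs_sub_abs_le_abs_sub s.im z.im
      rw [abs_sub_comm] at this
      linarith
    · have := norm_add_le (z - s) s
      rw [sub_add_cancel] at this
      linarith
  have hd : DiffContOnCl ℂ riemannZeta (Metric.ball s (1 / 4)) := by
    refine DifferentiableOn.diffContOnCl ?_
    rw [closure_ball _ (by norm_num)]
    intro z hz
    have hz1 : z ≠ 1 := by
      rintro rfl
      have := (hb 1 hz).2.1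
      norm_num at this
    exact (differentiableAt_riemannZeta hz1).differentiableWithinAt
  have := Complex.norm_deriv_le_of_forall_mem_sphere_norm_le (by norm_num) hd
    (C := C * (1 + (‖s‖ + 1 / 4))) fun z hz => by
      obtain ⟨h1, h2, h3⟩ := hb z (Metric.sphere_subset_closedBall hz)
      exact (h z h1 h2).trans (by gcongr)
  refine this.trans ?_
  have := norm_nonneg s
  have h0 := mul_nonneg hC.le this
  linarith

/-! ### Series for log Γ and the digamma function -/

/-- The half-plane Re z > -3/4 contains s/2 and (1-s)/2 for 1/2 ≤ Re s ≤ 2, the arguments needed for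
θ', and keeps n + 1 + z away from 0 for every n ≥ 0. -/
theorem add_one_div_four_le_norm (n : ℕ) {z : ℂ} (hz : -(3 / 4) < z.re) :
    ((n + 1 : ℕ) : ℝ) / 4 ≤ ‖(n + 1 : ℂ) + z‖ := by
  refine le_trans ?_ (Complex.re_le_norm _)
  simp
  linarith [n.cast_nonneg (α := ℝ)]

theorem log_succ_sub_log_bounds (n : ℕ) :
    (1 : ℝ) / (n + 1) - 1 / ((n + 1 : ℕ) : ℝ) ^ 2 ≤ Real.log (n + 2) - Real.log (n + 1) ∧
      Real.log (n + 2) - Real.log (n + 1) ≤ 1 / (n + 1) := by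
  have h1 : (0 : ℝ) < n + 1 := by positivity
  have h2 : (0 : ℝ) < n + 2 := by positivity
  rw [← Real.log_div h2.ne' h1.ne']
  constructor
  · refine le_trans ?_ (Real.one_sub_inv_le_log_of_pos (div_pos h2 h1))
    rw [inv_div]
    push_cast
    rw [div_sub_div _ _ h1.ne' (by positivity), one_sub_div h2.ne',
      div_le_div_iff₀ (by positivity) h2]
    nlinarith [h1]
  · refine (Real.log_le_sub_one_of_pos (div_pos h2 h1)).trans (le_of_eq ?_)
    field_simp
    ring

/-- The terms of the series for `digamma (z + 1)`. -/
noncomputable def digammaTerm (n : ℕ) (z : ℂ) : ℂ :=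
  ((Real.log (n + 2) - Real.log (n + 1) : ℝ) : ℂ) - 1 / (n + 1 + z)

theorem norm_digammaTerm_le (n : ℕ) {z : ℂ} (hz : -(3 / 4) < z.re) :
    ‖digammaTerm n z‖ ≤ (1 + 4 * ‖z‖) * (1 / ((n + 1 : ℕ) : ℝ) ^ 2) := by
  have hn : (0 : ℝ) < ((n + 1 : ℕ) : ℝ) := by positivity
  have hnz := add_one_div_four_le_norm n hz
  have hnz0 : (n + 1 : ℂ) + z ≠ 0 := norm_pos_iff.1 (lt_of_lt_of_le (by positivity) hnz)
  have hn0 : (n + 1 : ℂ) ≠ 0 := by exact_mod_cast hn.ne'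
  obtain ⟨h1, h2⟩ := log_succ_sub_log_bounds n
  have e : digammaTerm n z = ((Real.log (n + 2) - Real.log (n + 1) - 1 / (n + 1) : ℝ) : ℂ)
      + z / ((n + 1) * (n + 1 + z)) := by
    rw [digammaTerm]
    push_cast
    field_simp
    ring
  rw [e]
  refine (norm_add_le _ _).trans ?_
  have e1 : ‖((Real.log (n + 2) - Real.log (n + 1) - 1 / (n + 1) : ℝ) : ℂ)‖
      ≤ 1 / ((n + 1 : ℕ) : ℝ) ^ 2 := by
    rw [Complex.norm_real, Real.norm_eq_abs, abs_le]
    constructor <;> linarith [show (0 : ℝ) ≤ 1 / ((n + 1 : ℕ) : ℝ) ^ 2 by positivity]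
  have e2 : ‖z / ((n + 1) * (n + 1 + z))‖ ≤ 4 * ‖z‖ * (1 / ((n + 1 : ℕ) : ℝ) ^ 2) := by
    rw [norm_div, norm_mul, show ‖(n + 1 : ℂ)‖ = ((n + 1 : ℕ) : ℝ) by
      rw [← Complex.norm_natCast (n + 1)]; push_cast; rfl, div_le_iff₀ (by positivity)]
    calc ‖z‖ = 4 * ‖z‖ * (1 / ((n + 1 : ℕ) : ℝ) ^ 2) *
          (((n + 1 : ℕ) : ℝ) * (((n + 1 : ℕ) : ℝ) / 4)) := by field_simp
      _ ≤ _ := by gcongr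
  linarith

theorem summable_one_div_succ_sq : Summable fun n : ℕ => 1 / ((n + 1 : ℕ) : ℝ) ^ 2 :=
  (summable_nat_add_iff 1).2 (Real.summable_one_div_nat_pow.2 one_lt_two)

theorem summable_digammaTerm {z : ℂ} (hz : -(3 / 4) < z.re) : Summable fun n => digammaTerm n z :=
  Summable.of_norm_bounded (summable_one_div_succ_sq.mul_left _) fun n => norm_digammaTerm_le n hz

/-- The terms of the series for `log Γ(z + 1)`. -/
noncomputable def logGammaTerm (n : ℕ) (z : ℂ) : ℂ :=
  z * ((Real.log (n + 2) - Real.log (n + 1) : ℝ) : ℂ) - Complex.log (1 + z / (n + 1))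

theorem one_add_div_mem_slitPlane (n : ℕ) {z : ℂ} (hz : -(3 / 4) < z.re) :
    1 + z / (n + 1) ∈ Complex.slitPlane := by
  left
  have hn : (0 : ℝ) < (n : ℝ) + 1 := by positivity
  have e : z / (n + 1) = z / ((n + 1 : ℝ) : ℂ) := by push_cast; rfl
  rw [e, Complex.add_re, Complex.div_ofReal_re, Complex.one_re]
  have : -1 < z.re / (n + 1) := by
    rw [lt_div_iff₀ hn]
    linarith [n.cast_nonneg (α := ℝ)]
  linarith

theorem hasDerivAt_logGammaTerm (n : ℕ) {z : ℂ} (hz : -(3 / 4) < z.re) :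
    HasDerivAt (logGammaTerm n) (digammaTerm n z) z := by
  have hn0 : (n + 1 : ℂ) ≠ 0 := by exact_mod_cast n.succ_ne_zero
  have hnz0 : (n + 1 : ℂ) + z ≠ 0 :=
    norm_pos_iff.1 (lt_of_lt_of_le (by positivity) (add_one_div_four_le_norm n hz))
  have h1 := (hasDerivAt_id z).mul_const ((Real.log (n + 2) - Real.log (n + 1) : ℝ) : ℂ)
  have h2 := (((hasDerivAt_id z).div_const (n + 1 : ℂ)).const_add 1).clog
    (one_add_div_mem_slitPlane n hz)
  refine (h1.sub h2).congr_deriv ?_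
  rw [digammaTerm]
  simp only [id]
  rw [one_mul, div_div, mul_add, mul_one, mul_div_cancel₀ _ hn0]

/-- At z = 1 every term vanishes. This is the base point from which convergence of the series of
derivatives propagates to the series of logarithms. -/
theorem hasSum_logGammaTerm_one : HasSum (fun n => logGammaTerm n 1) 0 := by
  have : (fun n => logGammaTerm n 1) = fun _ => 0 := by
    ext n
    have h1 : (0 : ℝ) < n + 1 := by positivity
    have h2 : (0 : ℝ) < n + 2 := by positivity
    have e : (1 + 1 / (n + 1) : ℂ) = (((n + 2 : ℝ) / (n + 1 : ℝ) : ℝ) : ℂ) := by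
      push_cast
      have : (n + 1 : ℂ) ≠ 0 := by exact_mod_cast n.succ_ne_zero
      field_simp
      ring
    rw [logGammaTerm, e, ← Complex.ofReal_log (div_pos h2 h1).le, Real.log_div h2.ne' h1.ne']
    simp
  rw [this]
  exact hasSum_zero

theorem hasDerivAt_tsum_logGammaTerm {z : ℂ} (hz : -(3 / 4) < z.re) :
    (Summable fun n => logGammaTerm n z) ∧
    HasDerivAt (fun w => ∑' n, logGammaTerm n w) (∑' n, digammaTerm n z) z := by
  set R : ℝ := ‖z‖ + 2
  set U : Set ℂ := {w | -(3 / 4) < w.re} ∩ Metric.ball 0 R with hU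
  have hopen : IsOpen U := (isOpen_lt continuous_const Complex.continuous_re).inter
    Metric.isOpen_ball
  have hconv : Convex ℝ U := (convex_halfSpace_re_gt _).inter (convex_ball _ _)
  have hzU : z ∈ U := ⟨hz, by simp [R]⟩
  have h1U : (1 : ℂ) ∈ U := ⟨by norm_num, by simp [R]; linarith [norm_nonneg z]⟩
  have hb : ∀ n, ∀ y ∈ U, ‖digammaTerm n y‖ ≤ (1 + 4 * R) * (1 / ((n + 1 : ℕ) : ℝ) ^ 2) := by
    intro n y hy
    have : ‖y‖ ≤ R := by simpa using (Metric.mem_ball.1 hy.2).le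
    exact (norm_digammaTerm_le n hy.1).trans (by gcongr)
  exact ⟨summable_of_summable_hasDerivAt_of_isPreconnected
    (summable_one_div_succ_sq.mul_left _) hopen hconv.isPreconnected
    (fun n y hy => hasDerivAt_logGammaTerm n hy.1) hb h1U hasSum_logGammaTerm_one.summable hzU,
    hasDerivAt_tsum_of_isPreconnected (summable_one_div_succ_sq.mul_left _) hopen
    hconv.isPreconnected (fun n y hy => hasDerivAt_logGammaTerm n hy.1) hb h1U
    hasSum_logGammaTerm_one.summable hzU⟩

/-- This is Euler's limit formula with the logarithms telescoped. `Complex.GammaSeq` at index N + 1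
has N + 2 factors in its denominator while the partial sum has N terms; the two correcting factors
tend to 1. -/
theorem exp_sum_logGammaTerm (N : ℕ) {z : ℂ} (hz : -(3 / 4) < z.re) :
    Complex.exp (∑ n ∈ Finset.range N, logGammaTerm n z)
      = Complex.GammaSeq (z + 1) (N + 1) * ((1 + z / (N + 1)) * (1 + (z + 1) / (N + 1))) := by
  have hN : (N + 1 : ℂ) ≠ 0 := by exact_mod_cast N.succ_ne_zero
  have hne : ∀ n : ℕ, z + 1 + n ≠ 0 := fun n => by
    have := norm_pos_iff.1 (lt_of_lt_of_le (by positivity) (add_one_div_four_le_norm n hz))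
    convert this using 1
    ring
  have hexp : Complex.exp (∑ n ∈ Finset.range N, logGammaTerm n z)
      = Complex.exp (z * (Real.log (N + 1) : ℝ)) *
        (∏ n ∈ Finset.range N, (1 + z / (n + 1)))⁻¹ := by
    simp only [logGammaTerm]
    have e1 : ∑ n ∈ Finset.range N, (Real.log (n + 2) - Real.log (n + 1)) = Real.log (N + 1) := by
      have := Finset.sum_range_sub (fun n : ℕ => Real.log (n + 1)) N
      simp only [Nat.cast_zero, zero_add, Real.log_one, sub_zero, Nat.cast_add, Nat.cast_one] at this
      rw [← this]
      refine Finset.sum_congr rfl fun n _ => ?_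
      ring_nf
    have e2 : Complex.exp (∑ n ∈ Finset.range N, Complex.log (1 + z / (n + 1)))
        = ∏ n ∈ Finset.range N, (1 + z / (n + 1)) := by
      rw [Complex.exp_sum]
      refine Finset.prod_congr rfl fun n _ => ?_
      exact Complex.exp_log (Complex.slitPlane_ne_zero (one_add_div_mem_slitPlane n hz))
    rw [Finset.sum_sub_distrib, Complex.exp_sub, ← Finset.mul_sum, ← Complex.ofReal_sum, e1, e2,
      div_eq_mul_inv]
  have hprod : ∏ n ∈ Finset.range N, (1 + z / (n + 1))
      = (∏ n ∈ Finset.range N, (z + 1 + n)) / (N.factorial : ℂ) := by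
    rw [← Finset.prod_range_add_one_eq_factorial, Nat.cast_prod, ← Finset.prod_div_distrib]
    refine Finset.prod_congr rfl fun n _ => ?_
    have : (n + 1 : ℂ) ≠ 0 := by exact_mod_cast n.succ_ne_zero
    push_cast
    field_simp
    ring
  rw [hexp, hprod, Complex.GammaSeq, Finset.prod_range_succ, Finset.prod_range_succ,
    Nat.factorial_succ]
  have hP : ∏ n ∈ Finset.range N, (z + 1 + (n : ℂ)) ≠ 0 := Finset.prod_ne_zero_iff.2 fun n _ => hne n
  have e1 := hne N
  have e2 := hne (N + 1)
  push_cast at e2 ⊢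
  have epow : (N + 1 : ℂ) ^ (z + 1) = Complex.exp (z * (Real.log (N + 1) : ℝ)) * (N + 1) := by
    rw [Complex.cpow_add _ _ hN, Complex.cpow_one, Complex.cpow_def_of_ne_zero hN,
      Complex.ofReal_log (by positivity)]
    push_cast
    rw [mul_comm z]
  rw [epow]
  have hf : (N.factorial : ℂ) ≠ 0 := by exact_mod_cast N.factorial_ne_zero
  field_simp
  ring

theorem Gamma_add_one_eq_exp_tsum {z : ℂ} (hz : -(3 / 4) < z.re) :
    Complex.Gamma (z + 1) = Complex.exp (∑' n, logGammaTerm n z) := by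
  have h1 := (Complex.continuous_exp.tendsto _).comp
    (hasDerivAt_tsum_logGammaTerm hz).1.hasSum.tendsto_sum_nat
  have hdiv : ∀ w : ℂ, Filter.Tendsto (fun N : ℕ => 1 + w / (N + 1 : ℂ)) Filter.atTop (nhds 1) := by
    intro w
    have := (tendsto_one_div_add_atTop_nhds_zero_nat (𝕜 := ℂ)).const_mul w
    simpa [div_eq_mul_inv] using this.const_add 1
  have h2 := ((Complex.GammaSeq_tendsto_Gamma (z + 1)).comp (Filter.tendsto_add_atTop_nat 1)).mul
    ((hdiv z).mul (hdiv (z + 1)))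
  rw [mul_one, mul_one] at h2
  exact tendsto_nhds_unique h2 (h1.congr fun N => exp_sum_logGammaTerm N hz)

theorem digamma_add_one_eq_tsum {z : ℂ} (hz : -(3 / 4) < z.re) :
    Complex.digamma (z + 1) = ∑' n, digammaTerm n z := by
  have h1 : HasDerivAt (fun w => Complex.Gamma (w + 1))
      (Complex.exp (∑' n, logGammaTerm n z) * ∑' n, digammaTerm n z) z := by
    refine ((hasDerivAt_tsum_logGammaTerm hz).2.cexp).congr_of_eventuallyEq ?_
    filter_upwards [(isOpen_lt continuous_const Complex.continuous_re).mem_nhds hz] with w hw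
    exact Gamma_add_one_eq_exp_tsum hw
  rw [Complex.digamma_def, logDeriv_apply, ← deriv_comp_add_const, h1.deriv,
    Gamma_add_one_eq_exp_tsum hz, mul_div_cancel_left₀ _ (Complex.exp_ne_zero _)]

theorem exists_norm_digamma_add_one_le : ∃ C : ℝ, 0 < C ∧ ∀ z : ℂ, -(3 / 4) < z.re →
    ‖Complex.digamma (z + 1)‖ ≤ C * (1 + ‖z‖) := by
  set A := ∑' n : ℕ, 1 / ((n + 1 : ℕ) : ℝ) ^ 2 with hA
  have hA0 : 0 ≤ A := tsum_nonneg fun n => by positivity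
  refine ⟨4 * A + 1, by linarith, fun z hz => ?_⟩
  rw [digamma_add_one_eq_tsum hz]
  have := tsum_of_norm_bounded (summable_one_div_succ_sq.mul_left (1 + 4 * ‖z‖)).hasSum
    fun n => norm_digammaTerm_le n hz
  rw [tsum_mul_left, ← hA] at this
  nlinarith [norm_nonneg z, mul_nonneg hA0 (norm_nonneg z)]

/-- A weighted geometric mean of the bounds by the real and the imaginary part. The exponents are
such that a product of two of these norms yields the summable (n+1)^(3/2) together with √Y. -/
theorem rpow_mul_rpow_le_norm (n : ℕ) {z : ℂ} (hz : -(3 / 4) < z.re) {Y : ℝ} (hY : 0 < Y)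
    (him : Y ≤ |z.im|) :
    (((n + 1 : ℕ) : ℝ) / 4) ^ (3 / 4 : ℝ) * Y ^ (1 / 4 : ℝ) ≤ ‖(n + 1 : ℂ) + z‖ := by
  set r := ‖(n + 1 : ℂ) + z‖
  have h1 : ((n + 1 : ℕ) : ℝ) / 4 ≤ r := add_one_div_four_le_norm n hz
  have h2 : Y ≤ r := him.trans (by simpa using Complex.abs_im_le_norm ((n + 1 : ℂ) + z))
  have hr : 0 < r := hY.trans_le h2
  calc _ ≤ r ^ (3 / 4 : ℝ) * r ^ (1 / 4 : ℝ) := by gcongr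
    _ = r := by rw [← Real.rpow_add hr]; norm_num

/-- Slow variation of the digamma function away from the real axis. -/
theorem exists_norm_digamma_sub_digamma_le : ∃ C : ℝ, 0 < C ∧ ∀ z w : ℂ, ∀ Y : ℝ,
    -(3 / 4) < z.re → -(3 / 4) < w.re → 0 < Y → Y ≤ |z.im| → Y ≤ |w.im| →
    ‖Complex.digamma (z + 1) - Complex.digamma (w + 1)‖ ≤ C * ‖z - w‖ / √Y := by
  have hs : Summable fun n : ℕ => ((((n + 1 : ℕ) : ℝ) / 4) ^ (3 / 2 : ℝ))⁻¹ := by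
    have := ((summable_nat_add_iff 1).2 (Real.summable_nat_rpow_inv.2
      (by norm_num : (1 : ℝ) < 3 / 2))).mul_left ((4 : ℝ) ^ (3 / 2 : ℝ))
    refine this.congr fun n => ?_
    rw [Real.div_rpow (by positivity) (by positivity), inv_div]
    exact (div_eq_mul_inv _ _).symm
  set A := ∑' n : ℕ, ((((n + 1 : ℕ) : ℝ) / 4) ^ (3 / 2 : ℝ))⁻¹ with hA
  have hA0 : 0 ≤ A := tsum_nonneg fun n => by positivity
  refine ⟨A + 1, by linarith, fun z w Y hz hw hY hzY hwY => ?_⟩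
  rw [digamma_add_one_eq_tsum hz, digamma_add_one_eq_tsum hw,
    ← (summable_digammaTerm hz).tsum_sub (summable_digammaTerm hw)]
  have hb : ∀ n, ‖digammaTerm n z - digammaTerm n w‖
      ≤ ‖z - w‖ / √Y * ((((n + 1 : ℕ) : ℝ) / 4) ^ (3 / 2 : ℝ))⁻¹ := by
    intro n
    have h1 := rpow_mul_rpow_le_norm n hz hY hzY
    have h2 := rpow_mul_rpow_le_norm n hw hY hwY
    have p1 : 0 < (((n + 1 : ℕ) : ℝ) / 4) ^ (3 / 4 : ℝ) * Y ^ (1 / 4 : ℝ) := by positivity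
    have hz0 : (n + 1 : ℂ) + z ≠ 0 := norm_pos_iff.1 (p1.trans_le h1)
    have hw0 : (n + 1 : ℂ) + w ≠ 0 := norm_pos_iff.1 (p1.trans_le h2)
    have e : digammaTerm n z - digammaTerm n w = (z - w) / ((n + 1 + z) * (n + 1 + w)) := by
      rw [digammaTerm, digammaTerm]
      field_simp
      ring
    have key : (((n + 1 : ℕ) : ℝ) / 4) ^ (3 / 2 : ℝ) * √Y
        ≤ ‖(n + 1 : ℂ) + z‖ * ‖(n + 1 : ℂ) + w‖ :=
      calc (((n + 1 : ℕ) : ℝ) / 4) ^ (3 / 2 : ℝ) * √Y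
          = ((((n + 1 : ℕ) : ℝ) / 4) ^ (3 / 4 : ℝ) * Y ^ (1 / 4 : ℝ)) *
            ((((n + 1 : ℕ) : ℝ) / 4) ^ (3 / 4 : ℝ) * Y ^ (1 / 4 : ℝ)) := by
            rw [mul_mul_mul_comm, ← Real.rpow_add (by positivity), ← Real.rpow_add hY,
              Real.sqrt_eq_rpow]
            norm_num
        _ ≤ _ := by gcongr
    rw [e, norm_div, norm_mul]
    calc _ ≤ ‖z - w‖ / ((((n + 1 : ℕ) : ℝ) / 4) ^ (3 / 2 : ℝ) * √Y) := by gcongr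
      _ = _ := by field_simp
  have := tsum_of_norm_bounded (hs.mul_left (‖z - w‖ / √Y)).hasSum hb
  rw [tsum_mul_left, ← hA] at this
  refine this.trans ?_
  rw [mul_div_assoc, mul_comm]
  gcongr
  linarith

/-- With y = |Im z|, the terms with n below about y lose at most 1/(N+1) each, hence at most 1
altogether, while their logarithms telescope to log(N+1), which is at least log(y/2). The remaining
terms are bounded below by a convergent series. -/
theorem exists_le_re_digamma : ∃ C : ℝ, ∀ z : ℂ, z.re = 1 / 4 → 1 ≤ |z.im| →
    Real.log |z.im| - C ≤ (Complex.digamma (z + 1)).re := by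
  set A := ∑' n : ℕ, 1 / ((n + 1 : ℕ) : ℝ) ^ 2 with hA
  refine ⟨A + 1 + Real.log 2, fun z hz him => ?_⟩
  set y := |z.im| with hy
  have hz' : -(3 / 4) < z.re := by rw [hz]; norm_num
  -- The cutoff is N + 1 = ⌊y⌋, so that N + 1 ≤ y < N + 2.
  obtain ⟨N, hN⟩ : ∃ N : ℕ, ⌊y⌋₊ = N + 1 := Nat.exists_eq_succ_of_ne_zero
    (Nat.floor_pos.2 him).ne'
  have hN1 : (N + 1 : ℝ) ≤ y := by
    have := Nat.floor_le (by linarith : 0 ≤ y)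
    rw [hN] at this
    exact_mod_cast this
  have hN2 : y < N + 2 := by
    have := Nat.lt_floor_add_one y
    rw [hN] at this
    push_cast at this
    linarith
  have hre : ∀ n : ℕ, (digammaTerm n z).re = Real.log (n + 2) - Real.log (n + 1)
      - (n + 5 / 4) / ((n + 5 / 4) ^ 2 + y ^ 2) := by
    intro n
    rw [digammaTerm, Complex.sub_re, Complex.ofReal_re, one_div, Complex.inv_re,
      Complex.normSq_apply]
    have e1 : ((n + 1 : ℂ) + z).re = n + 5 / 4 := by simp [hz]; ring
    have e2 : ((n + 1 : ℂ) + z).im = z.im := by simp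
    rw [e1, e2, hy, sq_abs, sq, sq]
  have hlow : ∀ n : ℕ, -(1 / ((n + 1 : ℕ) : ℝ) ^ 2) ≤ (digammaTerm n z).re := by
    intro n
    rw [hre]
    have h1 := (log_succ_sub_log_bounds n).1
    have h2 : (n + 5 / 4 : ℝ) / ((n + 5 / 4) ^ 2 + y ^ 2) ≤ 1 / (n + 1) := by
      rw [div_le_div_iff₀ (by positivity) (by positivity)]
      nlinarith [n.cast_nonneg (α := ℝ), sq_nonneg y]
    linarith
  have hlow2 : ∀ n ∈ Finset.range N, Real.log (n + 2) - Real.log (n + 1) - 1 / (N + 1)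
      - 1 / ((n + 1 : ℕ) : ℝ) ^ 2 ≤ (digammaTerm n z).re := by
    intro n hn
    rw [hre]
    have hn' : (n + 1 : ℝ) ≤ N := by exact_mod_cast Finset.mem_range.1 hn
    have h2 : (n + 5 / 4 : ℝ) / ((n + 5 / 4) ^ 2 + y ^ 2) ≤ 1 / (N + 1) := by
      rw [div_le_div_iff₀ (by positivity) (by positivity)]
      nlinarith [n.cast_nonneg (α := ℝ), sq_nonneg y, mul_self_le_mul_self (by positivity) hN1]
    have : (0 : ℝ) ≤ 1 / ((n + 1 : ℕ) : ℝ) ^ 2 := by positivity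
    linarith
  have hsum := summable_digammaTerm hz'
  have hsre : Summable fun n => (digammaTerm n z).re := (Complex.hasSum_re hsum.hasSum).summable
  rw [digamma_add_one_eq_tsum hz', Complex.re_tsum hsum, ← hsre.sum_add_tsum_nat_add N]
  have t1 : ∑ n ∈ Finset.range N, (Real.log (n + 2) - Real.log (n + 1) - 1 / (N + 1)
      - 1 / ((n + 1 : ℕ) : ℝ) ^ 2) ≤ ∑ n ∈ Finset.range N, (digammaTerm n z).re :=
    Finset.sum_le_sum hlow2
  have t2 : ∑' n : ℕ, -(1 / ((n + N + 1 : ℕ) : ℝ) ^ 2) ≤ ∑' n, (digammaTerm (n + N) z).re :=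
    Summable.tsum_le_tsum (fun n => hlow (n + N))
      ((summable_nat_add_iff N).2 summable_one_div_succ_sq).neg
      ((summable_nat_add_iff N).2 hsre)
  have t3 := summable_one_div_succ_sq.sum_add_tsum_nat_add N
  rw [tsum_neg] at t2
  have t4 : ∑ n ∈ Finset.range N, (Real.log (n + 2) - Real.log (n + 1)) = Real.log (N + 1) := by
    have := Finset.sum_range_sub (fun n : ℕ => Real.log (n + 1)) N
    simp only [Nat.cast_zero, zero_add, Real.log_one, sub_zero, Nat.cast_add, Nat.cast_one] at this
    rw [← this]
    refine Finset.sum_congr rfl fun n _ => ?_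
    ring_nf
  rw [Finset.sum_sub_distrib, Finset.sum_sub_distrib, t4, Finset.sum_const, Finset.card_range,
    nsmul_eq_mul] at t1
  have t5 : (N : ℝ) * (1 / (N + 1)) ≤ 1 := by
    rw [mul_one_div, div_le_one (by positivity)]
    linarith
  have t6 : Real.log y - Real.log 2 ≤ Real.log (N + 1) := by
    rw [← Real.log_div (by linarith) two_ne_zero]
    refine Real.log_le_log (by linarith) ?_
    rw [div_le_iff₀ two_pos]
    linarith [N.cast_nonneg (α := ℝ)]
  linarith

/-! ### The theta derivative and the modulus of (Z^k)' -/

/-- The analytic continuation of the derivative of the Riemann–Siegel theta function from the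
critical line, as a function of `s = 1/2 + it`. -/
noncomputable def thetaDeriv (s : ℂ) : ℂ :=
  -(Real.log Real.pi : ℂ) / 2 + (Complex.digamma (s / 2) + Complex.digamma ((1 - s) / 2)) / 4

theorem hasDerivAt_Gammaℝ {s : ℂ} (hs : 0 < s.re) :
    HasDerivAt Complex.Gammaℝ (Complex.Gammaℝ s *
      (-(Real.log Real.pi : ℂ) / 2 + Complex.digamma (s / 2) / 2)) s := by
  have hpi : (Real.pi : ℂ) ≠ 0 := Complex.ofReal_ne_zero.2 Real.pi_ne_zero
  have hre : 0 < (s / 2).re := by simpa using hs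
  have hG : DifferentiableAt ℂ Complex.Gamma (s / 2) :=
    Complex.differentiableAt_Gamma _ fun m h => by
      rw [h] at hre
      simp at hre
      linarith [m.cast_nonneg (α := ℝ)]
  have hG0 : Complex.Gamma (s / 2) ≠ 0 := Complex.Gamma_ne_zero_of_re_pos hre
  have h1 : HasDerivAt (fun s : ℂ => (Real.pi : ℂ) ^ (-s / 2))
      ((Real.pi : ℂ) ^ (-s / 2) * Complex.log Real.pi * (-1 / 2)) s :=
    (((hasDerivAt_id s).neg).div_const 2).const_cpow (Or.inl hpi)
  have h2 : HasDerivAt (fun s : ℂ => Complex.Gamma (s / 2))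
      (deriv Complex.Gamma (s / 2) * (1 / 2)) s :=
    HasDerivAt.comp s hG.hasDerivAt ((hasDerivAt_id s).div_const 2)
  refine (h1.mul h2).congr_deriv ?_
  rw [Complex.Gammaℝ_def, Complex.digamma_def, logDeriv_apply, Complex.ofReal_log Real.pi_pos.le]
  field_simp

theorem hasDerivAt_line (t : ℝ) :
    HasDerivAt (fun t : ℝ => (1 / 2 + t * Complex.I : ℂ)) Complex.I t := by
  simpa using ((Complex.ofRealCLM.hasDerivAt (x := t)).mul_const Complex.I).const_add (1 / 2 : ℂ)

theorem sqrtChi_sq_eq_div (t : ℝ) : sqrtChi t ^ 2 =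
    Complex.Gammaℝ (1 / 2 + t * Complex.I) / Complex.Gammaℝ (1 - (1 / 2 + t * Complex.I)) := by
  set s : ℂ := 1 / 2 + t * Complex.I with hs
  have hc : (‖Complex.Gammaℝ s‖ : ℂ) ^ 2 = Complex.Gammaℝ s * Complex.Gammaℝ (1 - s) := by
    rw [← conj_half t, ← conj_gammaR, Complex.mul_conj, Complex.normSq_eq_norm_sq]
    push_cast
    rfl
  rw [sqrtChi, div_pow, hc, sq, mul_div_mul_left _ _ (gammaR_half_ne_zero t)]

theorem norm_sqrtChi (t : ℝ) : ‖sqrtChi t‖ = 1 := by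
  have := gammaR_half_ne_zero t
  rw [sqrtChi, norm_div, Complex.norm_real, norm_norm, div_self (norm_ne_zero_iff.2 this)]

/-- The square of `sqrtChi` is a quotient of two values of `Complex.Gammaℝ`. Differentiating that
quotient and dividing by twice the nonzero `sqrtChi` avoids differentiating the norm in the
definition. -/
theorem hasDerivAt_sqrtChi (t : ℝ) : HasDerivAt sqrtChi
    (sqrtChi t * (Complex.I * thetaDeriv (1 / 2 + t * Complex.I))) t := by
  have hE := (sqrtChi_differentiable t).hasDerivAt
  have hE0 : sqrtChi t ≠ 0 := norm_ne_zero_iff.1 (by rw [norm_sqrtChi]; exact one_ne_zero)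
  have hsq := hE.pow 2
  have hs : 0 < (1 / 2 + t * Complex.I : ℂ).re := by simp
  have hs' : 0 < (1 - (1 / 2 + t * Complex.I) : ℂ).re := by norm_num
  have h1 := (hasDerivAt_Gammaℝ hs).scomp t (hasDerivAt_line t)
  have h2 := (hasDerivAt_Gammaℝ hs').scomp t ((hasDerivAt_line t).const_sub 1)
  have h0 : Complex.Gammaℝ (1 - (1 / 2 + t * Complex.I)) ≠ 0 :=
    Complex.Gammaℝ_ne_zero_of_re_pos hs'
  have h3 := h1.div h2 h0
  have hfun : (sqrtChi ^ 2 : ℝ → ℂ) = (Complex.Gammaℝ ∘ fun t : ℝ => (1 / 2 + t * Complex.I : ℂ)) /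
      (Complex.Gammaℝ ∘ fun t : ℝ => (1 - (1 / 2 + t * Complex.I) : ℂ)) :=
    funext fun t => sqrtChi_sq_eq_div t
  rw [hfun] at hsq
  have key := hsq.unique h3
  have hval := sqrtChi_sq_eq_div t
  simp only [Function.comp_apply, smul_eq_mul] at key
  have hd : deriv sqrtChi t = sqrtChi t * (Complex.I * thetaDeriv (1 / 2 + t * Complex.I)) := by
    set g := Complex.Gammaℝ (1 / 2 + t * Complex.I)
    set h := Complex.Gammaℝ (1 - (1 / 2 + t * Complex.I))
    have e : ∀ a b : ℂ, (Complex.I * (g * a) * h - g * (-Complex.I * (h * b))) / h ^ 2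
        = sqrtChi t ^ 2 * (Complex.I * (a + b)) := by
      intro a b
      rw [hval]
      field_simp
      ring
    rw [e] at key
    have h2E : (2 : ℂ) * sqrtChi t ≠ 0 := mul_ne_zero two_ne_zero hE0
    apply mul_left_cancel₀ h2E
    norm_num at key
    rw [key, thetaDeriv]
    ring
  rw [← hd]
  exact hE

theorem half_line_ne_one (t : ℝ) : (1 / 2 + t * Complex.I : ℂ) ≠ 1 := by
  intro h
  have := congrArg Complex.re h
  norm_num at this

theorem hasDerivAt_ofReal_hardyZ (t : ℝ) : HasDerivAt (fun t => (hardyZ t : ℂ))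
    (sqrtChi t * (Complex.I * (thetaDeriv (1 / 2 + t * Complex.I) *
      riemannZeta (1 / 2 + t * Complex.I) + deriv riemannZeta (1 / 2 + t * Complex.I)))) t := by
  have h1 := (differentiableAt_riemannZeta (half_line_ne_one t)).hasDerivAt.scomp t
    (hasDerivAt_line t)
  have h2 := (hasDerivAt_sqrtChi t).mul h1
  have hfun : (fun t => (hardyZ t : ℂ)) =
      sqrtChi * (riemannZeta ∘ fun t : ℝ => (1 / 2 + t * Complex.I : ℂ)) := funext hardyZ_eq
  rw [hfun]
  refine h2.congr_deriv ?_
  simp only [Function.comp_apply, smul_eq_mul]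
  ring

theorem hasDerivAt_hardyZ (t : ℝ) : HasDerivAt hardyZ (sqrtChi t * (Complex.I *
    (thetaDeriv (1 / 2 + t * Complex.I) * riemannZeta (1 / 2 + t * Complex.I)
      + deriv riemannZeta (1 / 2 + t * Complex.I)))).re t :=
  Complex.reCLM.hasFDerivAt.comp_hasDerivAt t (hasDerivAt_ofReal_hardyZ t)

/-- Z is real-valued, so its derivative equals the complex derivative of its coercion, from which
the unimodular factor i `sqrtChi` drops out. -/
theorem norm_deriv_hardyZ (t : ℝ) : |deriv hardyZ t| =
    ‖thetaDeriv (1 / 2 + t * Complex.I) * riemannZeta (1 / 2 + t * Complex.I)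
      + deriv riemannZeta (1 / 2 + t * Complex.I)‖ := by
  have h := (hasDerivAt_hardyZ t).differentiableAt.hasDerivAt.ofReal_comp
  rw [← Real.norm_eq_abs, ← Complex.norm_real, ← (hasDerivAt_ofReal_hardyZ t).unique h, norm_mul, norm_sqrtChi,
    one_mul, norm_mul, Complex.norm_I, one_mul]

theorem norm_hardyZ (t : ℝ) : |hardyZ t| = ‖riemannZeta (1 / 2 + t * Complex.I)‖ := by
  rw [← Real.norm_eq_abs, ← Complex.norm_real, hardyZ_eq, norm_mul, norm_sqrtChi, one_mul]

/-- The function `k θ' ζ ^ k + (ζ ^ k)'`, whose modulus on the critical line is that of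
`(Z ^ k)'`. -/
noncomputable def zetaPowDeriv (k : ℕ) (s : ℂ) : ℂ :=
  k * thetaDeriv s * riemannZeta s ^ k + k * riemannZeta s ^ (k - 1) * deriv riemannZeta s

theorem norm_zetaPowDeriv_sq {k : ℕ} (hk : 1 ≤ k) (t : ℝ) :
    ‖zetaPowDeriv k (1 / 2 + t * Complex.I)‖ ^ 2 =
      (k : ℝ) ^ 2 * (deriv hardyZ t ^ 2 * hardyZ t ^ (2 * k - 2)) := by
  have e : 2 * k - 2 = 2 * (k - 1) := by omega
  rw [e, pow_mul, ← sq_abs (deriv hardyZ t), ← sq_abs (hardyZ t), norm_deriv_hardyZ, norm_hardyZ,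
    ← pow_mul, mul_comm 2 (k - 1), pow_mul, ← mul_pow, ← mul_pow]
  congr 1
  rw [← norm_pow, ← norm_mul, ← Complex.norm_natCast k, ← norm_mul]
  congr 1
  obtain ⟨j, rfl⟩ := Nat.exists_eq_add_of_le' hk
  rw [zetaPowDeriv, Nat.add_sub_cancel, pow_succ]
  ring

theorem isOpen_im_ne_zero : IsOpen {s : ℂ | s.im ≠ 0} :=
  isOpen_ne_fun Complex.continuous_im continuous_const

theorem differentiableAt_digamma {z : ℂ} (hz : z.im ≠ 0) :
    DifferentiableAt ℂ Complex.digamma z := by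
  have hne : ∀ w : ℂ, w.im ≠ 0 → ∀ m : ℕ, w ≠ -m := fun w hw m h => hw (by rw [h]; simp)
  have h1 : DifferentiableOn ℂ Complex.Gamma {s : ℂ | s.im ≠ 0} := fun w hw =>
    (Complex.differentiableAt_Gamma w (hne w hw)).differentiableWithinAt
  have h2 := (h1.deriv isOpen_im_ne_zero).differentiableAt (isOpen_im_ne_zero.mem_nhds hz)
  have h3 := h1.differentiableAt (isOpen_im_ne_zero.mem_nhds hz)
  exact h2.div h3 (Complex.Gamma_ne_zero (hne z hz))

theorem differentiableAt_thetaDeriv {s : ℂ} (hs : s.im ≠ 0) :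
    DifferentiableAt ℂ thetaDeriv s := by
  have h1 : DifferentiableAt ℂ (fun s : ℂ => Complex.digamma (s / 2)) s :=
    DifferentiableAt.comp (g := Complex.digamma) s (differentiableAt_digamma (by simpa using hs))
      (by fun_prop)
  have h2 : DifferentiableAt ℂ (fun s : ℂ => Complex.digamma ((1 - s) / 2)) s :=
    DifferentiableAt.comp (g := Complex.digamma) s (differentiableAt_digamma (by simpa using hs))
      (by fun_prop)
  exact ((h1.add h2).div_const 4).const_add _

theorem ne_one_of_im_ne_zero {s : ℂ} (hs : s.im ≠ 0) : s ≠ 1 := by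
  rintro rfl
  simp at hs

theorem differentiableAt_deriv_riemannZeta {s : ℂ} (hs : s.im ≠ 0) :
    DifferentiableAt ℂ (deriv riemannZeta) s := by
  have h1 : DifferentiableOn ℂ riemannZeta {s : ℂ | s.im ≠ 0} := fun w hw =>
    (differentiableAt_riemannZeta (ne_one_of_im_ne_zero hw)).differentiableWithinAt
  exact (h1.deriv isOpen_im_ne_zero).differentiableAt (isOpen_im_ne_zero.mem_nhds hs)

theorem differentiableAt_zetaPowDeriv (k : ℕ) {s : ℂ} (hs : s.im ≠ 0) :
    DifferentiableAt ℂ (zetaPowDeriv k) s := by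
  have h1 := differentiableAt_thetaDeriv hs
  have h2 := differentiableAt_riemannZeta (ne_one_of_im_ne_zero hs)
  have h3 := differentiableAt_deriv_riemannZeta hs
  unfold zetaPowDeriv
  exact ((h1.const_mul _).mul (h2.pow k)).add (((h2.pow (k - 1)).const_mul _).mul h3)

/-- The recurrence moves both digamma arguments by 1, into the form covered by the series. The terms
2/s and 2/(1-s) are harmless away from the real axis. -/
theorem thetaDeriv_eq {s : ℂ} (hs : s.im ≠ 0) : thetaDeriv s = -(Real.log Real.pi : ℂ) / 2 +
    (Complex.digamma (s / 2 + 1) + Complex.digamma ((1 - s) / 2 + 1) - 2 / s - 2 / (1 - s)) / 4 := by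
  have hne : ∀ w : ℂ, w.im ≠ 0 → ∀ m : ℕ, w ≠ -m := fun w hw m h => hw (by rw [h]; simp)
  rw [Complex.digamma_apply_add_one _ (hne _ (by simpa using hs)),
    Complex.digamma_apply_add_one _ (hne _ (by simpa using hs)), thetaDeriv, inv_div, inv_div]
  ring

theorem exists_norm_thetaDeriv_le : ∃ C : ℝ, 0 < C ∧ ∀ s : ℂ, 1 / 2 ≤ s.re → s.re ≤ 2 →
    1 ≤ s.im → ‖thetaDeriv s‖ ≤ C * (1 + ‖s‖) := by
  obtain ⟨C, hC, h⟩ := exists_norm_digamma_add_one_le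
  refine ⟨C + Real.log Real.pi + 1, by
    have := Real.log_pos (by linarith [Real.pi_gt_three] : 1 < Real.pi)
    linarith, fun s h1 h2 him => ?_⟩
  have hlog := Real.log_pos (by linarith [Real.pi_gt_three] : 1 < Real.pi)
  have hs1 : 1 ≤ ‖s‖ := him.trans ((le_abs_self _).trans (Complex.abs_im_le_norm s))
  have hs2 : 1 ≤ ‖1 - s‖ := by
    refine le_trans ?_ (Complex.abs_im_le_norm (1 - s))
    simpa using him.trans (le_abs_self _)
  have hs3 : ‖1 - s‖ ≤ 1 + ‖s‖ := (norm_sub_le _ _).trans (by simp)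
  rw [thetaDeriv_eq (by linarith)]
  have a1 := h (s / 2) (by simp; linarith)
  have a2 := h ((1 - s) / 2) (by simp; linarith)
  have a3 : ‖2 / s‖ ≤ 2 := by
    rw [norm_div, Complex.norm_ofNat]
    exact div_le_self zero_le_two hs1
  have a4 : ‖2 / (1 - s)‖ ≤ 2 := by
    rw [norm_div, Complex.norm_ofNat]
    exact div_le_self zero_le_two hs2
  rw [norm_div, Complex.norm_ofNat] at a1 a2
  have a5 : ‖-(Real.log Real.pi : ℂ) / 2‖ = Real.log Real.pi / 2 := by
    rw [norm_div, norm_neg, Complex.norm_real, Real.norm_of_nonneg hlog.le, Complex.norm_ofNat]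
  refine (norm_add_le _ _).trans ?_
  rw [a5, norm_div, Complex.norm_ofNat]
  have a6 := (norm_sub_le (Complex.digamma (s / 2 + 1) + Complex.digamma ((1 - s) / 2 + 1) - 2 / s)
    (2 / (1 - s)))
  have a7 := (norm_sub_le (Complex.digamma (s / 2 + 1) + Complex.digamma ((1 - s) / 2 + 1)) (2 / s))
  have a8 := (norm_add_le (Complex.digamma (s / 2 + 1)) (Complex.digamma ((1 - s) / 2 + 1)))
  nlinarith [mul_nonneg hlog.le (norm_nonneg s), mul_nonneg hC.le (norm_nonneg s), norm_nonneg s]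

/-- Inherited from the slow variation of digamma. A saving of √Y suffices: in the application √Y is
of order X^32, against a Gaussian width of X^16. -/
theorem exists_norm_thetaDeriv_sub_le : ∃ C : ℝ, 0 < C ∧ ∀ s w : ℂ, ∀ Y : ℝ, 1 ≤ Y →
    1 / 2 ≤ s.re → s.re ≤ 2 → 1 / 2 ≤ w.re → w.re ≤ 2 → Y ≤ s.im → Y ≤ w.im →
    ‖thetaDeriv s - thetaDeriv w‖ ≤ C * ‖s - w‖ / √Y := by
  obtain ⟨C, hC, h⟩ := exists_norm_digamma_sub_digamma_le
  refine ⟨C + 1, by linarith, fun s w Y hY hs1 hs2 hw1 hw2 hs hw => ?_⟩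
  have hn : ∀ z : ℂ, Y ≤ |z.im| → Y ≤ ‖z‖ := fun z hz => hz.trans (Complex.abs_im_le_norm z)
  have b1 : Y ≤ ‖s‖ := hn s (hs.trans (le_abs_self _))
  have b2 : Y ≤ ‖w‖ := hn w (hw.trans (le_abs_self _))
  have b3 : Y ≤ ‖1 - s‖ := hn _ (by simpa using hs.trans (le_abs_self _))
  have b4 : Y ≤ ‖1 - w‖ := hn _ (by simpa using hw.trans (le_abs_self _))
  have hY2 : √(Y / 2) * √(Y / 2) = Y / 2 := Real.mul_self_sqrt (by linarith)
  have hYY : √Y ≤ Y := (Real.sqrt_le_left (by linarith)).2 (by nlinarith)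
  have hsq : √Y ≤ 2 * √(Y / 2) := by
    rw [Real.sqrt_le_left (by positivity), mul_pow, Real.sq_sqrt (by linarith)]
    linarith
  have c1 := h (s / 2) (w / 2) (Y / 2) (by simp; linarith) (by simp; linarith) (by linarith)
    (by simp [abs_div]; linarith [le_abs_self s.im]) (by simp [abs_div]; linarith [le_abs_self w.im])
  have c2 := h ((1 - s) / 2) ((1 - w) / 2) (Y / 2) (by simp; linarith) (by simp; linarith)
    (by linarith) (by simp [abs_div]; linarith [le_abs_self s.im])
    (by simp [abs_div]; linarith [le_abs_self w.im])
  have n1 : ‖s / 2 - w / 2‖ = ‖s - w‖ / 2 := by rw [← sub_div, norm_div, Complex.norm_ofNat]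
  have n2 : ‖(1 - s) / 2 - (1 - w) / 2‖ = ‖s - w‖ / 2 := by
    rw [← sub_div, norm_div, Complex.norm_ofNat, sub_sub_sub_cancel_left, norm_sub_rev]
  have hsY : 0 < √Y := Real.sqrt_pos.2 (by linarith)
  have d1 : ∀ X : ℝ, X ≤ C * (‖s - w‖ / 2) / √(Y / 2) → X ≤ C * ‖s - w‖ / √Y := by
    intro X hX
    refine hX.trans ?_
    rw [div_le_div_iff₀ (Real.sqrt_pos.2 (by linarith)) hsY]
    nlinarith [mul_nonneg hC.le (norm_nonneg (s - w))]
  rw [n1] at c1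
  rw [n2] at c2
  replace c1 := d1 _ c1
  replace c2 := d1 _ c2
  have hs0 : s ≠ 0 := norm_pos_iff.1 (by linarith)
  have hw0 : w ≠ 0 := norm_pos_iff.1 (by linarith)
  have hs0' : 1 - s ≠ 0 := norm_pos_iff.1 (by linarith)
  have hw0' : 1 - w ≠ 0 := norm_pos_iff.1 (by linarith)
  have inv : ∀ a b : ℂ, Y ≤ ‖a‖ → Y ≤ ‖b‖ → ‖a - b‖ = ‖s - w‖ → a ≠ 0 → b ≠ 0 →
      ‖2 / a - 2 / b‖ ≤ 2 * ‖s - w‖ / √Y := by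
    intro a b ha hb hab ha0 hb0
    have e : 2 / a - 2 / b = -(2 * (a - b)) / (a * b) := by
      field_simp
      ring
    rw [e, norm_div, norm_neg, norm_mul, norm_mul, hab, Complex.norm_ofNat]
    have : √Y ≤ ‖a‖ * ‖b‖ := by nlinarith
    gcongr
  have c3 := inv s w b1 b2 rfl hs0 hw0
  have c4 := inv (1 - s) (1 - w) b3 b4 (by rw [sub_sub_sub_cancel_left, norm_sub_rev]) hs0' hw0'
  rw [thetaDeriv_eq (by linarith), thetaDeriv_eq (by linarith)]
  have e : (-(Real.log Real.pi : ℂ) / 2 + (Complex.digamma (s / 2 + 1)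
      + Complex.digamma ((1 - s) / 2 + 1) - 2 / s - 2 / (1 - s)) / 4) -
      (-(Real.log Real.pi : ℂ) / 2 + (Complex.digamma (w / 2 + 1)
      + Complex.digamma ((1 - w) / 2 + 1) - 2 / w - 2 / (1 - w)) / 4)
      = ((Complex.digamma (s / 2 + 1) - Complex.digamma (w / 2 + 1))
        + (Complex.digamma ((1 - s) / 2 + 1) - Complex.digamma ((1 - w) / 2 + 1))
        - (2 / s - 2 / w) - (2 / (1 - s) - 2 / (1 - w))) / 4 := by ring
  rw [e, norm_div, Complex.norm_ofNat, div_le_iff₀ (by norm_num)]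
  refine (norm_sub_le _ _).trans ?_
  refine (add_le_add_left (norm_sub_le _ _) _).trans ?_
  refine (add_le_add_left (add_le_add_left (norm_add_le _ _) _) _).trans ?_
  have hfin : (C + 1) * ‖s - w‖ / √Y * 4 = 4 * (C * ‖s - w‖ / √Y) + 2 * (2 * ‖s - w‖ / √Y) := by ring
  rw [hfin]
  have : 0 ≤ C * ‖s - w‖ / √Y := by positivity
  linarith

/-- On the critical line s/2 and (1-s)/2 both have real part 1/4, and each digamma value contributes
(log t)/4 up to a bounded amount. -/
theorem exists_le_re_thetaDeriv : ∃ C : ℝ, ∀ t : ℝ, 2 ≤ t →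
    Real.log t / 2 - C ≤ (thetaDeriv (1 / 2 + t * Complex.I)).re := by
  obtain ⟨C, h⟩ := exists_le_re_digamma
  refine ⟨Real.log Real.pi / 2 + (C + Real.log 2) / 2 + 1, fun t ht => ?_⟩
  set s : ℂ := 1 / 2 + t * Complex.I with hs
  have hre : s.re = 1 / 2 := by simp [hs]
  have him : s.im = t := by simp [hs]
  have hpos : |t| = t := abs_of_pos (by linarith)
  have h1 := h (s / 2) (by rw [Complex.div_ofNat_re, hre]; norm_num)
    (by rw [Complex.div_ofNat_im, him, abs_div, hpos, abs_two]; linarith)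
  have h2 := h ((1 - s) / 2) (by rw [Complex.div_ofNat_re, Complex.sub_re, hre]; norm_num)
    (by rw [Complex.div_ofNat_im, Complex.sub_im, him, abs_div, Complex.one_im, zero_sub, abs_neg,
      hpos, abs_two]; linarith)
  rw [Complex.div_ofNat_im, him, abs_div, hpos, abs_two, Real.log_div (by linarith) two_ne_zero] at h1
  rw [Complex.div_ofNat_im, Complex.sub_im, him, abs_div, Complex.one_im, zero_sub, abs_neg, hpos,
    abs_two, Real.log_div (by linarith) two_ne_zero] at h2
  have inv : ∀ a : ℂ, 2 ≤ |a.im| → (2 / a).re ≤ 1 := by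
    intro a ha
    refine (Complex.re_le_norm _).trans ?_
    have := ha.trans (Complex.abs_im_le_norm a)
    rw [norm_div, Complex.norm_ofNat]
    exact div_le_one_of_le₀ this (norm_nonneg _)
  have h3 := inv s (by rw [him, hpos]; exact ht)
  have h4 := inv (1 - s) (by rw [Complex.sub_im, him, Complex.one_im, zero_sub, abs_neg, hpos]; exact ht)
  rw [thetaDeriv_eq (by rw [him]; linarith)]
  have e : (-(Real.log Real.pi : ℂ) / 2 + (Complex.digamma (s / 2 + 1)
      + Complex.digamma ((1 - s) / 2 + 1) - 2 / s - 2 / (1 - s)) / 4).re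
      = -Real.log Real.pi / 2 + ((Complex.digamma (s / 2 + 1)).re
      + (Complex.digamma ((1 - s) / 2 + 1)).re - (2 / s).re - (2 / (1 - s)).re) / 4 := by
    rw [Complex.add_re, Complex.div_ofNat_re, Complex.div_ofNat_re, Complex.sub_re, Complex.sub_re,
      Complex.add_re, Complex.neg_re, Complex.ofReal_re]
  rw [e]
  linarith

/-! ### Gaussian weights and diagonal extraction -/

/-- The Gaussian weight of width `Δ` centred at `1/2 + iτ`, as an entire function. -/
noncomputable def gaussWeight (Δ τ : ℝ) (s : ℂ) : ℂ :=
  Complex.exp ((s - (1 / 2 + τ * Complex.I)) ^ 2 / (Δ : ℂ) ^ 2)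

theorem differentiable_gaussWeight (Δ τ : ℝ) : Differentiable ℂ (gaussWeight Δ τ) := by
  unfold gaussWeight
  fun_prop

theorem norm_gaussWeight (Δ τ σ t : ℝ) : ‖gaussWeight Δ τ (σ + t * Complex.I)‖ =
    Real.exp (((σ - 1 / 2) ^ 2 - (t - τ) ^ 2) / Δ ^ 2) := by
  rw [gaussWeight, Complex.norm_exp]
  congr 1
  rw [← Complex.ofReal_pow, Complex.div_ofReal_re, sq (σ + t * Complex.I - _ : ℂ), Complex.mul_re]
  simp
  ring

theorem gaussWeight_half (Δ τ t : ℝ) : gaussWeight Δ τ (1 / 2 + t * Complex.I) =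
    (Real.exp (-(t - τ) ^ 2 / Δ ^ 2) : ℝ) := by
  rw [gaussWeight, Complex.ofReal_exp]
  congr 1
  push_cast
  congr 1
  linear_combination ((t - τ : ℂ)) ^ 2 * Complex.I_sq

theorem integral_norm_gaussWeight {Δ : ℝ} (hΔ : 0 < Δ) (τ σ : ℝ) :
    MeasureTheory.Integrable (fun t : ℝ => ‖gaussWeight Δ τ (σ + t * Complex.I)‖) ∧
    ∫ t : ℝ, ‖gaussWeight Δ τ (σ + t * Complex.I)‖ =
      Real.exp ((σ - 1 / 2) ^ 2 / Δ ^ 2) * (√Real.pi * Δ) := by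
  have e : (fun t : ℝ => ‖gaussWeight Δ τ (σ + t * Complex.I)‖) = fun t : ℝ =>
      Real.exp ((σ - 1 / 2) ^ 2 / Δ ^ 2) * Real.exp (-(1 / Δ ^ 2) * (t - τ) ^ 2) := by
    ext t
    rw [norm_gaussWeight, ← Real.exp_add]
    congr 1
    ring
  rw [e]
  refine ⟨((integrable_exp_neg_mul_sq (by positivity)).comp_sub_right τ).const_mul _, ?_⟩
  rw [MeasureTheory.integral_const_mul,
    MeasureTheory.integral_sub_right_eq_self (fun t : ℝ => Real.exp (-(1 / Δ ^ 2) * t ^ 2)),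
    integral_gaussian]
  congr 1
  rw [div_div_eq_mul_div, div_one, Real.sqrt_mul Real.pi_pos.le, Real.sqrt_sq hΔ.le]

/-- The Gaussian transform of `exp (-s x) exp ((s - 1) y)` along a vertical line. -/
theorem integral_gaussWeight_mul_exp {Δ : ℝ} (hΔ : 0 < Δ) (τ σ x y : ℝ) :
    MeasureTheory.Integrable (fun t : ℝ => gaussWeight Δ τ (σ + t * Complex.I) *
      Complex.exp (-(σ + t * Complex.I) * x) * Complex.exp ((σ + t * Complex.I - 1) * y)) ∧
    ∫ t : ℝ, gaussWeight Δ τ (σ + t * Complex.I) *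
      Complex.exp (-(σ + t * Complex.I) * x) * Complex.exp ((σ + t * Complex.I - 1) * y) =
      (√Real.pi * Δ : ℝ) *
        Complex.exp ((1 / 2 + τ * Complex.I) * (y - x) - y - (Δ : ℂ) ^ 2 * (y - x) ^ 2 / 4) := by
  have hΔ' : (Δ : ℂ) ≠ 0 := Complex.ofReal_ne_zero.2 hΔ.ne'
  have e : (fun t : ℝ => gaussWeight Δ τ (σ + t * Complex.I) *
      Complex.exp (-(σ + t * Complex.I) * x) * Complex.exp ((σ + t * Complex.I - 1) * y)) =
      fun t : ℝ => Complex.exp (((-(1 / Δ ^ 2) : ℝ) : ℂ) * (t : ℂ) ^ 2 +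
        (2 * Complex.I * (σ - 1 / 2 - τ * Complex.I) / (Δ : ℂ) ^ 2 + Complex.I * (y - x)) * t +
        ((σ - 1 / 2 - τ * Complex.I) ^ 2 / (Δ : ℂ) ^ 2 + σ * (y - x) - y)) := by
    ext t
    rw [gaussWeight, ← Complex.exp_add, ← Complex.exp_add]
    congr 1
    push_cast
    field_simp
    linear_combination (4 * (t : ℂ) ^ 2) * Complex.I_sq
  have hb : ((-(1 / Δ ^ 2) : ℝ) : ℂ).re < 0 := by
    rw [Complex.ofReal_re]
    exact neg_lt_zero.2 (by positivity)
  rw [e]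
  refine ⟨integrable_cexp_quadratic' hb _ _, ?_⟩
  rw [integral_cexp_quadratic hb]
  congr 1
  · have h1 : (Real.pi / -((-(1 / Δ ^ 2) : ℝ) : ℂ) : ℂ) = ((Real.pi * Δ ^ 2 : ℝ) : ℂ) := by
      push_cast
      field_simp
    rw [h1, show (1 / 2 : ℂ) = ((1 / 2 : ℝ) : ℂ) by push_cast; rfl,
      ← Complex.ofReal_cpow (by positivity), ← Real.sqrt_eq_rpow, Real.sqrt_mul Real.pi_pos.le,
      Real.sqrt_sq hΔ.le]
  · congr 1
    push_cast
    field_simp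
    ring_nf
    simp only [Complex.I_sq, Complex.I_pow_three,
      Complex.I_pow_four]
    ring

/-- Only n is bounded by N; m is free, because it later runs through a whole Dirichlet series. -/
theorem one_div_le_abs_log_sub_log {m n N : ℕ} (hm : m ≠ 0) (hn : n ≠ 0) (hnN : n ≤ N)
    (hmn : m ≠ n) : 1 / (N + 1 : ℝ) ≤ |Real.log n - Real.log m| := by
  have hm' : (0 : ℝ) < m := by positivity
  have hn' : (0 : ℝ) < n := by positivity
  have hN : (n : ℝ) ≤ N := by exact_mod_cast hnN
  rcases lt_or_gt_of_ne hmn with h | h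
  · have h' : (m + 1 : ℝ) ≤ n := by exact_mod_cast h
    refine le_trans ?_ (le_abs_self _)
    rw [← Real.log_div hn'.ne' hm'.ne']
    refine le_trans ?_ (Real.one_sub_inv_le_log_of_pos (by positivity))
    rw [inv_div, one_sub_div hn'.ne', div_le_div_iff₀ (by positivity) hn']
    nlinarith
  · have h' : (n + 1 : ℝ) ≤ m := by exact_mod_cast h
    refine le_trans ?_ (neg_le_abs _)
    rw [neg_sub, ← Real.log_div hm'.ne' hn'.ne']
    refine le_trans ?_ (Real.one_sub_inv_le_log_of_pos (by positivity))
    rw [inv_div, one_sub_div hm'.ne', div_le_div_iff₀ (by positivity) hm']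
    nlinarith

theorem natCast_cpow_eq_exp {n : ℕ} (hn : n ≠ 0) (s : ℂ) :
    (n : ℂ) ^ s = Complex.exp (s * (Real.log n : ℝ)) := by
  rw [Complex.cpow_def_of_ne_zero (Nat.cast_ne_zero.2 hn), Complex.natCast_log, mul_comm]

/-- Twisting a Dirichlet series on the line `Re s = 2` by `n ^ (s - 1)` with a wide Gaussian weight
picks out its `n`-th coefficient. -/
theorem norm_integral_gaussWeight_LSeries_sub_le {b : ℕ → ℂ} (hb : LSeriesSummable b 2)
    {Δ : ℝ} (hΔ : 0 < Δ) (τ : ℝ) {n N : ℕ} (hn : n ≠ 0) (hnN : n ≤ N)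
    (hΔN : 12 * (N + 1 : ℝ) ≤ Δ ^ 2) :
    MeasureTheory.Integrable (fun t : ℝ => gaussWeight Δ τ ((2 : ℝ) + t * Complex.I) *
      LSeries b ((2 : ℝ) + t * Complex.I) * (n : ℂ) ^ ((2 : ℝ) + t * Complex.I - 1 : ℂ)) ∧
    ‖(∫ t : ℝ, gaussWeight Δ τ ((2 : ℝ) + t * Complex.I) * LSeries b ((2 : ℝ) + t * Complex.I) *
        (n : ℂ) ^ ((2 : ℝ) + t * Complex.I - 1 : ℂ)) - (√Real.pi * Δ : ℝ) * (b n / n)‖ ≤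
      √Real.pi * Δ * (n * Real.exp (-(Δ ^ 2 / (8 * (N + 1) ^ 2))) *
        ∑' m, ‖LSeries.term b 2 m‖) := by
  have hpΔ : 0 < √Real.pi * Δ := mul_pos (Real.sqrt_pos.2 Real.pi_pos) hΔ
  set F : ℕ → ℝ → ℂ := fun m t => gaussWeight Δ τ ((2 : ℝ) + t * Complex.I) *
    LSeries.term b ((2 : ℝ) + t * Complex.I) m * (n : ℂ) ^ ((2 : ℝ) + t * Complex.I - 1 : ℂ) with hF
  have hF' : ∀ m : ℕ, m ≠ 0 → F m = fun t : ℝ => b m * (gaussWeight Δ τ ((2 : ℝ) + t * Complex.I) *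
      Complex.exp (-((2 : ℝ) + t * Complex.I) * (Real.log m : ℝ)) *
      Complex.exp (((2 : ℝ) + t * Complex.I - 1) * (Real.log n : ℝ))) := by
    intro m hm
    ext t
    simp only [hF]
    rw [LSeries.term_of_ne_zero hm, natCast_cpow_eq_exp hn, div_eq_mul_inv, ← Complex.cpow_neg,
      natCast_cpow_eq_exp hm]
    ring
  have hF0 : F 0 = fun _ => 0 := by
    ext t
    simp [hF]
  have hint : ∀ m, MeasureTheory.Integrable (F m) := by
    intro m
    rcases eq_or_ne m 0 with rfl | hm
    · rw [hF0]; exact MeasureTheory.integrable_zero _ _ _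
    · rw [hF' m hm]
      exact (integral_gaussWeight_mul_exp hΔ τ 2 _ _).1.const_mul _
  have hnorm : ∀ m t, ‖F m t‖ = ‖gaussWeight Δ τ ((2 : ℝ) + t * Complex.I)‖ *
      (‖LSeries.term b 2 m‖ * n) := by
    intro m t
    simp only [hF]
    rw [norm_mul, norm_mul, LSeries.norm_term_eq, LSeries.norm_term_eq,
      Complex.norm_natCast_cpow_of_pos (Nat.pos_of_ne_zero hn)]
    norm_num
    simp only [mul_assoc]
  have hsum : Summable fun m => ∫ t, ‖F m t‖ := by
    simp only [hnorm, MeasureTheory.integral_mul_const]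
    exact (hb.norm.mul_right _).mul_left _
  have hS := MeasureTheory.hasSum_integral_of_summable_integral_norm hint hsum
  have htsum : (fun t => ∑' m, F m t) = fun t : ℝ => gaussWeight Δ τ ((2 : ℝ) + t * Complex.I) *
      LSeries b ((2 : ℝ) + t * Complex.I) * (n : ℂ) ^ ((2 : ℝ) + t * Complex.I - 1 : ℂ) := by
    ext t
    simp only [hF]
    rw [tsum_mul_right, tsum_mul_left, LSeries]
  have hintS : MeasureTheory.Integrable fun t => ∑' m, F m t := by
    rw [htsum]
    have hcont : Continuous fun t : ℝ => (n : ℂ) ^ ((2 : ℝ) + t * Complex.I - 1 : ℂ) :=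
      Continuous.const_cpow (by fun_prop) (Or.inl (Nat.cast_ne_zero.2 hn))
    have hL : Continuous fun t : ℝ => LSeries b ((2 : ℝ) + t * Complex.I) := by
      refine continuous_tsum (u := fun m => ‖LSeries.term b 2 m‖) (fun m => ?_) hb.norm fun m t => ?_
      · rcases eq_or_ne m 0 with rfl | hm
        · simp only [LSeries.term_zero]; exact continuous_const
        · simp only [LSeries.term_of_ne_zero hm, natCast_cpow_eq_exp hm]
          exact continuous_const.div (by fun_prop) fun t => Complex.exp_ne_zero _
      · rw [LSeries.norm_term_eq, LSeries.norm_term_eq]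
        norm_num
    have hw : Continuous fun t : ℝ => gaussWeight Δ τ ((2 : ℝ) + t * Complex.I) :=
      (differentiable_gaussWeight Δ τ).continuous.comp (by fun_prop)
    refine ((integral_norm_gaussWeight hΔ τ 2).1.mul_const
      ((∑' m, ‖LSeries.term b 2 m‖) * n)).mono' ((hw.mul hL).mul hcont).aestronglyMeasurable
      (Filter.Eventually.of_forall fun t => ?_)
    rw [norm_mul, norm_mul, Complex.norm_natCast_cpow_of_pos (Nat.pos_of_ne_zero hn), mul_assoc]
    have h1 : ‖LSeries b ((2 : ℝ) + t * Complex.I)‖ ≤ ∑' m, ‖LSeries.term b 2 m‖ := by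
      refine tsum_of_norm_bounded hb.norm.hasSum fun m => ?_
      rw [LSeries.norm_term_eq, LSeries.norm_term_eq]
      norm_num
    have h2 : (n : ℝ) ^ ((2 : ℝ) + t * Complex.I - 1 : ℂ).re = n := by norm_num
    rw [h2]
    gcongr
  rw [← htsum]
  refine ⟨hintS, ?_⟩
  have hI : ∀ m : ℕ, m ≠ 0 → ∫ t, F m t = b m * ((√Real.pi * Δ : ℝ) *
      Complex.exp ((1 / 2 + τ * Complex.I) * ((Real.log n : ℝ) - (Real.log m : ℝ)) - (Real.log n : ℝ)
        - (Δ : ℂ) ^ 2 * ((Real.log n : ℝ) - (Real.log m : ℝ)) ^ 2 / 4)) := by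
    intro m hm
    rw [hF' m hm, MeasureTheory.integral_const_mul, (integral_gaussWeight_mul_exp hΔ τ 2 _ _).2]
  have hIn : ∫ t, F n t = (√Real.pi * Δ : ℝ) * (b n / n) := by
    rw [hI n hn, sub_self, mul_zero, zero_sub, zero_pow two_ne_zero, mul_zero, zero_div, sub_zero,
      ← Complex.ofReal_neg, ← Complex.ofReal_exp, Real.exp_neg, Real.exp_log (by positivity)]
    push_cast
    ring
  -- Subtracting the diagonal term m = n leaves a series in which every nonzero term carries the
  -- full Gaussian decay.
  have hD := hS.sub (hasSum_ite_eq n ((√Real.pi * Δ : ℝ) * (b n / n) : ℂ))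
  rw [← hD.tsum_eq]
  have hbound := (hb.norm.mul_left (√Real.pi * Δ * (n * Real.exp (-(Δ ^ 2 / (8 * (N + 1) ^ 2)))))).hasSum
  rw [tsum_mul_left] at hbound
  rw [← mul_assoc (√Real.pi * Δ)]
  refine tsum_of_norm_bounded hbound fun m => ?_
  split_ifs with hmn
  · rw [hmn, hIn, sub_self, norm_zero]
    positivity
  rw [sub_zero]
  rcases eq_or_ne m 0 with rfl | hm
  · rw [hF0]; simp
  rw [hI m hm, norm_mul, norm_mul, Complex.norm_real, Real.norm_of_nonneg hpΔ.le, Complex.norm_exp,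
    LSeries.norm_term_eq, if_neg hm]
  set ℓ := Real.log n - Real.log m with hℓ
  have hre : ((1 / 2 + τ * Complex.I) * ((Real.log n : ℝ) - (Real.log m : ℝ)) - (Real.log n : ℝ)
        - (Δ : ℂ) ^ 2 * ((Real.log n : ℝ) - (Real.log m : ℝ)) ^ 2 / 4 : ℂ).re
      = ℓ / 2 - Real.log n - Δ ^ 2 * ℓ ^ 2 / 4 := by
    rw [← Complex.ofReal_sub, ← hℓ, ← Complex.ofReal_pow, ← Complex.ofReal_pow,
      ← Complex.ofReal_mul, Complex.sub_re, Complex.sub_re, Complex.div_ofNat_re, Complex.ofReal_re,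
      Complex.ofReal_re, Complex.re_mul_ofReal]
    simp
    ring
  rw [hre]
  have hgap := one_div_le_abs_log_sub_log hm hn hnN hmn
  rw [← hℓ] at hgap
  have hN0 : (0 : ℝ) < N + 1 := by positivity
  have h12 : 12 ≤ Δ ^ 2 * |ℓ| := by
    calc (12 : ℝ) = 12 * (N + 1) * (1 / (N + 1)) := by field_simp
      _ ≤ _ := by gcongr
  have hsq : 1 / (N + 1 : ℝ) ^ 2 ≤ ℓ ^ 2 := by
    rw [← sq_abs ℓ, ← one_div_pow]
    exact pow_le_pow_left₀ (by positivity) hgap 2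
  -- The exponent Δ²ℓ²/4 is split in two halves. One gives the uniform saving through the gap
  -- between logarithms. The other exceeds 3|ℓ|/2, by the assumption with constant 12 = 8 · 3/2, and
  -- turns the factor into n m^(-2), so that the series at 2 appears.
  have hexp : ℓ / 2 - Real.log n - Δ ^ 2 * ℓ ^ 2 / 4 ≤
      Real.log n + -(Δ ^ 2 / (8 * (N + 1) ^ 2)) - 2 * Real.log m := by
    have h1 : Δ ^ 2 / (8 * (N + 1) ^ 2) ≤ Δ ^ 2 * ℓ ^ 2 / 8 := by
      calc Δ ^ 2 / (8 * (N + 1) ^ 2) = Δ ^ 2 * (1 / (N + 1 : ℝ) ^ 2) / 8 := by field_simp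
        _ ≤ _ := by gcongr
    have h2 : 12 * |ℓ| ≤ Δ ^ 2 * ℓ ^ 2 := by
      rw [← sq_abs ℓ]
      nlinarith [abs_nonneg ℓ]
    have h3 := neg_abs_le ℓ
    have h4 : Real.log m = Real.log n - ℓ := by rw [hℓ]; ring
    rw [h4]
    linarith
  have hm' : (0 : ℝ) < m := by positivity
  calc ‖b m‖ * (√Real.pi * Δ * Real.exp (ℓ / 2 - Real.log n - Δ ^ 2 * ℓ ^ 2 / 4))
      ≤ ‖b m‖ * (√Real.pi * Δ * Real.exp
        (Real.log n + -(Δ ^ 2 / (8 * (N + 1) ^ 2)) - 2 * Real.log m)) := by gcongr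
    _ = _ := by
      rw [Real.exp_sub, Real.exp_add, Real.exp_log (by positivity), mul_comm (2 : ℝ) (Real.log m),
        Real.exp_mul, Real.exp_log hm']
      simp only [Complex.re_ofNat]
      ring

/-- The Dirichlet polynomial `∑ a n n ^ (s - 1)`, which on the critical line is the complex
conjugate of `∑ a n n ^ (-s)` for real coefficients. -/
noncomputable def dirichletPoly (a : ℕ → ℝ) (N : ℕ) (s : ℂ) : ℂ :=
  ∑ n ∈ Finset.Icc 1 N, (a n : ℂ) * (n : ℂ) ^ (s - 1)

theorem differentiable_dirichletPoly (a : ℕ → ℝ) (N : ℕ) : Differentiable ℂ (dirichletPoly a N) := by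
  unfold dirichletPoly
  refine Differentiable.fun_sum fun n hn => (Differentiable.const_cpow (by fun_prop) (Or.inl ?_)).const_mul _
  exact Nat.cast_ne_zero.2 (by have := (Finset.mem_Icc.1 hn).1; omega)

theorem norm_dirichletPoly_le {a : ℕ → ℝ} (ha : ∀ n, 0 ≤ a n) (N : ℕ) {s : ℂ} (hs : s.re ≤ 2) :
    ‖dirichletPoly a N s‖ ≤ ∑ n ∈ Finset.Icc 1 N, a n * n := by
  refine (norm_sum_le _ _).trans (Finset.sum_le_sum fun n hn => ?_)
  have hn1 := (Finset.mem_Icc.1 hn).1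
  rw [norm_mul, Complex.norm_real, Real.norm_of_nonneg (ha n), Complex.norm_natCast_cpow_of_pos hn1]
  refine mul_le_mul_of_nonneg_left ?_ (ha n)
  calc (n : ℝ) ^ (s - 1).re ≤ (n : ℝ) ^ (1 : ℝ) :=
        Real.rpow_le_rpow_of_exponent_le (by exact_mod_cast hn1) (by simp; linarith)
    _ = n := Real.rpow_one _

/-- Gaussian mean square of a Dirichlet polynomial on the critical line. -/
theorem integral_gaussWeight_mul_norm_dirichletPoly_sq_le {a : ℕ → ℝ} (ha : ∀ n, 0 ≤ a n) (N : ℕ)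
    {Δ : ℝ} (hΔ : 0 < Δ) (τ : ℝ) :
    MeasureTheory.Integrable (fun t : ℝ => Real.exp (-(t - τ) ^ 2 / Δ ^ 2) *
      ‖dirichletPoly a N (1 / 2 + t * Complex.I)‖ ^ 2) ∧
    ∫ t : ℝ, Real.exp (-(t - τ) ^ 2 / Δ ^ 2) * ‖dirichletPoly a N (1 / 2 + t * Complex.I)‖ ^ 2 ≤
      √Real.pi * Δ * (∑ n ∈ Finset.Icc 1 N, a n ^ 2 / n +
        Real.exp (-(Δ ^ 2 / (8 * (N + 1) ^ 2))) * (∑ n ∈ Finset.Icc 1 N, a n) ^ 2) := by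
  have hpΔ : 0 < √Real.pi * Δ := mul_pos (Real.sqrt_pos.2 Real.pi_pos) hΔ
  set g : ℕ → ℕ → ℝ → ℂ := fun m n t => gaussWeight Δ τ ((1 / 2 : ℝ) + t * Complex.I) *
      Complex.exp (-((1 / 2 : ℝ) + t * Complex.I) * (Real.log m : ℝ)) *
      Complex.exp (((1 / 2 : ℝ) + t * Complex.I - 1) * (Real.log n : ℝ)) with hg
  have hexpand : (fun t : ℝ => ((Real.exp (-(t - τ) ^ 2 / Δ ^ 2) *
      ‖dirichletPoly a N (1 / 2 + t * Complex.I)‖ ^ 2 : ℝ) : ℂ)) =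
      fun t => ∑ m ∈ Finset.Icc 1 N, ∑ n ∈ Finset.Icc 1 N, (a m * a n : ℂ) * g m n t := by
    ext t
    have hhalf : ((1 / 2 : ℝ) : ℂ) = 1 / 2 := by push_cast; rfl
    -- Conjugation on the critical line turns m^(s-1) into m^(-s), so each cross term is a Gaussian
    -- transform already evaluated.
    have hc : (starRingEnd ℂ) (dirichletPoly a N (1 / 2 + t * Complex.I)) =
        ∑ m ∈ Finset.Icc 1 N, (a m : ℂ) *
          Complex.exp (-((1 / 2 : ℝ) + t * Complex.I) * (Real.log m : ℝ)) := by
      rw [dirichletPoly, map_sum]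
      refine Finset.sum_congr rfl fun n hn => ?_
      have hn1 := (Finset.mem_Icc.1 hn).1
      rw [natCast_cpow_eq_exp (by omega), map_mul, Complex.conj_ofReal, ← Complex.exp_conj, map_mul,
        Complex.conj_ofReal, map_sub, conj_half, hhalf, map_one]
      ring_nf
    have hd : dirichletPoly a N (1 / 2 + t * Complex.I) = ∑ n ∈ Finset.Icc 1 N, (a n : ℂ) *
          Complex.exp (((1 / 2 : ℝ) + t * Complex.I - 1) * (Real.log n : ℝ)) := by
      rw [dirichletPoly]
      refine Finset.sum_congr rfl fun n hn => ?_
      have hn1 := (Finset.mem_Icc.1 hn).1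
      rw [natCast_cpow_eq_exp (by omega), hhalf]
    rw [Complex.ofReal_mul, ← gaussWeight_half, ← Complex.normSq_eq_norm_sq,
      Complex.normSq_eq_conj_mul_self, hc, hd, Finset.sum_mul_sum, Finset.mul_sum]
    refine Finset.sum_congr rfl fun m _ => ?_
    rw [Finset.mul_sum]
    refine Finset.sum_congr rfl fun n _ => ?_
    simp only [hg, hhalf]
    ring
  have hgint : ∀ m n, MeasureTheory.Integrable (fun t => (a m * a n : ℂ) * g m n t) := fun m n =>
    (integral_gaussWeight_mul_exp hΔ τ (1 / 2) _ _).1.const_mul _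
  have hsumint : MeasureTheory.Integrable (fun t : ℝ => ((Real.exp (-(t - τ) ^ 2 / Δ ^ 2) *
      ‖dirichletPoly a N (1 / 2 + t * Complex.I)‖ ^ 2 : ℝ) : ℂ)) := by
    rw [hexpand]
    exact MeasureTheory.integrable_finsetSum _ fun m _ =>
      MeasureTheory.integrable_finsetSum _ fun n _ => hgint m n
  have hint : MeasureTheory.Integrable (fun t : ℝ => Real.exp (-(t - τ) ^ 2 / Δ ^ 2) *
      ‖dirichletPoly a N (1 / 2 + t * Complex.I)‖ ^ 2) := by
    exact hsumint.re
  refine ⟨hint, ?_⟩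
  have hval : ((∫ t : ℝ, Real.exp (-(t - τ) ^ 2 / Δ ^ 2) *
      ‖dirichletPoly a N (1 / 2 + t * Complex.I)‖ ^ 2 : ℝ) : ℂ) =
      ∑ m ∈ Finset.Icc 1 N, ∑ n ∈ Finset.Icc 1 N, (a m * a n : ℂ) * ∫ t, g m n t := by
    rw [← integral_complex_ofReal, hexpand, MeasureTheory.integral_finsetSum _ fun m _ =>
      MeasureTheory.integrable_finsetSum _ fun n _ => hgint m n]
    refine Finset.sum_congr rfl fun m _ => ?_
    rw [MeasureTheory.integral_finsetSum _ fun n _ => hgint m n]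
    refine Finset.sum_congr rfl fun n _ => ?_
    rw [MeasureTheory.integral_const_mul]
  have hnonneg : 0 ≤ ∫ t : ℝ, Real.exp (-(t - τ) ^ 2 / Δ ^ 2) *
      ‖dirichletPoly a N (1 / 2 + t * Complex.I)‖ ^ 2 :=
    MeasureTheory.integral_nonneg fun t => by positivity
  have hbound : ∀ m ∈ Finset.Icc 1 N, ∀ n ∈ Finset.Icc 1 N,
      ‖(a m * a n : ℂ) * ∫ t, g m n t‖ ≤ √Real.pi * Δ * ((if m = n then a n ^ 2 / n else 0) +
        Real.exp (-(Δ ^ 2 / (8 * (N + 1) ^ 2))) * (a m * a n)) := by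
    intro m hm n hn
    obtain ⟨hm1, hmN⟩ := Finset.mem_Icc.1 hm
    obtain ⟨hn1, hnN⟩ := Finset.mem_Icc.1 hn
    have hm' : (1 : ℝ) ≤ m := by exact_mod_cast hm1
    have hn' : (1 : ℝ) ≤ n := by exact_mod_cast hn1
    rw [(integral_gaussWeight_mul_exp hΔ τ (1 / 2) _ _).2, norm_mul, norm_mul, norm_mul,
      Complex.norm_real, Complex.norm_real, Complex.norm_real, Real.norm_of_nonneg hpΔ.le,
      Real.norm_of_nonneg (ha m), Real.norm_of_nonneg (ha n), Complex.norm_exp]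
    set ℓ := Real.log n - Real.log m with hℓ
    have hre : ((1 / 2 + τ * Complex.I) * ((Real.log n : ℝ) - (Real.log m : ℝ)) - (Real.log n : ℝ)
          - (Δ : ℂ) ^ 2 * ((Real.log n : ℝ) - (Real.log m : ℝ)) ^ 2 / 4 : ℂ).re
        = ℓ / 2 - Real.log n - Δ ^ 2 * ℓ ^ 2 / 4 := by
      rw [← Complex.ofReal_sub, ← hℓ, ← Complex.ofReal_pow, ← Complex.ofReal_pow,
        ← Complex.ofReal_mul, Complex.sub_re, Complex.sub_re, Complex.div_ofNat_re, Complex.ofReal_re,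
        Complex.ofReal_re, Complex.re_mul_ofReal]
      simp
      ring
    rw [hre]
    have hmn0 : 0 ≤ a m * a n := mul_nonneg (ha m) (ha n)
    split_ifs with hmn
    · subst hmn
      have : ℓ = 0 := by rw [hℓ, sub_self]
      rw [this]
      have e : Real.exp (0 / 2 - Real.log m - Δ ^ 2 * 0 ^ 2 / 4) = (m : ℝ)⁻¹ := by
        rw [show 0 / 2 - Real.log m - Δ ^ 2 * 0 ^ 2 / 4 = -Real.log m by ring, Real.exp_neg,
          Real.exp_log (by linarith)]
      rw [e]
      have : 0 ≤ √Real.pi * Δ * (Real.exp (-(Δ ^ 2 / (8 * (N + 1) ^ 2))) * (a m * a m)) := by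
        positivity
      calc a m * a m * (√Real.pi * Δ * (m : ℝ)⁻¹) = √Real.pi * Δ * (a m ^ 2 / m) := by
            rw [div_eq_mul_inv]; ring
        _ ≤ _ := by rw [mul_add]; linarith
    · rw [zero_add]
      have hgap := one_div_le_abs_log_sub_log (by omega) (by omega) hnN hmn
      rw [← hℓ] at hgap
      have hsq : 1 / (N + 1 : ℝ) ^ 2 ≤ ℓ ^ 2 := by
        rw [← sq_abs ℓ, ← one_div_pow]
        exact pow_le_pow_left₀ (by positivity) hgap 2
      have hle : ℓ / 2 - Real.log n - Δ ^ 2 * ℓ ^ 2 / 4 ≤ -(Δ ^ 2 / (8 * (N + 1) ^ 2)) := by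
        have h1 : Δ ^ 2 / (8 * (N + 1) ^ 2) ≤ Δ ^ 2 * ℓ ^ 2 / 8 := by
          calc Δ ^ 2 / (8 * (N + 1) ^ 2) = Δ ^ 2 * (1 / (N + 1 : ℝ) ^ 2) / 8 := by field_simp
            _ ≤ _ := by gcongr
        have h2 := Real.log_nonneg hm'
        have h3 := Real.log_nonneg hn'
        have h4 : 0 ≤ Δ ^ 2 * ℓ ^ 2 := by positivity
        have h5 : ℓ / 2 - Real.log n = -(Real.log n + Real.log m) / 2 := by rw [hℓ]; ring
        rw [h5]
        linarith
      calc a m * a n * (√Real.pi * Δ * Real.exp (ℓ / 2 - Real.log n - Δ ^ 2 * ℓ ^ 2 / 4))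
          ≤ a m * a n * (√Real.pi * Δ * Real.exp (-(Δ ^ 2 / (8 * (N + 1) ^ 2)))) := by gcongr
        _ = _ := by ring
  calc _ = ‖((∫ t : ℝ, Real.exp (-(t - τ) ^ 2 / Δ ^ 2) *
      ‖dirichletPoly a N (1 / 2 + t * Complex.I)‖ ^ 2 : ℝ) : ℂ)‖ := by
        rw [Complex.norm_real, Real.norm_of_nonneg hnonneg]
    _ ≤ ∑ m ∈ Finset.Icc 1 N, ∑ n ∈ Finset.Icc 1 N, √Real.pi * Δ *
        ((if m = n then a n ^ 2 / n else 0) +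
        Real.exp (-(Δ ^ 2 / (8 * (N + 1) ^ 2))) * (a m * a n)) := by
        rw [hval]
        exact (norm_sum_le _ _).trans (Finset.sum_le_sum fun m hm =>
          (norm_sum_le _ _).trans (Finset.sum_le_sum fun n hn => hbound m hm n hn))
    _ = _ := by
        simp only [← Finset.mul_sum, Finset.sum_add_distrib]
        congr 2
        · refine Finset.sum_congr rfl fun m hm => ?_
          rw [Finset.sum_ite_eq, if_pos hm]
        · rw [← Finset.sum_mul, ← sq]

/-! ### Dirichlet series of ζ^k and its derivative -/

/-- The Piltz function as a complex arithmetic sequence. -/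
noncomputable def piltzCoeff (k : ℕ) (n : ℕ) : ℂ := piltz k n

theorem LSeriesHasSum_piltzCoeff (k : ℕ) {s : ℂ} (hs : 1 < s.re) :
    LSeriesHasSum (piltzCoeff k) s (riemannZeta s ^ k) := LSeriesHasSum_piltz k hs

theorem abscissaOfAbsConv_piltzCoeff_lt (k : ℕ) {s : ℂ} (hs : 1 < s.re) :
    LSeries.abscissaOfAbsConv (piltzCoeff k) < s.re := by
  have : LSeries.abscissaOfAbsConv (piltzCoeff k) ≤ (1 : ℝ) :=
    LSeries.abscissaOfAbsConv_le_of_forall_lt_LSeriesSummable fun y hy =>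
      (LSeriesHasSum_piltzCoeff k (s := (y : ℂ)) (by simpa using hy)).LSeriesSummable
  exact this.trans_lt (by exact_mod_cast hs)

/-- The coefficients of the Dirichlet series `c ζ ^ k + (ζ ^ k)'`. -/
noncomputable def piltzDerivCoeff (k : ℕ) (c : ℂ) : ℕ → ℂ :=
  c • piltzCoeff k - LSeries.logMul (piltzCoeff k)

theorem LSeriesSummable_piltzDerivCoeff (k : ℕ) (c : ℂ) {s : ℂ} (hs : 1 < s.re) :
    LSeriesSummable (piltzDerivCoeff k c) s :=
  ((LSeriesHasSum_piltzCoeff k hs).LSeriesSummable.smul c).sub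
    (LSeriesSummable_logMul_of_lt_re (abscissaOfAbsConv_piltzCoeff_lt k hs))

theorem LSeries_piltzDerivCoeff (k : ℕ) (c : ℂ) {s : ℂ} (hs : 1 < s.re) :
    LSeries (piltzDerivCoeff k c) s = c * riemannZeta s ^ k +
      k * riemannZeta s ^ (k - 1) * deriv riemannZeta s := by
  have h1 := LSeriesSummable_logMul_of_lt_re (abscissaOfAbsConv_piltzCoeff_lt k hs)
  have hs1 : s ≠ 1 := by rintro rfl; simp at hs
  have h2 : HasDerivAt (LSeries (piltzCoeff k))
      (k * riemannZeta s ^ (k - 1) * deriv riemannZeta s) s := by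
    refine ((differentiableAt_riemannZeta hs1).hasDerivAt.pow k).congr_of_eventuallyEq ?_
    filter_upwards [(isOpen_lt continuous_const Complex.continuous_re).mem_nhds hs] with w hw
    exact (LSeriesHasSum_piltzCoeff k hw).LSeries_eq
  have h3 := (LSeries_hasDerivAt (abscissaOfAbsConv_piltzCoeff_lt k hs)).unique h2
  rw [piltzDerivCoeff, LSeries_sub ((LSeriesHasSum_piltzCoeff k hs).LSeriesSummable.smul c) h1,
    LSeries_smul, (LSeriesHasSum_piltzCoeff k hs).LSeries_eq, ← h3]
  ring

/-- Freezing θ' at a constant c separates a genuine Dirichlet series from a remainder that is small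
wherever θ' is close to c. -/
theorem zetaPowDeriv_eq_LSeries_add (k : ℕ) (c : ℂ) {s : ℂ} (hs : 1 < s.re) :
    zetaPowDeriv k s = LSeries (piltzDerivCoeff k (k * c)) s +
      k * (thetaDeriv s - c) * riemannZeta s ^ k := by
  rw [LSeries_piltzDerivCoeff k _ hs, zetaPowDeriv]
  ring

/-- The value of the Dirichlet series of `piltz k` at `2`. -/
noncomputable def piltzSum (k : ℕ) : ℝ := ∑' n, ‖LSeries.term (piltzCoeff k) 2 n‖

theorem summable_norm_term_piltzCoeff (k : ℕ) :
    Summable fun n => ‖LSeries.term (piltzCoeff k) 2 n‖ :=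
  (LSeriesHasSum_piltzCoeff k (s := 2) (by norm_num)).LSeriesSummable.norm

theorem norm_riemannZeta_pow_le (k : ℕ) {s : ℂ} (hs : s.re = 2) :
    ‖riemannZeta s ^ k‖ ≤ piltzSum k := by
  rw [← (LSeriesHasSum_piltzCoeff k (s := s) (by rw [hs]; norm_num)).LSeries_eq, LSeries]
  refine tsum_of_norm_bounded (summable_norm_term_piltzCoeff k).hasSum fun m => ?_
  rw [LSeries.norm_term_eq, LSeries.norm_term_eq, hs]
  norm_num

theorem norm_term_piltzCoeff (k : ℕ) {n : ℕ} (hn : n ≠ 0) :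
    ‖LSeries.term (piltzCoeff k) 2 n‖ = piltz k n / (n : ℝ) ^ 2 := by
  rw [LSeries.norm_term_eq, if_neg hn, piltzCoeff, Complex.norm_natCast]
  norm_num

theorem one_le_piltzSum (k : ℕ) : 1 ≤ piltzSum k := by
  have h := (summable_norm_term_piltzCoeff k).le_tsum 1 fun n _ => norm_nonneg _
  rw [norm_term_piltzCoeff k one_ne_zero, piltz_one_right] at h
  rw [piltzSum]
  simpa using h

/-- Crude, from n ≤ N³/n². Powers of N are harmless, since this bound meets either an exponentially
small factor or the saving X^(-32) from the slow variation of θ'. -/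
theorem sum_piltz_mul_le (k N : ℕ) :
    ∑ n ∈ Finset.Icc 1 N, (piltz k n : ℝ) * n ≤ piltzSum k * (N : ℝ) ^ 3 := by
  calc ∑ n ∈ Finset.Icc 1 N, (piltz k n : ℝ) * n
      ≤ ∑ n ∈ Finset.Icc 1 N, ‖LSeries.term (piltzCoeff k) 2 n‖ * (N : ℝ) ^ 3 := by
        refine Finset.sum_le_sum fun n hn => ?_
        obtain ⟨h1, h2⟩ := Finset.mem_Icc.1 hn
        have h1' : (0 : ℝ) < n := by exact_mod_cast h1
        have h2' : (n : ℝ) ≤ N := by exact_mod_cast h2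
        rw [norm_term_piltzCoeff k (by omega)]
        calc (piltz k n : ℝ) * n = piltz k n / (n : ℝ) ^ 2 * (n : ℝ) ^ 3 := by field_simp
          _ ≤ _ := by gcongr
    _ ≤ _ := by
        rw [← Finset.sum_mul]
        gcongr
        exact (summable_norm_term_piltzCoeff k).sum_le_tsum _ fun n _ => norm_nonneg _

/-- The point is the linear dependence on c, which will be k θ'(1/2 + iτ) and so varies with the
height. -/
theorem exists_tsum_norm_term_piltzDerivCoeff_le (k : ℕ) : ∃ C : ℝ, 0 < C ∧ ∀ c : ℂ,
    ∑' n, ‖LSeries.term (piltzDerivCoeff k c) 2 n‖ ≤ C * (1 + ‖c‖) := by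
  have h2 : 1 < (2 : ℂ).re := by norm_num
  have hs1 := summable_norm_term_piltzCoeff k
  have hs2 := (LSeriesSummable_logMul_of_lt_re (abscissaOfAbsConv_piltzCoeff_lt k h2)).norm
  set Q := ∑' n, ‖LSeries.term (LSeries.logMul (piltzCoeff k)) 2 n‖ with hQ
  have hQ0 : 0 ≤ Q := tsum_nonneg fun n => norm_nonneg _
  have hP := one_le_piltzSum k
  refine ⟨piltzSum k + Q, by linarith, fun c => ?_⟩
  have h := Summable.tsum_le_tsum (f := fun n => ‖LSeries.term (piltzDerivCoeff k c) 2 n‖)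
    (g := fun n => ‖c‖ * ‖LSeries.term (piltzCoeff k) 2 n‖ +
      ‖LSeries.term (LSeries.logMul (piltzCoeff k)) 2 n‖) (fun n => by
      rw [piltzDerivCoeff, LSeries.term_sub_apply, LSeries.term_smul_apply]
      exact (norm_sub_le _ _).trans_eq (by rw [norm_mul]))
    (LSeriesSummable_piltzDerivCoeff k c h2).norm ((hs1.mul_left _).add hs2)
  rw [(hs1.mul_left _).tsum_add hs2, tsum_mul_left, ← hQ] at h
  rw [piltzSum] at hP ⊢
  nlinarith [norm_nonneg c, mul_nonneg hQ0 (norm_nonneg c)]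

theorem norm_LSeries_piltzDerivCoeff_le (k : ℕ) (c : ℂ) {s : ℂ} (hs : s.re = 2) :
    ‖LSeries (piltzDerivCoeff k c) s‖ ≤ ∑' n, ‖LSeries.term (piltzDerivCoeff k c) 2 n‖ := by
  refine tsum_of_norm_bounded (LSeriesSummable_piltzDerivCoeff k c (s := 2) (by norm_num)).norm.hasSum
    fun m => ?_
  rw [LSeries.norm_term_eq, LSeries.norm_term_eq, hs]
  norm_num

/-! ### The twisted moment on the line Re s = 2 -/

/-- An integral dominated by a Gaussian. -/
theorem norm_setIntegral_le_of_le_gaussian {E : Type*} [NormedAddCommGroup E] [NormedSpace ℝ E]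
    {A : Set ℝ} (hA : MeasurableSet A) {f : ℝ → E} {M Δ τ : ℝ} (hΔ : 0 < Δ) (hM : 0 ≤ M)
    (h : ∀ t ∈ A, ‖f t‖ ≤ M * Real.exp (-(t - τ) ^ 2 / (2 * Δ ^ 2))) :
    ‖∫ t in A, f t‖ ≤ M * (3 * Δ) := by
  set g : ℝ → ℝ := fun t => Real.exp (-(1 / (2 * Δ ^ 2)) * (t - τ) ^ 2) with hg
  have hgi : MeasureTheory.Integrable g :=
    (integrable_exp_neg_mul_sq (by positivity : 0 < 1 / (2 * Δ ^ 2))).comp_sub_right τ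
  have hval : ∫ t, g t = √(2 * Real.pi) * Δ := by
    rw [hg, MeasureTheory.integral_sub_right_eq_self
      (fun t : ℝ => Real.exp (-(1 / (2 * Δ ^ 2)) * t ^ 2)), integral_gaussian,
      div_div_eq_mul_div, div_one, ← mul_assoc, mul_comm Real.pi 2, Real.sqrt_mul (by positivity),
      Real.sqrt_sq hΔ.le]
  have hpi : √(2 * Real.pi) ≤ 3 := by
    rw [Real.sqrt_le_left (by norm_num)]
    linarith [Real.pi_lt_four]
  calc ‖∫ t in A, f t‖ ≤ ∫ t in A, M * g t := by
        refine MeasureTheory.norm_integral_le_of_norm_le (hgi.const_mul M).integrableOn ?_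
        filter_upwards [MeasureTheory.ae_restrict_mem hA] with t ht
        refine (h t ht).trans_eq ?_
        rw [hg]
        congr 2
        field_simp
    _ ≤ ∫ t, M * g t := MeasureTheory.setIntegral_le_integral (hgi.const_mul M)
        (Filter.Eventually.of_forall fun t => mul_nonneg hM (Real.exp_pos _).le)
    _ = M * (√(2 * Real.pi) * Δ) := by rw [MeasureTheory.integral_const_mul, hval]
    _ ≤ _ := by gcongr

/-- Half of the Gaussian exponent is traded for the linear factor, at the cost of one power of Δ. -/
theorem abs_add_two_mul_exp_le {Δ : ℝ} (hΔ : 1 ≤ Δ) (u : ℝ) :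
    (|u| + 2) * Real.exp (-u ^ 2 / Δ ^ 2) ≤ 3 * Δ * Real.exp (-u ^ 2 / (2 * Δ ^ 2)) := by
  have hΔ0 : 0 < Δ := by linarith
  have h1 : Real.exp (-u ^ 2 / Δ ^ 2) =
      Real.exp (-u ^ 2 / (2 * Δ ^ 2)) * Real.exp (-(u ^ 2 / (2 * Δ ^ 2))) := by
    rw [← Real.exp_add]
    congr 1
    field_simp
    ring
  have h2 : (|u| + 2) * Real.exp (-(u ^ 2 / (2 * Δ ^ 2))) ≤ 3 * Δ := by
    rw [Real.exp_neg, ← div_eq_mul_inv, div_le_iff₀ (Real.exp_pos _)]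
    have h3 := Real.add_one_le_exp (u ^ 2 / (2 * Δ ^ 2))
    have h4 : |u| ≤ Δ * (u ^ 2 / (2 * Δ ^ 2) + 1) := by
      rw [← sq_abs u]
      have : Δ * (|u| ^ 2 / (2 * Δ ^ 2) + 1) - |u| = ((|u| - Δ) ^ 2 + Δ ^ 2) / (2 * Δ) := by
        field_simp
        ring
      have h5 : 0 ≤ ((|u| - Δ) ^ 2 + Δ ^ 2) / (2 * Δ) := by positivity
      linarith
    have h5 : 0 ≤ u ^ 2 / (2 * Δ ^ 2) := by positivity
    nlinarith
  rw [h1]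
  have := mul_le_mul_of_nonneg_left h2 (Real.exp_pos (-u ^ 2 / (2 * Δ ^ 2))).le
  linarith

theorem norm_gaussWeight_two_le {Δ : ℝ} (hΔ : 2 ≤ Δ) (τ t : ℝ) :
    ‖gaussWeight Δ τ ((2 : ℝ) + t * Complex.I)‖ ≤ 3 * Real.exp (-(t - τ) ^ 2 / Δ ^ 2) := by
  rw [norm_gaussWeight, sub_div, sub_eq_add_neg, Real.exp_add, neg_div]
  have : Real.exp ((2 - 1 / 2 : ℝ) ^ 2 / Δ ^ 2) ≤ 3 := by
    calc _ ≤ Real.exp 1 := by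
          rw [Real.exp_le_exp, div_le_one (by positivity)]
          nlinarith
      _ ≤ 3 := by linarith [Real.exp_one_lt_d9]
  gcongr

/-- The full integral of the twisted Dirichlet series over the line `Re s = 2`. -/
theorem norm_integral_gaussWeight_piltz_sub_le (k : ℕ) (c : ℂ) {Δ : ℝ} (hΔ : 0 < Δ) (τ : ℝ) {N : ℕ}
    (hΔN : 12 * (N + 1 : ℝ) ≤ Δ ^ 2) :
    MeasureTheory.Integrable (fun t : ℝ => gaussWeight Δ τ ((2 : ℝ) + t * Complex.I) *
      LSeries (piltzDerivCoeff k c) ((2 : ℝ) + t * Complex.I) *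
      dirichletPoly (fun n => piltz k n) N ((2 : ℝ) + t * Complex.I)) ∧
    ‖(∫ t : ℝ, gaussWeight Δ τ ((2 : ℝ) + t * Complex.I) *
      LSeries (piltzDerivCoeff k c) ((2 : ℝ) + t * Complex.I) *
      dirichletPoly (fun n => piltz k n) N ((2 : ℝ) + t * Complex.I)) -
      (√Real.pi * Δ : ℝ) * ∑ n ∈ Finset.Icc 1 N, (piltz k n : ℂ) ^ 2 / n * (c - Real.log n)‖ ≤
      √Real.pi * Δ * (Real.exp (-(Δ ^ 2 / (8 * (N + 1) ^ 2))) * (piltzSum k * (N : ℝ) ^ 3) *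
        ∑' m, ‖LSeries.term (piltzDerivCoeff k c) 2 m‖) := by
  set b := piltzDerivCoeff k c with hb
  have hbs : LSeriesSummable b 2 := LSeriesSummable_piltzDerivCoeff k c (by norm_num)
  have hB0 : 0 ≤ ∑' m, ‖LSeries.term b 2 m‖ := tsum_nonneg fun _ => norm_nonneg _
  set f : ℕ → ℝ → ℂ := fun n t => gaussWeight Δ τ ((2 : ℝ) + t * Complex.I) *
    LSeries b ((2 : ℝ) + t * Complex.I) * (n : ℂ) ^ ((2 : ℝ) + t * Complex.I - 1 : ℂ) with hf
  have hmem : ∀ n ∈ Finset.Icc 1 N, n ≠ 0 ∧ n ≤ N := fun n hn => by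
    have := Finset.mem_Icc.1 hn
    exact ⟨by omega, this.2⟩
  have hfun : (fun t : ℝ => gaussWeight Δ τ ((2 : ℝ) + t * Complex.I) *
      LSeries b ((2 : ℝ) + t * Complex.I) *
      dirichletPoly (fun n => piltz k n) N ((2 : ℝ) + t * Complex.I)) =
      fun t => ∑ n ∈ Finset.Icc 1 N, (piltz k n : ℂ) * f n t := by
    ext t
    rw [dirichletPoly, Finset.mul_sum]
    refine Finset.sum_congr rfl fun n _ => ?_
    simp only [hf]
    push_cast
    ring
  have hint : ∀ n ∈ Finset.Icc 1 N,
      MeasureTheory.Integrable (fun t => (piltz k n : ℂ) * f n t) := fun n hn =>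
    (norm_integral_gaussWeight_LSeries_sub_le hbs hΔ τ (hmem n hn).1 (hmem n hn).2 hΔN).1.const_mul _
  refine ⟨?_, ?_⟩
  · rw [hfun]
    exact MeasureTheory.integrable_finsetSum _ hint
  rw [hfun, MeasureTheory.integral_finsetSum _ hint, Finset.mul_sum, ← Finset.sum_sub_distrib]
  calc _ ≤ ∑ n ∈ Finset.Icc 1 N, (piltz k n : ℝ) * (√Real.pi * Δ *
        (n * Real.exp (-(Δ ^ 2 / (8 * (N + 1) ^ 2))) * ∑' m, ‖LSeries.term b 2 m‖)) := by
        refine (norm_sum_le _ _).trans (Finset.sum_le_sum fun n hn => ?_)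
        have h := (norm_integral_gaussWeight_LSeries_sub_le hbs hΔ τ (hmem n hn).1 (hmem n hn).2
          hΔN).2
        have e : ((∫ t, (piltz k n : ℂ) * f n t) - (√Real.pi * Δ : ℝ) *
            ((piltz k n : ℂ) ^ 2 / n * (c - Real.log n))) =
            piltz k n * ((∫ t, f n t) - (√Real.pi * Δ : ℝ) * (b n / n)) := by
          rw [MeasureTheory.integral_const_mul, hb, piltzDerivCoeff, Pi.sub_apply, Pi.smul_apply,
            smul_eq_mul, LSeries.logMul, piltzCoeff, Complex.natCast_log]
          ring
        rw [e, norm_mul, Complex.norm_natCast]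
        exact mul_le_mul_of_nonneg_left h (Nat.cast_nonneg _)
    _ = √Real.pi * Δ * (Real.exp (-(Δ ^ 2 / (8 * (N + 1) ^ 2))) *
        (∑ n ∈ Finset.Icc 1 N, (piltz k n : ℝ) * n) * ∑' m, ‖LSeries.term b 2 m‖) := by
        rw [Finset.mul_sum, Finset.sum_mul, Finset.mul_sum]
        refine Finset.sum_congr rfl fun n _ => ?_
        ring
    _ ≤ _ := by
        gcongr
        exact sum_piltz_mul_le k N

theorem exists_norm_thetaDeriv_half_le : ∃ C : ℝ, 0 < C ∧ ∀ X τ : ℝ, 2 ≤ X → X ^ 64 / 2 ≤ τ →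
    τ ≤ X ^ 64 → ‖thetaDeriv (1 / 2 + τ * Complex.I)‖ ≤ C * X ^ 64 := by
  obtain ⟨C, hC, h⟩ := exists_norm_thetaDeriv_le
  refine ⟨3 * C, by positivity, fun X τ hX h1 h2 => ?_⟩
  have hX64 : 2 ≤ X ^ 64 := hX.trans (le_self_pow₀ (by linarith) (by norm_num))
  have hs := h (1 / 2 + τ * Complex.I) (by simp) (by norm_num) (by simp; linarith)
  have hn : ‖(1 / 2 + τ * Complex.I : ℂ)‖ ≤ 1 + X ^ 64 := by
    refine (norm_add_le _ _).trans ?_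
    rw [norm_mul, Complex.norm_I, mul_one, Complex.norm_real, Real.norm_of_nonneg (by linarith)]
    norm_num
    linarith
  calc _ ≤ _ := hs
    _ ≤ C * (3 * X ^ 64) := by gcongr; linarith
    _ = _ := by ring

theorem le_pow_div_of_two_le {X : ℝ} (hX : 2 ≤ X) {j : ℕ} (hj : 5 ≤ j) : X ≤ X ^ (j + 1) / 32 := by
  have : (32 : ℝ) ≤ X ^ j := by
    calc (32 : ℝ) = 2 ^ 5 := by norm_num
      _ ≤ X ^ 5 := by gcongr
      _ ≤ X ^ j := pow_le_pow_right₀ (by linarith) hj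
  rw [pow_succ]
  nlinarith

theorem norm_dirichletPoly_piltz_le (k : ℕ) {N : ℕ} {X : ℝ} (hN : (N : ℝ) ≤ X) {s : ℂ}
    (hs : s.re ≤ 2) : ‖dirichletPoly (fun n => piltz k n) N s‖ ≤ piltzSum k * X ^ 3 := by
  have := one_le_piltzSum k
  calc _ ≤ _ := norm_dirichletPoly_le (fun n => Nat.cast_nonneg _) N hs
    _ ≤ _ := sum_piltz_mul_le k N
    _ ≤ _ := by gcongr

/-- Replacing the theta derivative by its value at the centre of the Gaussian. -/
theorem exists_norm_integral_thetaDeriv_sub_le (k : ℕ) : ∃ C : ℝ, 0 < C ∧ ∀ X τ : ℝ, ∀ N : ℕ,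
    2 ≤ X → (N : ℝ) ≤ X → X ^ 64 / 2 ≤ τ → τ ≤ X ^ 64 →
    ‖∫ t in Set.Ioc (X ^ 64 / 4) (X ^ 64), gaussWeight (X ^ 16) τ ((2 : ℝ) + t * Complex.I) *
      (k * (thetaDeriv ((2 : ℝ) + t * Complex.I) - thetaDeriv (1 / 2 + τ * Complex.I)) *
        riemannZeta ((2 : ℝ) + t * Complex.I) ^ k) *
      dirichletPoly (fun n => piltz k n) N ((2 : ℝ) + t * Complex.I)‖ ≤ X ^ 16 * (C / X) := by
  obtain ⟨C, hC, h⟩ := exists_norm_thetaDeriv_sub_le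
  have hP := one_le_piltzSum k
  set P := piltzSum k with hPdef
  refine ⟨54 * k * C * P ^ 2 + 1, by positivity, fun X τ N hX hN h1 h2 => ?_⟩
  have hX0 : 0 < X := by linarith
  have hX64 : 4 ≤ X ^ 64 := by
    calc (4 : ℝ) = 2 ^ 2 := by norm_num
      _ ≤ X ^ 2 := by gcongr
      _ ≤ X ^ 64 := pow_le_pow_right₀ (by linarith) (by norm_num)
  have hX16 : 2 ≤ X ^ 16 := hX.trans (le_self_pow₀ (by linarith) (by norm_num))
  have hsqrt : √(X ^ 64 / 4) = X ^ 32 / 2 := by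
    rw [show X ^ 64 / 4 = (X ^ 32 / 2) ^ 2 by ring, Real.sqrt_sq (by positivity)]
  have hb := norm_setIntegral_le_of_le_gaussian (A := Set.Ioc (X ^ 64 / 4) (X ^ 64))
    measurableSet_Ioc (f := fun t : ℝ => gaussWeight (X ^ 16) τ ((2 : ℝ) + t * Complex.I) *
      (k * (thetaDeriv ((2 : ℝ) + t * Complex.I) - thetaDeriv (1 / 2 + τ * Complex.I)) *
        riemannZeta ((2 : ℝ) + t * Complex.I) ^ k) *
      dirichletPoly (fun n => piltz k n) N ((2 : ℝ) + t * Complex.I))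
    (M := 9 * X ^ 16 * (k * (C / (X ^ 32 / 2)) * P * (P * X ^ 3))) (Δ := X ^ 16) (τ := τ)
    (by positivity) (by positivity) (fun t ht => by
      have e1 := norm_gaussWeight_two_le hX16 τ t
      have e2 := h ((2 : ℝ) + t * Complex.I) (1 / 2 + τ * Complex.I) (X ^ 64 / 4) (by linarith)
        (by norm_num) (by norm_num) (by norm_num) (by norm_num) (by simpa using ht.1.le)
        (by simp; linarith)
      have e3 : ‖((2 : ℝ) + t * Complex.I : ℂ) - (1 / 2 + τ * Complex.I)‖ ≤ |t - τ| + 2 := by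
        have : ((2 : ℝ) + t * Complex.I : ℂ) - (1 / 2 + τ * Complex.I)
            = ((t - τ : ℝ) : ℂ) * Complex.I + (3 / 2 : ℝ) := by push_cast; ring
        rw [this]
        refine (norm_add_le _ _).trans ?_
        rw [norm_mul, Complex.norm_I, mul_one, Complex.norm_real, Complex.norm_real,
          Real.norm_eq_abs]
        norm_num
      have e4 := norm_riemannZeta_pow_le k (s := (2 : ℝ) + t * Complex.I) (by simp)
      have e5 := norm_dirichletPoly_piltz_le k hN (s := (2 : ℝ) + t * Complex.I) (by simp)
      have e6 := abs_add_two_mul_exp_le (Δ := X ^ 16) (by linarith) (t - τ)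
      rw [hsqrt] at e2
      rw [norm_mul, norm_mul, norm_mul, norm_mul, Complex.norm_natCast]
      calc _ ≤ 3 * Real.exp (-(t - τ) ^ 2 / (X ^ 16) ^ 2) *
            (k * (C * (|t - τ| + 2) / (X ^ 32 / 2)) * P) * (P * X ^ 3) := by
            gcongr
            exact e2.trans (by gcongr)
        _ = 3 * ((|t - τ| + 2) * Real.exp (-(t - τ) ^ 2 / (X ^ 16) ^ 2)) *
            (k * (C / (X ^ 32 / 2)) * P * (P * X ^ 3)) := by ring
        _ ≤ 3 * (3 * X ^ 16 * Real.exp (-(t - τ) ^ 2 / (2 * (X ^ 16) ^ 2))) *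
            (k * (C / (X ^ 32 / 2)) * P * (P * X ^ 3)) := by gcongr
        _ = _ := by ring)
  refine hb.trans ?_
  -- Relative to Δ = X^16 the error is X^16 from the linear factor, X³ from the polynomial and
  -- X^(-32) from the slow variation of θ'; so X^19/X^32 remains.
  have e : 9 * X ^ 16 * (k * (C / (X ^ 32 / 2)) * P * (P * X ^ 3)) * (3 * X ^ 16) =
      X ^ 16 * (54 * k * C * P ^ 2 * (X ^ 19 / X ^ 32)) := by
    field_simp
    ring
  rw [e]
  gcongr
  have hq : X ^ 19 / X ^ 32 ≤ 1 / X := by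
    rw [div_le_div_iff₀ (by positivity) hX0, one_mul, ← pow_succ]
    exact pow_le_pow_right₀ (by linarith) (by norm_num)
  calc _ ≤ 54 * k * C * P ^ 2 * (1 / X) := by gcongr
    _ ≤ _ := by
      rw [mul_one_div]
      gcongr
      linarith

/-- The twisted moment on the line `Re s = 2`. -/
theorem exists_norm_integral_two_sub_le (k : ℕ) : ∃ C : ℝ, 0 < C ∧ ∀ X τ : ℝ, ∀ N : ℕ,
    2 ≤ X → (N : ℝ) ≤ X → X ^ 64 / 2 ≤ τ → τ ≤ 3 / 4 * X ^ 64 →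
    ‖(∫ t in (X ^ 64 / 4)..(X ^ 64), gaussWeight (X ^ 16) τ ((2 : ℝ) + t * Complex.I) *
      zetaPowDeriv k ((2 : ℝ) + t * Complex.I) *
      dirichletPoly (fun n => piltz k n) N ((2 : ℝ) + t * Complex.I)) -
      (√Real.pi * X ^ 16 : ℝ) * ∑ n ∈ Finset.Icc 1 N, (piltz k n : ℂ) ^ 2 / n *
        (k * thetaDeriv (1 / 2 + τ * Complex.I) - Real.log n)‖ ≤
      X ^ 16 * (C / X + C * X ^ 67 * Real.exp (-X)) := by
  obtain ⟨C1, hC1, h1⟩ := exists_norm_integral_thetaDeriv_sub_le k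
  obtain ⟨C2, hC2, h2⟩ := exists_norm_thetaDeriv_half_le
  obtain ⟨C3, hC3, h3⟩ := exists_tsum_norm_term_piltzDerivCoeff_le k
  have hP := one_le_piltzSum k
  set P := piltzSum k with hPdef
  -- The 11 is 2 + 9: the off-diagonal error is at most 2Δ times the common quantity since √π ≤ 2,
  -- and the tail outside the window at most 9Δ times it, from 3 · 3Δ.
  refine ⟨C1 + 11 * (C3 * (1 + k * C2)) * P, by positivity, fun X τ N hX hN hτ1 hτ2 => ?_⟩
  have hX0 : 0 < X := by linarith
  have hX1 : 1 ≤ X := by linarith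
  have hX64 : 1 ≤ X ^ 64 := one_le_pow₀ hX1
  have hX16 : 2 ≤ X ^ 16 := hX.trans (le_self_pow₀ hX1 (by norm_num))
  set Δ := X ^ 16 with hΔ
  set T := X ^ 64 with hT
  have hΔ0 : 0 < Δ := by linarith
  set κ := thetaDeriv (1 / 2 + τ * Complex.I) with hκ
  set b := piltzDerivCoeff k (k * κ) with hb
  set B := ∑' m, ‖LSeries.term b 2 m‖ with hB
  have hB0 : 0 ≤ B := tsum_nonneg fun _ => norm_nonneg _
  have hBle : B ≤ C3 * (1 + k * C2) * T := by
    have hκle := h2 X τ hX hτ1 (by linarith)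
    refine (h3 _).trans ?_
    rw [mul_assoc C3]
    gcongr
    rw [norm_mul, Complex.norm_natCast]
    have : (k : ℝ) * ‖κ‖ ≤ k * (C2 * T) := by gcongr
    linarith
  have hN1 : (N + 1 : ℝ) ≤ 2 * X := by linarith
  have hΔN : 12 * (N + 1 : ℝ) ≤ Δ ^ 2 := by
    have h32 := le_pow_div_of_two_le hX (j := 31) (by norm_num)
    calc 12 * (N + 1 : ℝ) ≤ 32 * X := by linarith
      _ ≤ X ^ 32 := by linarith
      _ = Δ ^ 2 := by rw [hΔ]; ring
  have hq : Real.exp (-(Δ ^ 2 / (8 * (N + 1) ^ 2))) ≤ Real.exp (-X) := by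
    rw [Real.exp_le_exp, neg_le_neg_iff]
    refine (le_pow_div_of_two_le hX (j := 29) (by norm_num)).trans ?_
    calc X ^ (29 + 1) / 32 = Δ ^ 2 / (8 * (2 * X) ^ 2) := by
          rw [hΔ]
          field_simp
          ring
      _ ≤ _ := by gcongr
  set F : ℝ → ℂ := fun t => gaussWeight Δ τ ((2 : ℝ) + t * Complex.I) *
      LSeries b ((2 : ℝ) + t * Complex.I) *
      dirichletPoly (fun n => piltz k n) N ((2 : ℝ) + t * Complex.I) with hF
  set G : ℝ → ℂ := fun t => gaussWeight Δ τ ((2 : ℝ) + t * Complex.I) *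
      (k * (thetaDeriv ((2 : ℝ) + t * Complex.I) - κ) * riemannZeta ((2 : ℝ) + t * Complex.I) ^ k) *
      dirichletPoly (fun n => piltz k n) N ((2 : ℝ) + t * Complex.I) with hG
  set H : ℝ → ℂ := fun t => gaussWeight Δ τ ((2 : ℝ) + t * Complex.I) *
      zetaPowDeriv k ((2 : ℝ) + t * Complex.I) *
      dirichletPoly (fun n => piltz k n) N ((2 : ℝ) + t * Complex.I) with hH
  have hHFG : H = fun t => F t + G t := by
    ext t
    simp only [hH, hF, hG]
    rw [zetaPowDeriv_eq_LSeries_add k κ (s := (2 : ℝ) + t * Complex.I) (by simp)]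
    ring
  have hHc : ContinuousOn H (Set.Icc (T / 4) T) := by
    intro t ht
    have him : ((2 : ℝ) + t * Complex.I : ℂ).im ≠ 0 := by
      have : 0 < t := by linarith [ht.1]
      simpa using this.ne'
    have hline : ContinuousAt (fun t : ℝ => ((2 : ℝ) + t * Complex.I : ℂ)) t := by fun_prop
    have c1 : ContinuousAt (fun t : ℝ => zetaPowDeriv k ((2 : ℝ) + t * Complex.I)) t :=
      ContinuousAt.comp (g := zetaPowDeriv k) (differentiableAt_zetaPowDeriv k him).continuousAt hline
    have c2 : ContinuousAt (fun t : ℝ => gaussWeight Δ τ ((2 : ℝ) + t * Complex.I)) t :=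
      ContinuousAt.comp (g := gaussWeight Δ τ) (differentiable_gaussWeight Δ τ _).continuousAt hline
    have c3 : ContinuousAt (fun t : ℝ =>
        dirichletPoly (fun n => piltz k n) N ((2 : ℝ) + t * Complex.I)) t :=
      ContinuousAt.comp (g := dirichletPoly (fun n => piltz k n) N)
        (differentiable_dirichletPoly _ N _).continuousAt hline
    exact ((c2.mul c1).mul c3).continuousWithinAt
  obtain ⟨hFint, hFval⟩ := norm_integral_gaussWeight_piltz_sub_le k (k * κ) hΔ0 τ hΔN
  have hHint : MeasureTheory.IntegrableOn H (Set.Ioc (T / 4) T) :=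
    (hHc.integrableOn_Icc).mono_set Set.Ioc_subset_Icc_self
  have hGint : MeasureTheory.IntegrableOn G (Set.Ioc (T / 4) T) := by
    have : G = fun t => H t - F t := by rw [hHFG]; ext t; simp
    rw [this]
    exact hHint.sub hFint.integrableOn
  -- The Dirichlet series part is completed to the whole line, where the diagonal can be extracted.
  -- The correction from freezing θ' stays on the window, away from the real axis.
  have hsplit : ∫ t in (T / 4)..T, H t = (∫ t, F t) - (∫ t in (Set.Ioc (T / 4) T)ᶜ, F t) +
      ∫ t in Set.Ioc (T / 4) T, G t := by
    rw [intervalIntegral.integral_of_le (by linarith), hHFG,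
      MeasureTheory.integral_add hFint.integrableOn hGint,
      ← MeasureTheory.integral_add_compl (measurableSet_Ioc (a := T / 4) (b := T)) hFint]
    ring
  have hE2 := h1 X τ N hX hN hτ1 (by linarith)
  have hE3 := norm_setIntegral_le_of_le_gaussian (A := (Set.Ioc (T / 4) T)ᶜ)
    measurableSet_Ioc.compl (f := F) (M := 3 * Real.exp (-X) * B * (P * X ^ 3)) (Δ := Δ) (τ := τ)
    hΔ0 (by positivity) (fun t ht => by
      have e1 := norm_gaussWeight_two_le hX16 τ t
      have e4 := norm_LSeries_piltzDerivCoeff_le k (k * κ) (s := (2 : ℝ) + t * Complex.I) (by simp)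
      have e5 := norm_dirichletPoly_piltz_le k hN (s := (2 : ℝ) + t * Complex.I) (by simp)
      have hfar : (T / 4) ^ 2 ≤ (t - τ) ^ 2 := by
        rw [Set.mem_compl_iff, Set.mem_Ioc, not_and_or, not_lt, not_le] at ht
        rcases ht with ht | ht <;> nlinarith
      -- Both ends of the window are at distance at least T/4 from τ, so half of the exponent
      -- already exceeds X^96/32 ≥ X; the other half keeps the integral finite.
      have e6 : Real.exp (-(t - τ) ^ 2 / Δ ^ 2) ≤
          Real.exp (-X) * Real.exp (-(t - τ) ^ 2 / (2 * Δ ^ 2)) := by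
        rw [← Real.exp_add, Real.exp_le_exp]
        have h96 := le_pow_div_of_two_le hX (j := 95) (by norm_num)
        have e7 : X ^ (95 + 1) / 32 = (T / 4) ^ 2 / (2 * Δ ^ 2) := by
          rw [hT, hΔ]
          field_simp
          ring
        have e8 : (T / 4) ^ 2 / (2 * Δ ^ 2) ≤ (t - τ) ^ 2 / (2 * Δ ^ 2) := by gcongr
        have e9 : -(t - τ) ^ 2 / Δ ^ 2 = -((t - τ) ^ 2 / (2 * Δ ^ 2)) + -(t - τ) ^ 2 / (2 * Δ ^ 2) := by
          field_simp
          ring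
        rw [e9]
        linarith
      simp only [hF]
      rw [norm_mul, norm_mul]
      calc _ ≤ 3 * (Real.exp (-X) * Real.exp (-(t - τ) ^ 2 / (2 * Δ ^ 2))) * B * (P * X ^ 3) := by
            gcongr
            exact e1.trans (by gcongr)
        _ = _ := by ring)
  rw [hsplit]
  have hpi : √Real.pi ≤ 2 := by
    rw [Real.sqrt_le_left (by norm_num)]
    linarith [Real.pi_lt_four]
  have hN3 : (N : ℝ) ^ 3 ≤ X ^ 3 := by gcongr
  have hE4 : √Real.pi * Δ * (Real.exp (-(Δ ^ 2 / (8 * (N + 1) ^ 2))) * (P * (N : ℝ) ^ 3) * B)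
      ≤ 2 * Δ * (Real.exp (-X) * (P * X ^ 3) * B) := by gcongr
  have htri : ∀ a b c d : ℂ, ‖a - b + c - d‖ ≤ ‖a - d‖ + ‖b‖ + ‖c‖ := by
    intro a b c d
    calc ‖a - b + c - d‖ = ‖(a - d) - b + c‖ := by ring_nf
      _ ≤ ‖a - d - b‖ + ‖c‖ := norm_add_le _ _
      _ ≤ _ := by gcongr; exact norm_sub_le _ _
  refine (htri _ _ _ _).trans ((add_le_add (add_le_add (hFval.trans hE4) hE3) hE2).trans ?_)
  have hT67 : X ^ 67 = X ^ 3 * T := by rw [hT]; ring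
  rw [hT67]
  have hfin : Real.exp (-X) * (P * X ^ 3) * B ≤
      Real.exp (-X) * (P * X ^ 3) * (C3 * (1 + k * C2) * T) := by gcongr
  have hpos1 : 0 ≤ 11 * (C3 * (1 + k * C2)) * P / X := by positivity
  have hpos2 : 0 ≤ C1 * (X ^ 3 * T) * Real.exp (-X) := by positivity
  calc _ = Δ * (11 * (Real.exp (-X) * (P * X ^ 3) * B)) + Δ * (C1 / X) := by ring
    _ ≤ Δ * (11 * (Real.exp (-X) * (P * X ^ 3) * (C3 * (1 + k * C2) * T))) + Δ * (C1 / X) := by gcongr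
    _ ≤ Δ * (11 * (Real.exp (-X) * (P * X ^ 3) * (C3 * (1 + k * C2) * T)) +
        11 * (C3 * (1 + k * C2)) * P / X + C1 * (X ^ 3 * T) * Real.exp (-X) + C1 / X) := by
      nlinarith
    _ = _ := by ring

/-! ### Shifting the twisted moment to the critical line -/

theorem exists_norm_zetaPowDeriv_le (k : ℕ) : ∃ C : ℝ, 0 < C ∧ ∀ s : ℂ, 1 / 2 ≤ s.re → s.re ≤ 2 →
    1 ≤ s.im → ‖zetaPowDeriv k s‖ ≤ C * (1 + ‖s‖) ^ (k + 1) := by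
  obtain ⟨C1, hC1, h1⟩ := exists_norm_thetaDeriv_le
  obtain ⟨C2, hC2, h2⟩ := exists_norm_riemannZeta_le
  obtain ⟨C3, hC3, h3⟩ := exists_norm_deriv_riemannZeta_le
  refine ⟨k * C1 * C2 ^ k + k * C2 ^ (k - 1) * C3 + 1, by positivity, fun s hs1 hs2 him => ?_⟩
  have a1 := h1 s hs1 hs2 him
  have a2 := h2 s (by linarith) (by linarith [le_abs_self s.im])
  have a3 := h3 s hs1 (by linarith [le_abs_self s.im])
  set R := 1 + ‖s‖ with hR
  have hR1 : 1 ≤ R := by rw [hR]; linarith [norm_nonneg s]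
  have hR0 : 0 ≤ R := by linarith
  calc ‖zetaPowDeriv k s‖ ≤ k * ‖thetaDeriv s‖ * ‖riemannZeta s‖ ^ k +
        k * ‖riemannZeta s‖ ^ (k - 1) * ‖deriv riemannZeta s‖ := by
        refine (norm_add_le _ _).trans_eq ?_
        simp only [norm_mul, norm_pow, Complex.norm_natCast]
    _ ≤ k * (C1 * R) * (C2 * R) ^ k + k * (C2 * R) ^ (k - 1) * (C3 * R) := by gcongr
    -- The exponent is left as k - 1 + 1 because with truncated subtraction it equals 1, not 0, when
    -- k = 0.
    _ = k * C1 * C2 ^ k * R ^ (k + 1) + k * C2 ^ (k - 1) * C3 * R ^ (k - 1 + 1) := by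
        rw [mul_pow, mul_pow, pow_succ, pow_succ]; ring
    _ ≤ k * C1 * C2 ^ k * R ^ (k + 1) + k * C2 ^ (k - 1) * C3 * R ^ (k + 1) := by
        gcongr
        omega
    _ ≤ _ := by
        have : 0 ≤ R ^ (k + 1) := by positivity
        linarith

/-- Shifting an integral from the line `Re s = 1/2` to the line `Re s = 2`. -/
theorem norm_integral_half_sub_integral_two_le {f : ℂ → ℂ}
    (hf : ∀ s : ℂ, s.im ≠ 0 → DifferentiableAt ℂ f s) {a b M : ℝ} (ha : 0 < a) (hab : a ≤ b)
    (hM : ∀ x : ℝ, 1 / 2 ≤ x → x ≤ 2 → ‖f (x + a * Complex.I)‖ ≤ M ∧ ‖f (x + b * Complex.I)‖ ≤ M) :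
    ‖(∫ t in a..b, f (1 / 2 + t * Complex.I)) - ∫ t in a..b, f ((2 : ℝ) + t * Complex.I)‖
      ≤ 3 * M := by
  have h := Complex.integral_boundary_rect_eq_zero_of_differentiableOn f
    (((1 / 2 : ℝ) : ℂ) + a * Complex.I) (((2 : ℝ) : ℂ) + b * Complex.I) (fun s hs => by
      refine (hf s ?_).differentiableWithinAt
      have h2 := (Complex.mem_reProdIm.1 hs).2
      have e1 : (((1 / 2 : ℝ) : ℂ) + a * Complex.I).im = a := by simp
      have e2 : (((2 : ℝ) : ℂ) + b * Complex.I).im = b := by simp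
      rw [e1, e2, Set.uIcc_of_le hab] at h2
      linarith [h2.1])
  have e1 : (((1 / 2 : ℝ) : ℂ) + a * Complex.I).im = a := by simp
  have e2 : (((2 : ℝ) : ℂ) + b * Complex.I).im = b := by simp
  have e3 : (((1 / 2 : ℝ) : ℂ) + a * Complex.I).re = 1 / 2 := by simp
  have e4 : (((2 : ℝ) : ℂ) + b * Complex.I).re = 2 := by simp
  rw [e1, e2, e3, e4] at h
  have b1 := intervalIntegral.norm_integral_le_of_norm_le_const (a := (1 / 2 : ℝ)) (b := 2)
    (f := fun x : ℝ => f (x + a * Complex.I)) (C := M) fun x hx => by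
      rw [Set.uIoc_of_le (by norm_num)] at hx
      exact (hM x hx.1.le hx.2).1
  have b2 := intervalIntegral.norm_integral_le_of_norm_le_const (a := (1 / 2 : ℝ)) (b := 2)
    (f := fun x : ℝ => f (x + b * Complex.I)) (C := M) fun x hx => by
      rw [Set.uIoc_of_le (by norm_num)] at hx
      exact (hM x hx.1.le hx.2).2
  set A := ∫ x in (1 / 2 : ℝ)..2, f (x + a * Complex.I)
  set B := ∫ x in (1 / 2 : ℝ)..2, f (x + b * Complex.I)
  set D := ∫ t in a..b, f ((2 : ℝ) + t * Complex.I)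
  have e5 : ((1 / 2 : ℝ) : ℂ) = 1 / 2 := by push_cast; rfl
  rw [e5] at h
  set E := ∫ t in a..b, f (1 / 2 + t * Complex.I)
  have h' : Complex.I * (E - D) = A - B := by
    simp only [smul_eq_mul] at h
    linear_combination -h
  have hn : ‖E - D‖ = ‖A - B‖ := by
    rw [← h', norm_mul, Complex.norm_I, one_mul]
  rw [hn]
  refine (norm_sub_le _ _).trans ((add_le_add b1 b2).trans (le_of_eq ?_))
  norm_num
  ring

/-- The twisted moment on the critical line. -/
theorem exists_norm_integral_half_sub_le (k : ℕ) : ∃ C : ℝ, 0 < C ∧ ∀ X τ : ℝ, ∀ N : ℕ,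
    2 ≤ X → (N : ℝ) ≤ X → X ^ 64 / 2 ≤ τ → τ ≤ 3 / 4 * X ^ 64 →
    ‖(∫ t in (X ^ 64 / 4)..(X ^ 64), gaussWeight (X ^ 16) τ (1 / 2 + t * Complex.I) *
      zetaPowDeriv k (1 / 2 + t * Complex.I) *
      dirichletPoly (fun n => piltz k n) N (1 / 2 + t * Complex.I)) -
      (√Real.pi * X ^ 16 : ℝ) * ∑ n ∈ Finset.Icc 1 N, (piltz k n : ℂ) ^ 2 / n *
        (k * thetaDeriv (1 / 2 + τ * Complex.I) - Real.log n)‖ ≤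
      X ^ 16 * (C / X + C * X ^ (64 * (k + 1) + 3) * Real.exp (-X)) := by
  obtain ⟨C1, hC1, h1⟩ := exists_norm_integral_two_sub_le k
  obtain ⟨C2, hC2, h2⟩ := exists_norm_zetaPowDeriv_le k
  have hP := one_le_piltzSum k
  set P := piltzSum k with hPdef
  refine ⟨C1 + 3 * (C2 * 4 ^ (k + 1)) * P, by positivity, fun X τ N hX hN hτ1 hτ2 => ?_⟩
  have hX1 : 1 ≤ X := by linarith
  have hX0 : 0 < X := by linarith
  have hX64 : 4 ≤ X ^ 64 := by
    calc (4 : ℝ) = 2 ^ 2 := by norm_num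
      _ ≤ X ^ 2 := by gcongr
      _ ≤ X ^ 64 := pow_le_pow_right₀ hX1 (by norm_num)
  have hX16 : 1 ≤ X ^ 16 := one_le_pow₀ hX1
  set T := X ^ 64 with hT
  set f : ℂ → ℂ := fun s => gaussWeight (X ^ 16) τ s * zetaPowDeriv k s *
    dirichletPoly (fun n => piltz k n) N s with hf
  -- On the horizontal edges the Gaussian is at most exp(-X), which beats the polynomial growth of
  -- the other factors.
  have hedge : ∀ x y : ℝ, 1 / 2 ≤ x → x ≤ 2 → 1 ≤ y → y ≤ T → (T / 4) ^ 2 ≤ (y - τ) ^ 2 →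
      ‖f (x + y * Complex.I)‖ ≤ Real.exp (-X) * (C2 * (4 * T) ^ (k + 1)) * (P * X ^ 3) := by
    intro x y hx1 hx2 hy1 hyT hfar
    have hre : (x + y * Complex.I : ℂ).re = x := by simp
    have him : (x + y * Complex.I : ℂ).im = y := by simp
    have a1 := h2 (x + y * Complex.I) (by rw [hre]; exact hx1) (by rw [hre]; exact hx2)
      (by rw [him]; exact hy1)
    have a2 := norm_dirichletPoly_piltz_le k hN (s := x + y * Complex.I) (by rw [hre]; exact hx2)
    have a3 : ‖(x + y * Complex.I : ℂ)‖ ≤ 2 + T := by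
      refine (norm_add_le _ _).trans ?_
      rw [norm_mul, Complex.norm_I, mul_one, Complex.norm_real, Complex.norm_real,
        Real.norm_of_nonneg (by linarith), Real.norm_of_nonneg (by linarith)]
      linarith
    have a4 : ‖gaussWeight (X ^ 16) τ (x + y * Complex.I)‖ ≤ Real.exp (-X) := by
      rw [norm_gaussWeight, Real.exp_le_exp, div_le_iff₀ (by positivity)]
      have e1 := le_pow_div_of_two_le hX (j := 95) (by norm_num)
      have e2 : X ^ (95 + 1) * X ^ 32 = T ^ 2 := by rw [hT]; ring
      have e3 : (X ^ 16) ^ 2 = X ^ 32 := by ring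
      have e4 : 1 ≤ X ^ 32 := one_le_pow₀ hX1
      rw [e3]
      have e5 : X * X ^ 32 ≤ T ^ 2 / 32 := by
        rw [← e2]
        nlinarith
      have e6 : (x - 1 / 2) ^ 2 ≤ 9 / 4 := by nlinarith
      have e7 : X * X ^ 32 ≥ 2 := by nlinarith
      nlinarith
    simp only [hf]
    rw [norm_mul, norm_mul]
    gcongr
    exact a1.trans (by gcongr; linarith)
  have hshift := norm_integral_half_sub_integral_two_le (f := f) (fun s hs =>
      ((differentiable_gaussWeight _ τ s).mul (differentiableAt_zetaPowDeriv k hs)).mul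
        (differentiable_dirichletPoly _ N s)) (a := T / 4) (b := T)
    (M := Real.exp (-X) * (C2 * (4 * T) ^ (k + 1)) * (P * X ^ 3)) (by linarith) (by linarith)
    (fun x hx1 hx2 => ⟨hedge x _ hx1 hx2 (by linarith) (by linarith) (by nlinarith),
      hedge x _ hx1 hx2 (by linarith) le_rfl (by nlinarith)⟩)
  have hright := h1 X τ N hX hN hτ1 hτ2
  refine (norm_sub_le_norm_sub_add_norm_sub _ (∫ t in (T / 4)..T, f ((2 : ℝ) + t * Complex.I)) _).trans
    ((add_le_add hshift hright).trans ?_)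
  have hpow : X ^ 3 * T ^ (k + 1) = X ^ (64 * (k + 1) + 3) := by
    rw [hT, ← pow_mul, ← pow_add]
    ring_nf
  have h67 : X ^ 67 ≤ X ^ (64 * (k + 1) + 3) := pow_le_pow_right₀ hX1 (by omega)
  set Y := X ^ (64 * (k + 1) + 3) with hY
  have hY0 : 0 < Y := by positivity
  set W := 3 * (C2 * 4 ^ (k + 1)) * P with hW
  have hW0 : 0 ≤ W := by positivity
  have e1 : 3 * (Real.exp (-X) * (C2 * (4 * T) ^ (k + 1)) * (P * X ^ 3)) = W * Y * Real.exp (-X) := by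
    rw [hW, ← hpow, mul_pow]
    ring
  rw [e1]
  have e2 : W * Y * Real.exp (-X) ≤ X ^ 16 * (W * Y * Real.exp (-X)) :=
    le_mul_of_one_le_left (by positivity) hX16
  have e3 : C1 * X ^ 67 * Real.exp (-X) ≤ C1 * Y * Real.exp (-X) := by gcongr
  have e4 : 0 ≤ X ^ 16 * (W / X) := by positivity
  calc _ ≤ X ^ 16 * (W * Y * Real.exp (-X)) + X ^ 16 * (C1 / X + C1 * Y * Real.exp (-X)) := by gcongr
    _ ≤ X ^ 16 * (W * Y * Real.exp (-X)) + X ^ 16 * (C1 / X + C1 * Y * Real.exp (-X)) +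
        X ^ 16 * (W / X) := by linarith
    _ = _ := by ring

/-! ### Lower bound by duality and averaging -/

/-- Half of log τ is about 32 log X; part of it absorbs the constants. What is left exceeds log n
for every n ≤ X, and this keeps the diagonal sum positive. -/
theorem exists_mul_log_le_re_thetaDeriv : ∃ X₀ : ℝ, 2 ≤ X₀ ∧ ∀ X τ : ℝ, X₀ ≤ X → X ^ 64 / 2 ≤ τ →
    16 * Real.log X ≤ (thetaDeriv (1 / 2 + τ * Complex.I)).re := by
  obtain ⟨C, h⟩ := exists_le_re_thetaDeriv
  have hev := (Real.tendsto_log_atTop.eventually_ge_atTop (C + Real.log 2)).and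
    (Filter.eventually_ge_atTop (2 : ℝ))
  obtain ⟨X₀, hX₀⟩ := Filter.eventually_atTop.1 hev
  refine ⟨max X₀ 2, le_max_right _ _, fun X τ hX hτ => ?_⟩
  obtain ⟨hlog, hX2⟩ := hX₀ X ((le_max_left _ _).trans hX)
  have hX64 : 4 ≤ X ^ 64 := by
    calc (4 : ℝ) = 2 ^ 2 := by norm_num
      _ ≤ X ^ 2 := by gcongr
      _ ≤ X ^ 64 := pow_le_pow_right₀ (by linarith) (by norm_num)
  have h1 := h τ (by linarith)
  have h2 : 64 * Real.log X - Real.log 2 ≤ Real.log τ := by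
    have : Real.log (X ^ 64 / 2) = 64 * Real.log X - Real.log 2 := by
      rw [Real.log_div (by positivity) two_ne_zero, Real.log_pow]
      norm_num
    rw [← this]
    exact Real.log_le_log (by positivity) hτ
  have h3 := Real.log_pos one_lt_two
  have h4 : 0 < Real.log X := Real.log_pos (by linarith)
  linarith

/-- The mean square weighted by `1 / n` of the Piltz function. -/
noncomputable def piltzMeanSq (k N : ℕ) : ℝ := ∑ n ∈ Finset.Icc 1 N, (piltz k n : ℝ) ^ 2 / n

theorem one_le_piltzMeanSq (k : ℕ) {N : ℕ} (hN : 1 ≤ N) : 1 ≤ piltzMeanSq k N := by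
  have h := Finset.single_le_sum (f := fun n : ℕ => (piltz k n : ℝ) ^ 2 / n)
    (fun n _ => by positivity) (Finset.mem_Icc.2 ⟨le_rfl, hN⟩)
  rw [piltzMeanSq]
  simpa [piltz_one_right] using h

theorem sum_piltz_le (k N : ℕ) :
    ∑ n ∈ Finset.Icc 1 N, (piltz k n : ℝ) ≤ piltzSum k * (N : ℝ) ^ 3 := by
  refine (Finset.sum_le_sum fun n hn => ?_).trans (sum_piltz_mul_le k N)
  have : (1 : ℝ) ≤ n := by exact_mod_cast (Finset.mem_Icc.1 hn).1
  exact le_mul_of_one_le_right (Nat.cast_nonneg _) this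

theorem continuousAt_zetaPowDeriv_half (k : ℕ) {t : ℝ} (ht : 0 < t) :
    ContinuousAt (fun t : ℝ => zetaPowDeriv k (1 / 2 + t * Complex.I)) t := by
  have him : (1 / 2 + t * Complex.I : ℂ).im ≠ 0 := by simpa using ht.ne'
  exact ContinuousAt.comp (g := zetaPowDeriv k) (differentiableAt_zetaPowDeriv k him).continuousAt
    (by fun_prop)

/-- Duality: a lower bound for a weighted mean square from a twisted moment. -/
theorem two_mul_re_integral_sub_le {a b : ℝ} (hab : a ≤ b) {e : ℝ → ℝ} {G A : ℝ → ℂ}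
    (he : ∀ t, 0 ≤ e t) (ce : Continuous e) (cG : ContinuousOn G (Set.uIcc a b))
    (cA : Continuous A) {l : ℝ} (hl : 0 ≤ l) :
    2 * l * (∫ t in a..b, (e t : ℂ) * G t * A t).re - l ^ 2 * ∫ t in a..b, e t * ‖A t‖ ^ 2 ≤
      ∫ t in a..b, e t * ‖G t‖ ^ 2 := by
  have iG : IntervalIntegrable (fun t => e t * ‖G t‖ ^ 2) MeasureTheory.volume a b :=
    (ce.continuousOn.mul (cG.norm.pow 2)).intervalIntegrable
  have iA : IntervalIntegrable (fun t => e t * ‖A t‖ ^ 2) MeasureTheory.volume a b :=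
    (ce.mul (cA.norm.pow 2)).intervalIntegrable _ _
  have cJ : ContinuousOn (fun t => (e t : ℂ) * G t * A t) (Set.uIcc a b) :=
    ((Complex.continuous_ofReal.comp ce).continuousOn.mul cG).mul cA.continuousOn
  have iJre : IntervalIntegrable (fun t => ((e t : ℂ) * G t * A t).re) MeasureTheory.volume a b :=
    (Complex.continuous_re.comp_continuousOn cJ).intervalIntegrable
  have hJre : (∫ t in a..b, (e t : ℂ) * G t * A t).re =
      ∫ t in a..b, ((e t : ℂ) * G t * A t).re :=
    (Complex.reCLM.intervalIntegral_comp_comm cJ.intervalIntegrable).symm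
  have hpt : ∀ t ∈ Set.Icc a b, 2 * l * ((e t : ℂ) * G t * A t).re - l ^ 2 * (e t * ‖A t‖ ^ 2)
      ≤ e t * ‖G t‖ ^ 2 := by
    intro t _
    have h10 : ((e t : ℂ) * G t * A t).re ≤ e t * (‖G t‖ * ‖A t‖) := by
      refine (Complex.re_le_norm _).trans_eq ?_
      rw [norm_mul, norm_mul, Complex.norm_real, Real.norm_of_nonneg (he t), mul_assoc]
    have h11 := mul_le_mul_of_nonneg_left h10 hl
    -- The whole inequality is the nonnegativity of (‖G‖ - l‖A‖)² under the weight, with l still to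
    -- be optimized.
    have h12 := mul_nonneg (he t) (sq_nonneg (‖G t‖ - l * ‖A t‖))
    have h13 : e t * (‖G t‖ - l * ‖A t‖) ^ 2 = e t * ‖G t‖ ^ 2 - 2 * (l * (e t * (‖G t‖ * ‖A t‖)))
        + l ^ 2 * (e t * ‖A t‖ ^ 2) := by ring
    linarith
  have hmono := intervalIntegral.integral_mono_on hab
    ((iJre.const_mul (2 * l)).sub (iA.const_mul (l ^ 2))) iG hpt
  rwa [intervalIntegral.integral_sub (iJre.const_mul _) (iA.const_mul _),
    intervalIntegral.integral_const_mul, intervalIntegral.integral_const_mul, ← hJre] at hmono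

/-- Lower bound for the Gaussian mean square of `(ζ ^ k)' + k θ' ζ ^ k` on the critical line. -/
theorem exists_le_integral_gauss_mul_norm_sq {k : ℕ} (hk : 1 ≤ k) :
    ∃ X₀ : ℝ, 2 ≤ X₀ ∧ ∀ X τ : ℝ, ∀ N : ℕ,
    X₀ ≤ X → 1 ≤ N → (N : ℝ) ≤ X → X ^ 64 / 2 ≤ τ → τ ≤ 3 / 4 * X ^ 64 →
    √Real.pi * X ^ 16 * (8 * k ^ 2 * Real.log X ^ 2 * piltzMeanSq k N) ≤
      ∫ t in (X ^ 64 / 4)..(X ^ 64), Real.exp (-(t - τ) ^ 2 / (X ^ 16) ^ 2) *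
        ‖zetaPowDeriv k (1 / 2 + t * Complex.I)‖ ^ 2 := by
  obtain ⟨C, hC, h1⟩ := exists_norm_integral_half_sub_le k
  obtain ⟨X₁, hX₁, h2⟩ := exists_mul_log_le_re_thetaDeriv
  have hlim1 : Filter.Tendsto (fun X : ℝ => C / X + C * X ^ (64 * (k + 1) + 3) * Real.exp (-X))
      Filter.atTop (nhds 0) := by
    have a := (tendsto_const_nhds (x := C)).div_atTop Filter.tendsto_id
    have b := (Real.tendsto_pow_mul_exp_neg_atTop_nhds_zero (64 * (k + 1) + 3)).const_mul C
    simpa [mul_assoc] using a.add b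
  have hlim2 : Filter.Tendsto (fun X : ℝ => piltzSum k ^ 2 * (X ^ 6 * Real.exp (-X)))
      Filter.atTop (nhds 0) := by
    simpa using (Real.tendsto_pow_mul_exp_neg_atTop_nhds_zero 6).const_mul (piltzSum k ^ 2)
  obtain ⟨X₂, hX₂⟩ := Filter.eventually_atTop.1
    ((hlim1.eventually_le_const one_pos).and (hlim2.eventually_le_const one_pos))
  refine ⟨max X₁ X₂, hX₁.trans (le_max_left _ _), fun X τ N hX hN1 hNX hτ1 hτ2 => ?_⟩
  have hX1 : X₁ ≤ X := (le_max_left _ _).trans hX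
  have hX2 : 2 ≤ X := hX₁.trans hX1
  have hX0 : 0 < X := by linarith
  obtain ⟨herr1, herr2⟩ := hX₂ X ((le_max_right _ _).trans hX)
  have hI := h1 X τ N hX2 hNX hτ1 hτ2
  have hκ := h2 X τ hX1 hτ1
  have hk' : (1 : ℝ) ≤ k := by exact_mod_cast hk
  have hlogX : 1 / 2 ≤ Real.log X := by
    have := Real.log_le_log (by norm_num) hX2
    linarith [Real.log_two_gt_d9]
  have hT0 : 0 < X ^ 64 := by positivity
  set T := X ^ 64 with hT
  set Δ := X ^ 16 with hΔ
  have hΔ0 : 0 < Δ := by positivity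
  set S := piltzMeanSq k N with hS
  have hS1 : 1 ≤ S := one_le_piltzMeanSq k hN1
  set c := √Real.pi * Δ with hc
  have hpi : 1 ≤ √Real.pi := Real.one_le_sqrt.2 (by linarith [Real.pi_gt_three])
  have hc0 : 0 < c := by positivity
  have hΔc : Δ ≤ c := by rw [hc]; nlinarith
  set L := Real.log X with hL
  set κ := thetaDeriv (1 / 2 + τ * Complex.I) with hκdef
  set A : ℝ → ℂ := fun t => dirichletPoly (fun n => piltz k n) N (1 / 2 + t * Complex.I) with hA
  set G : ℝ → ℂ := fun t => zetaPowDeriv k (1 / 2 + t * Complex.I) with hG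
  set e : ℝ → ℝ := fun t => Real.exp (-(t - τ) ^ 2 / Δ ^ 2) with he
  -- Termwise, k Re κ - log n ≥ 16kL - L ≥ 8kL.
  have hmain : c * (8 * k * L * S) ≤
      ((c : ℂ) * ∑ n ∈ Finset.Icc 1 N, (piltz k n : ℂ) ^ 2 / n * (k * κ - Real.log n)).re := by
    rw [Complex.re_ofReal_mul, Complex.re_sum, hS, piltzMeanSq, Finset.mul_sum]
    refine mul_le_mul_of_nonneg_left (Finset.sum_le_sum fun n hn => ?_) hc0.le
    obtain ⟨hn1, hnN⟩ := Finset.mem_Icc.1 hn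
    have hlogn : Real.log n ≤ L := Real.log_le_log (by exact_mod_cast hn1)
      ((by exact_mod_cast hnN : (n : ℝ) ≤ N).trans hNX)
    have e1 : ((piltz k n : ℂ) ^ 2 / n * (k * κ - Real.log n)).re =
        (piltz k n : ℝ) ^ 2 / n * (k * κ.re - Real.log n) := by
      have : ((piltz k n : ℂ) ^ 2 / n) = (((piltz k n : ℝ) ^ 2 / n : ℝ) : ℂ) := by push_cast; rfl
      rw [this, Complex.re_ofReal_mul, Complex.sub_re, Complex.ofReal_re, ← Complex.ofReal_natCast,
        Complex.re_ofReal_mul]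
    rw [e1, mul_comm]
    refine mul_le_mul_of_nonneg_left ?_ (by positivity)
    nlinarith
  -- Half of the main term absorbs the error, which is at most Δ ≤ c.
  have hJ : c * (4 * k * L * S) ≤ (∫ t in (T / 4)..T, (e t : ℂ) * G t * A t).re := by
    have hI' := (Complex.abs_re_le_norm _).trans hI
    have hfun : ∀ t : ℝ, gaussWeight Δ τ (1 / 2 + t * Complex.I) = (e t : ℂ) := fun t =>
      gaussWeight_half Δ τ t
    simp only [hfun] at hI'
    rw [Complex.sub_re] at hI'
    have h5 := (abs_le.1 hI').1
    have h6 : Δ * (C / X + C * X ^ (64 * (k + 1) + 3) * Real.exp (-X)) ≤ c := by nlinarith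
    have h7 : c ≤ c * (4 * k * L * S) := by
      refine le_mul_of_one_le_right hc0.le ?_
      have : 1 ≤ k * (2 * L) := by nlinarith
      nlinarith
    have h8 : c * (8 * k * L * S) = c * (4 * k * L * S) + c * (4 * k * L * S) := by ring
    simp only [hA, hG] at h5 ⊢
    linarith
  obtain ⟨hAint, hAval⟩ := integral_gaussWeight_mul_norm_dirichletPoly_sq_le
    (a := fun n => (piltz k n : ℝ)) (fun n => Nat.cast_nonneg _) N hΔ0 τ
  have hAle : ∫ t in (T / 4)..T, e t * ‖A t‖ ^ 2 ≤ c * (2 * S) := by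
    rw [intervalIntegral.integral_of_le (by linarith)]
    refine (MeasureTheory.setIntegral_le_integral hAint
      (Filter.Eventually.of_forall fun t => by positivity)).trans (hAval.trans ?_)
    refine mul_le_mul_of_nonneg_left ?_ hc0.le
    have hq : Real.exp (-(Δ ^ 2 / (8 * (N + 1) ^ 2))) ≤ Real.exp (-X) := by
      rw [Real.exp_le_exp, neg_le_neg_iff]
      refine (le_pow_div_of_two_le hX2 (j := 29) (by norm_num)).trans ?_
      have hN1' : (N + 1 : ℝ) ≤ 2 * X := by linarith
      calc X ^ (29 + 1) / 32 = Δ ^ 2 / (8 * (2 * X) ^ 2) := by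
            rw [hΔ]
            field_simp
            ring
        _ ≤ _ := by gcongr
    have hsum : (∑ n ∈ Finset.Icc 1 N, (piltz k n : ℝ)) ^ 2 ≤ (piltzSum k * X ^ 3) ^ 2 := by
      have := one_le_piltzSum k
      gcongr
      exact (sum_piltz_le k N).trans (by gcongr)
    have h9 : Real.exp (-(Δ ^ 2 / (8 * (N + 1) ^ 2))) * (∑ n ∈ Finset.Icc 1 N, (piltz k n : ℝ)) ^ 2
        ≤ 1 := by
      calc _ ≤ Real.exp (-X) * (piltzSum k * X ^ 3) ^ 2 := by gcongr
        _ = piltzSum k ^ 2 * (X ^ 6 * Real.exp (-X)) := by ring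
        _ ≤ 1 := herr2
    rw [two_mul]
    exact add_le_add le_rfl (h9.trans hS1)
  have hpos : ∀ t ∈ Set.uIcc (T / 4) T, 0 < t := fun t ht => by
    rw [Set.uIcc_of_le (by linarith)] at ht
    linarith [ht.1]
  have cG : ContinuousOn G (Set.uIcc (T / 4) T) := fun t ht =>
    (continuousAt_zetaPowDeriv_half k (hpos t ht)).continuousWithinAt
  have cA : Continuous A := (differentiable_dirichletPoly _ N).continuous.comp (by fun_prop)
  have ce : Continuous e := by
    simp only [he]
    fun_prop
  -- This is the ratio of the bounds 4kLS for the twisted moment and 2S for the mean square, the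
  -- optimal multiplier.
  set lam := 2 * k * L with hlam
  have hlam0 : 0 ≤ lam := by positivity
  refine le_trans ?_ (two_mul_re_integral_sub_le (by linarith : T / 4 ≤ T)
    (fun t => (Real.exp_pos _).le) ce cG cA hlam0)
  have f1 := mul_le_mul_of_nonneg_left hJ (by positivity : 0 ≤ 2 * lam)
  have f2 := mul_le_mul_of_nonneg_left hAle (sq_nonneg lam)
  have f3 : c * (8 * k ^ 2 * L ^ 2 * S) = 2 * lam * (c * (4 * k * L * S)) - lam ^ 2 * (c * (2 * S)) := by
    rw [hlam]
    ring
  linarith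

/-- Unweighted lower bound, obtained by averaging the Gaussian weights over their centres. -/
theorem exists_le_integral_norm_zetaPowDeriv_sq {k : ℕ} (hk : 1 ≤ k) :
    ∃ X₀ : ℝ, 2 ≤ X₀ ∧ ∀ X : ℝ, ∀ N : ℕ, X₀ ≤ X → 1 ≤ N → (N : ℝ) ≤ X →
    2 * k ^ 2 * (X ^ 64 * Real.log X ^ 2 * piltzMeanSq k N) ≤
      ∫ t in (X ^ 64 / 4)..(X ^ 64), ‖zetaPowDeriv k (1 / 2 + t * Complex.I)‖ ^ 2 := by
  obtain ⟨X₀, hX₀, h⟩ := exists_le_integral_gauss_mul_norm_sq hk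
  refine ⟨X₀, hX₀, fun X N hX hN1 hNX => ?_⟩
  have hX0 : 0 < X := by linarith
  have hT0 : 0 < X ^ 64 := by positivity
  have hΔ0 : 0 < X ^ 16 := by positivity
  set T := X ^ 64 with hT
  set Δ := X ^ 16 with hΔ
  set g : ℝ → ℝ := fun t => ‖zetaPowDeriv k (1 / 2 + t * Complex.I)‖ ^ 2 with hg
  have cg : ContinuousOn g (Set.uIcc (T / 4) T) := fun t ht => by
    rw [Set.uIcc_of_le (by linarith)] at ht
    exact ((continuousAt_zetaPowDeriv_half k (by linarith [ht.1])).norm.pow 2).continuousWithinAt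
  have cF : ContinuousOn (Function.uncurry fun τ t : ℝ => Real.exp (-(t - τ) ^ 2 / Δ ^ 2) * g t)
      (Set.uIcc (T / 2) (3 / 4 * T) ×ˢ Set.uIcc (T / 4) T) := by
    refine ContinuousOn.mul (Continuous.continuousOn (by fun_prop)) ?_
    exact cg.comp continuous_snd.continuousOn fun p hp => hp.2
  have hswap := MeasureTheory.intervalIntegral_intervalIntegral_swap
    (F := fun τ t : ℝ => Real.exp (-(t - τ) ^ 2 / Δ ^ 2) * g t) (a := T / 2) (b := 3 / 4 * T)
    (c := T / 4) (d := T)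
    ((cF.integrableOn_compact (isCompact_uIcc.prod isCompact_uIcc)).mono_set
      (Set.prod_mono Set.uIoc_subset_uIcc Set.uIoc_subset_uIcc))
  have hF : MeasureTheory.Integrable
      (Function.uncurry fun τ t : ℝ => Real.exp (-(t - τ) ^ 2 / Δ ^ 2) * g t)
      ((MeasureTheory.volume.restrict (Set.Ioc (T / 2) (3 / 4 * T))).prod
        (MeasureTheory.volume.restrict (Set.Ioc (T / 4) T))) := by
    rw [MeasureTheory.Measure.prod_restrict, ← MeasureTheory.Measure.volume_eq_prod]
    refine (cF.integrableOn_compact (isCompact_uIcc.prod isCompact_uIcc)).mono_set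
      (Set.prod_mono ?_ ?_)
    · rw [← Set.uIoc_of_le (by linarith)]; exact Set.uIoc_subset_uIcc
    · rw [← Set.uIoc_of_le (by linarith)]; exact Set.uIoc_subset_uIcc
  -- For each fixed t the Gaussians over all centres have total mass at most √π Δ, the very factor
  -- present in the weighted bound, so it cancels after the integrals are interchanged.
  have hinner : ∀ t : ℝ, ∫ τ in (T / 2)..(3 / 4 * T), Real.exp (-(t - τ) ^ 2 / Δ ^ 2)
      ≤ √Real.pi * Δ := by
    intro t
    have e1 : (fun τ : ℝ => Real.exp (-(t - τ) ^ 2 / Δ ^ 2)) =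
        fun τ : ℝ => Real.exp (-(1 / Δ ^ 2) * (τ - t) ^ 2) := by
      ext τ
      congr 1
      field_simp
      ring
    have hi : MeasureTheory.Integrable fun τ : ℝ => Real.exp (-(1 / Δ ^ 2) * (τ - t) ^ 2) :=
      (integrable_exp_neg_mul_sq (by positivity : 0 < 1 / Δ ^ 2)).comp_sub_right t
    rw [e1, intervalIntegral.integral_of_le (by linarith)]
    refine (MeasureTheory.setIntegral_le_integral hi
      (Filter.Eventually.of_forall fun τ => (Real.exp_pos _).le)).trans_eq ?_
    rw [MeasureTheory.integral_sub_right_eq_self (fun t : ℝ => Real.exp (-(1 / Δ ^ 2) * t ^ 2)),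
      integral_gaussian, div_div_eq_mul_div, div_one, Real.sqrt_mul Real.pi_pos.le,
      Real.sqrt_sq hΔ0.le]
  -- The centres fill an interval of length T/4, which turns the constant 8 into 2.
  have hlow : T / 4 * (√Real.pi * Δ * (8 * k ^ 2 * Real.log X ^ 2 * piltzMeanSq k N)) ≤
      ∫ τ in (T / 2)..(3 / 4 * T), ∫ t in (T / 4)..T, Real.exp (-(t - τ) ^ 2 / Δ ^ 2) * g t := by
    have hconst := intervalIntegral.integral_const (a := T / 2) (b := 3 / 4 * T) (√Real.pi * Δ * (8 * k ^ 2 * Real.log X ^ 2 * piltzMeanSq k N))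
    rw [smul_eq_mul, show 3 / 4 * T - T / 2 = T / 4 by ring] at hconst
    rw [← hconst]
    refine intervalIntegral.integral_mono_on (by linarith) (by simp) ?_ fun τ hτ =>
      h X τ N hX hN1 hNX hτ.1 hτ.2
    rw [intervalIntegrable_iff_integrableOn_Ioc_of_le (by linarith)]
    simp only [intervalIntegral.integral_of_le (by linarith : T / 4 ≤ T)]
    exact hF.integral_prod_left
  have hup : ∫ t in (T / 4)..T, ∫ τ in (T / 2)..(3 / 4 * T), Real.exp (-(t - τ) ^ 2 / Δ ^ 2) * g t
      ≤ √Real.pi * Δ * ∫ t in (T / 4)..T, g t := by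
    rw [← intervalIntegral.integral_const_mul]
    refine intervalIntegral.integral_mono_on (by linarith) ?_ (cg.intervalIntegrable.const_mul _)
      fun t _ => ?_
    · rw [intervalIntegrable_iff_integrableOn_Ioc_of_le (by linarith)]
      simp only [intervalIntegral.integral_of_le (by linarith : T / 2 ≤ 3 / 4 * T)]
      exact hF.integral_prod_right
    · rw [intervalIntegral.integral_mul_const]
      exact mul_le_mul_of_nonneg_right (hinner t) (by positivity)
  have hfin := (hlow.trans_eq hswap).trans hup
  have hc0 : 0 < √Real.pi * Δ := mul_pos (Real.sqrt_pos.2 Real.pi_pos) hΔ0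
  refine le_of_mul_le_mul_left (le_trans (le_of_eq ?_) hfin) hc0
  ring

/-! ### Continuity of Z' and the bound for large heights -/

/-- The moments start at t = 0, where regularity off the real axis says nothing. Digamma is
therefore treated on Re z > 0, which contains both arguments occurring on the critical line. -/
theorem continuous_deriv_hardyZ : Continuous (deriv hardyZ) := by
  have hfun : deriv hardyZ = fun t : ℝ => (sqrtChi t * (Complex.I *
      (thetaDeriv (1 / 2 + t * Complex.I) * riemannZeta (1 / 2 + t * Complex.I)
        + deriv riemannZeta (1 / 2 + t * Complex.I)))).re :=
    funext fun t => (hasDerivAt_hardyZ t).deriv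
  have hline : Continuous fun t : ℝ => (1 / 2 + t * Complex.I : ℂ) := by fun_prop
  have hdG : ∀ z : ℂ, 0 < z.re → ContinuousAt Complex.digamma z := fun z hz => by
    have hne : ∀ w : ℂ, 0 < w.re → ∀ m : ℕ, w ≠ -m := fun w hw m h => by
      rw [h] at hw
      simp at hw
      linarith [m.cast_nonneg (α := ℝ)]
    have hopen : IsOpen {s : ℂ | 0 < s.re} := isOpen_lt continuous_const Complex.continuous_re
    have h1 : DifferentiableOn ℂ Complex.Gamma {s : ℂ | 0 < s.re} := fun w hw =>
      (Complex.differentiableAt_Gamma w (hne w hw)).differentiableWithinAt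
    exact (((h1.deriv hopen).differentiableAt (hopen.mem_nhds hz)).div
      (h1.differentiableAt (hopen.mem_nhds hz)) (Complex.Gamma_ne_zero (hne z hz))).continuousAt
  have c1 : Continuous fun t : ℝ => thetaDeriv (1 / 2 + t * Complex.I) := by
    refine continuous_const.add (Continuous.div_const (Continuous.add ?_ ?_) _)
    · exact continuous_iff_continuousAt.2 fun t =>
        ContinuousAt.comp (g := Complex.digamma) (hdG _ (by simp)) (by fun_prop)
    · exact continuous_iff_continuousAt.2 fun t =>
        ContinuousAt.comp (g := Complex.digamma) (hdG _ (by norm_num)) (by fun_prop)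
  have c2 : Continuous fun t : ℝ => riemannZeta (1 / 2 + t * Complex.I) :=
    continuous_iff_continuousAt.2 fun t => ContinuousAt.comp (g := riemannZeta)
      (differentiableAt_riemannZeta (half_line_ne_one t)).continuousAt hline.continuousAt
  have c3 : Continuous fun t : ℝ => deriv riemannZeta (1 / 2 + t * Complex.I) := by
    have hd : DifferentiableOn ℂ riemannZeta {1}ᶜ := fun w hw =>
      (differentiableAt_riemannZeta hw).differentiableWithinAt
    exact continuous_iff_continuousAt.2 fun t => ContinuousAt.comp (g := deriv riemannZeta)
      ((hd.deriv isOpen_compl_singleton).differentiableAt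
        (isOpen_compl_singleton.mem_nhds (half_line_ne_one t))).continuousAt hline.continuousAt
  rw [hfun]
  exact Complex.continuous_re.comp
    (sqrtChi_differentiable.continuous.mul (continuous_const.mul ((c1.mul c2).add c3)))

theorem continuous_hardyZ : Continuous hardyZ :=
  continuous_iff_continuousAt.2 fun t => (hasDerivAt_hardyZ t).continuousAt

theorem momentIntegrand_nonneg (k : ℕ) (t : ℝ) :
    0 ≤ deriv hardyZ t ^ 2 * hardyZ t ^ (2 * k - 2) := by
  have e : 2 * k - 2 = 2 * (k - 1) := by omega
  rw [e, pow_mul]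
  positivity

theorem continuous_momentIntegrand (k : ℕ) :
    Continuous fun t => deriv hardyZ t ^ 2 * hardyZ t ^ (2 * k - 2) :=
  (continuous_deriv_hardyZ.pow 2).mul (continuous_hardyZ.pow _)

theorem integral_moment_mono (k : ℕ) {a b c : ℝ} (h1 : 0 ≤ a) (h2 : a ≤ b) (h3 : b ≤ c) :
    ∫ t in a..b, deriv hardyZ t ^ 2 * hardyZ t ^ (2 * k - 2) ≤
      ∫ t in (0 : ℝ)..c, deriv hardyZ t ^ 2 * hardyZ t ^ (2 * k - 2) :=
  intervalIntegral.integral_mono_interval h1 h2 h3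
    (Filter.Eventually.of_forall (momentIntegrand_nonneg k))
    ((continuous_momentIntegrand k).intervalIntegrable _ _)

/-- The lower bound for large heights. -/
theorem exists_moment_lower_bound_of_large {k : ℕ} (hk : 1 ≤ k) :
    ∃ T₁ c : ℝ, 2 ≤ T₁ ∧ 0 < c ∧ ∀ T : ℝ, T₁ ≤ T → c * (T * Real.log T ^ (k ^ 2 + 2)) ≤
      ∫ t in (0 : ℝ)..T, deriv hardyZ t ^ 2 * hardyZ t ^ (2 * k - 2) := by
  obtain ⟨X₀, hX₀, h⟩ := exists_le_integral_norm_zetaPowDeriv_sq hk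
  obtain ⟨C, hC, hS⟩ := exists_sum_piltz_le_mul_sum_piltz_sq k
  have hk0 : (0 : ℝ) < k := by exact_mod_cast hk
  set K : ℕ := k ^ 2 with hK
  have hK0 : 0 < K := by positivity
  have hKr : (0 : ℝ) < K := by exact_mod_cast hK0
  -- The threshold makes X = T^(1/64) at least X₀ and makes its K-th root at least 16. The constant
  -- collects the comparison factor C, the loss log M ≥ log X/(2K), and log T = 64 log X.
  refine ⟨max X₀ (16 ^ K) ^ 64, 2 / C * (1 / (2 * K)) ^ K * (1 / 64) ^ (K + 2), ?_, by positivity,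
    fun T hT => ?_⟩
  · have : (2 : ℝ) ≤ max X₀ (16 ^ K) := hX₀.trans (le_max_left _ _)
    exact this.trans (le_self_pow₀ (by linarith) (by norm_num))
  set m := max X₀ (16 ^ K) with hm
  have hm2 : 2 ≤ m := hX₀.trans (le_max_left _ _)
  have hT0 : 0 < T := lt_of_lt_of_le (by positivity) hT
  set X : ℝ := T ^ (1 / 64 : ℝ) with hXdef
  have hXT : X ^ 64 = T := by
    rw [hXdef, ← Real.rpow_natCast, ← Real.rpow_mul hT0.le]
    norm_num
  have hX0 : 0 < X := Real.rpow_pos_of_pos hT0 _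
  have hmX : m ≤ X := by
    refine le_of_pow_le_pow_left₀ (n := 64) (by norm_num) hX0.le ?_
    rw [hXT]
    exact hT
  have hX₀X : X₀ ≤ X := (le_max_left _ _).trans hmX
  have h16 : (16 : ℝ) ^ K ≤ X := (le_max_right _ _).trans hmX
  have hlogT : Real.log T = 64 * Real.log X := by
    rw [← hXT, Real.log_pow]
    norm_num
  have hlogX : 0 < Real.log X := Real.log_pos (by linarith)
  set Y : ℝ := X ^ (1 / K : ℝ) with hYdef
  have hY0 : 0 < Y := Real.rpow_pos_of_pos hX0 _
  have hYX : Y ^ K = X := by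
    rw [hYdef, ← Real.rpow_natCast, ← Real.rpow_mul hX0.le, one_div_mul_cancel hKr.ne',
      Real.rpow_one]
  have hY16 : 16 ≤ Y := by
    refine le_of_pow_le_pow_left₀ hK0.ne' hY0.le ?_
    rw [hYX]
    exact h16
  have hlogY : Real.log X = K * Real.log Y := by rw [← hYX, Real.log_pow]
  -- The length of the polynomial is N = M^K ≤ X, the form required by the lower bound for
  -- logarithmic sums of d_K.
  set M : ℕ := ⌊Y⌋₊ with hM
  have hM1 : 1 ≤ M := Nat.floor_pos.2 (by linarith)
  have hMY : (M : ℝ) ≤ Y := Nat.floor_le hY0.le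
  have hYM : Y < M + 1 := Nat.lt_floor_add_one Y
  -- Since Y ≥ 16, rounding down still leaves M ≥ √Y.
  have hlogM : Real.log Y / 2 ≤ Real.log M := by
    have e : Real.log Y / 2 = Real.log (√Y) := (Real.log_sqrt hY0.le).symm
    rw [e]
    have hs : √Y * √Y = Y := Real.mul_self_sqrt hY0.le
    have hs4 : 4 ≤ √Y := by
      rw [Real.le_sqrt (by norm_num) hY0.le]
      linarith
    exact Real.log_le_log (by linarith) (by nlinarith)
  have hN1 : 1 ≤ M ^ K := Nat.one_le_pow _ _ hM1
  have hNX : ((M ^ K : ℕ) : ℝ) ≤ X := by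
    rw [← hYX]
    push_cast
    gcongr
  have hmain := h X (M ^ K) hX₀X hN1 hNX
  rw [hXT] at hmain
  have hSlow : (1 / (2 * K) * Real.log X) ^ K ≤ C * piltzMeanSq k (M ^ K) := by
    refine le_trans ?_ ((log_pow_le_sum_piltz_div K M hM1).trans (hS _))
    have hlogY0 : 0 ≤ Real.log Y := Real.log_nonneg (by linarith)
    have e : 1 / (2 * (K : ℝ)) * Real.log X = Real.log Y / 2 := by
      rw [hlogY]
      field_simp
    rw [e]
    exact pow_le_pow_left₀ (by positivity) hlogM K
  have hint : ∫ t in (T / 4)..T, ‖zetaPowDeriv k (1 / 2 + t * Complex.I)‖ ^ 2 =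
      (k : ℝ) ^ 2 * ∫ t in (T / 4)..T, deriv hardyZ t ^ 2 * hardyZ t ^ (2 * k - 2) := by
    rw [← intervalIntegral.integral_const_mul]
    simp only [norm_zetaPowDeriv_sq hk]
  rw [hint] at hmain
  have hmain' : 2 * (T * Real.log X ^ 2 * piltzMeanSq k (M ^ K)) ≤
      ∫ t in (T / 4)..T, deriv hardyZ t ^ 2 * hardyZ t ^ (2 * k - 2) := by
    have hk2 : (0 : ℝ) < (k : ℝ) ^ 2 := by positivity
    refine le_of_mul_le_mul_left (le_trans (le_of_eq ?_) hmain) hk2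
    ring
  refine le_trans ?_ (hmain'.trans (integral_moment_mono k (by linarith) (by linarith) le_rfl))
  rw [hlogT, mul_pow (64 : ℝ)]
  calc 2 / C * (1 / (2 * K)) ^ K * (1 / 64) ^ (K + 2) * (T * (64 ^ (K + 2) * Real.log X ^ (K + 2)))
      = 2 * (T * Real.log X ^ 2 * ((1 / (2 * K) * Real.log X) ^ K / C)) *
        ((1 / 64) ^ (K + 2) * 64 ^ (K + 2)) := by
        rw [mul_pow, pow_add (Real.log X)]
        ring
    _ = 2 * (T * Real.log X ^ 2 * ((1 / (2 * K) * Real.log X) ^ K / C)) := by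
        rw [← mul_pow]
        norm_num
    _ ≤ _ := by
        gcongr
        rw [div_le_iff₀ hC]
        exact hSlow.trans_eq (mul_comm _ _)

/-! ### A threshold independent of k -/

/-- Positivity of the first moment forces positivity of the others over the same interval. -/
theorem moment_pos_of_first_moment_pos {T : ℝ} (hT : 0 ≤ T)
    (h : 0 < ∫ t in (0 : ℝ)..T, deriv hardyZ t ^ 2) (k : ℕ) :
    0 < ∫ t in (0 : ℝ)..T, deriv hardyZ t ^ 2 * hardyZ t ^ (2 * k - 2) := by
  by_contra hneg
  have h0 : ∫ t in (0 : ℝ)..T, deriv hardyZ t ^ 2 * hardyZ t ^ (2 * k - 2) = 0 :=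
    le_antisymm (not_lt.1 hneg) (intervalIntegral.integral_nonneg hT fun t _ =>
      momentIntegrand_nonneg k t)
  have hT0 : 0 < T := by
    refine lt_of_le_of_ne hT fun h1 => ?_
    rw [← h1, intervalIntegral.integral_same] at h
    exact lt_irrefl _ h
  have hzero : ∀ t ∈ Set.Ioo 0 T, deriv hardyZ t = 0 ∨ hardyZ t = 0 := by
    intro t ht
    by_contra hne
    rw [not_or] at hne
    have hpos : 0 < deriv hardyZ t ^ 2 * hardyZ t ^ (2 * k - 2) :=
      lt_of_le_of_ne (momentIntegrand_nonneg k t)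
        (mul_ne_zero (pow_ne_zero _ hne.1) (pow_ne_zero _ hne.2)).symm
    have := intervalIntegral.integral_pos hT0 (continuous_momentIntegrand k).continuousOn
      (fun t _ => momentIntegrand_nonneg k t) ⟨t, ⟨ht.1.le, ht.2.le⟩, hpos⟩
    exact hneg this
  -- If Z' were nonzero at t, it would be nonzero nearby by continuity. Then Z would vanish on a
  -- neighbourhood of t, forcing Z'(t) = 0.
  have hall : ∀ t ∈ Set.Ioo 0 T, deriv hardyZ t = 0 := by
    intro t ht
    by_contra hd
    have hopen : ∀ᶠ u in nhds t, deriv hardyZ u ≠ 0 ∧ u ∈ Set.Ioo 0 T :=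
      (continuous_deriv_hardyZ.continuousAt.eventually_ne hd).and (isOpen_Ioo.mem_nhds ht)
    have hz : hardyZ =ᶠ[nhds t] fun _ => 0 := by
      filter_upwards [hopen] with u hu
      exact (hzero u hu.2).resolve_left hu.1
    exact hd (by rw [hz.deriv_eq, deriv_const])
  have hint : ∫ t in (0 : ℝ)..T, deriv hardyZ t ^ 2 = 0 := by
    rw [intervalIntegral.integral_of_le hT, MeasureTheory.integral_Ioc_eq_integral_Ioo,
      MeasureTheory.setIntegral_congr_fun (g := fun _ => 0) measurableSet_Ioo
        fun t ht => by simp [hall t ht]]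
    simp
  exact h.ne' hint

/-- The threshold is the one found for k = 1, so only the constant has to depend on k. Beyond the
threshold T₂ of the given k the bound for large heights applies. Between T₁ and T₂ the moment is at
least its positive value at T₁, while T (log T)^(k²+2) is at most its value at T₂; the second entry
of the minimum is their quotient. -/
theorem theorem2 (hRH : RiemannHypothesis) :
    ∃ T₀ : ℝ, ∀ k : ℕ, 1 ≤ k → ∃ c : ℝ, 0 < c ∧ ∀ T : ℝ, T₀ ≤ T →
      c * (T * Real.log T ^ (k ^ 2 + 2)) ≤
        ∫ t in (0 : ℝ)..T, deriv hardyZ t ^ 2 * hardyZ t ^ (2 * k - 2) := by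
  obtain ⟨T₁, c₁, hT₁, hc₁, h₁⟩ := exists_moment_lower_bound_of_large (k := 1) le_rfl
  have hlog₁ : 0 < Real.log T₁ := Real.log_pos (by linarith)
  have hpos₁ : 0 < ∫ t in (0 : ℝ)..T₁, deriv hardyZ t ^ 2 := by
    have h := h₁ T₁ le_rfl
    simp only [Nat.sub_self, pow_zero, mul_one] at h
    exact lt_of_lt_of_le (by positivity) h
  refine ⟨T₁, fun k hk => ?_⟩
  obtain ⟨T₂, c₂, hT₂, hc₂, h₂⟩ := exists_moment_lower_bound_of_large hk
  have hlog₂ : 0 < Real.log T₂ := Real.log_pos (by linarith)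
  have hI := moment_pos_of_first_moment_pos (by linarith) hpos₁ k
  set I := ∫ t in (0 : ℝ)..T₁, deriv hardyZ t ^ 2 * hardyZ t ^ (2 * k - 2) with hIdef
  have hD : 0 < T₂ * Real.log T₂ ^ (k ^ 2 + 2) := by positivity
  refine ⟨min c₂ (I / (T₂ * Real.log T₂ ^ (k ^ 2 + 2))), lt_min hc₂ (by positivity), fun T hT => ?_⟩
  have hlogT : 0 ≤ Real.log T := Real.log_nonneg (by linarith)
  have hF : 0 ≤ T * Real.log T ^ (k ^ 2 + 2) := mul_nonneg (by linarith) (by positivity)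
  rcases le_total T₂ T with h | h
  · exact (mul_le_mul_of_nonneg_right (min_le_left _ _) hF).trans (h₂ T h)
  · calc _ ≤ I / (T₂ * Real.log T₂ ^ (k ^ 2 + 2)) * (T₂ * Real.log T₂ ^ (k ^ 2 + 2)) := by
          refine mul_le_mul (min_le_right _ _) ?_ hF (by positivity)
          have := Real.log_le_log (by linarith) h
          gcongr
      _ = I := div_mul_cancel₀ _ hD.ne'
      _ ≤ _ := integral_moment_mono k le_rfl (by linarith) hT
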